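/- Let $r\in(0,1)$, $\beta=\frac{r}{1+r}$, $\lambda_o=\frac{\beta^2+(1-\beta)^2}{4}$, $E=[0,1]$, and let $N^{F^r}$ be the kernel on $E$ given by $$N^{F^r}_x=\lambda_o\big(\beta x\,\delta_{\beta x}+(1-\beta)x\,\delta_{(1-\beta)x}\big),\qquad x\in E .$$ Let $N'f(x)=\frac1{\lambda_o}N^{F^r}f(x)+(1-x)f(x)$ be the associated Markovian kernel (note that $N^{F^r}1(x)=\lambda_o x$). For $x\in E$ let $X=(X_t)_{t\ge0}$ under $\mathbb P^x$ be the pure jump Markov process with generator $\mathcal F^rf(x)=\int_E[f(y)-f(x)]\,N^{F^r}_x(dy)=\lambda_o(N'f-f)(x)$, that is, $X_t=Y(V_t)$, where $(Y(k))_{k\ge0}$ is a time-homogeneous Markov chain on $E$ with $Y(0)=x$ and transition kernel $N'$, and $(V_t)_{t\ge0}$ is a Poisson process with parameter $\lambda_o$ independent of $Y$. Theorem 3.1. For every $x\in E$ such a process $X$ exists, and the stochastic equation of fragmentation for avalanches $$X_t=X_0-2\lambda_o\beta(1-\beta)\int_0^tX_{\alpha-}^2\,d\alpha-\int_0^t\!\int_0^1\!\int_0^\infty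 g(X_{\alpha-},s)\,p(d\alpha,du,ds)+\int_0^t\!\int_0^\infty g(X_{\alpha-},s)\,d\alpha\,ds,\qquad t\ge 0,$$ $$g(y,s)=(1-\beta)\,y\,1_{[\frac{s}{\beta\lambda_o}<y\le1]}+\beta\, y\,1_{[\frac{s}{\lambda_o}<y\le\frac{s}{\beta\lambda_o}]},$$ with initial distribution $\delta_x$, has a weak solution which is equal in distribution with $(X,\mathbb P^x)$. That is, there are a probability space with a right-continuous filtration $(\mathcal G_t)_{t\ge0}$, a Poisson random measure $p$ on $\mathbb R_+\times[0,1]\times\mathbb R_+$ with intensity $d\alpha\,du\,ds$ with respect to $(\mathcal G_t)$ (its restriction to $[0,t]$ is $\mathcal G_t$-measurable and its restriction to $(t,\infty)$ is independent of $\mathcal G_t$, for all $t$), and an $E$-valued càdlàg adapted process with initial distribution $\delta_x$ which almost surely satisfies the equation for all $t\ge0$, all the integrals converging absolutely, and which has the same law on $E^{[0,\infty)}$ (product $\sigma$-algebra) as $(X,\mathbb P^x)$. -/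

import Mathlib

open MeasureTheory ProbabilityTheory Filter Topology
open scoped NNReal ENNReal unitInterval

namespace Avalanche

noncomputable section

/-! ### The jump process of a bounded kernel -/

section JumpProcess

variable {E Ω : Type*} [MeasurableSpace E] [MeasurableSpace Ω]

/-- `‖N1‖_∞`, the supremum of the total masses of the measures `N_x`. -/
def massSup (N : Kernel E E) : ℝ≥0∞ := ⨆ x, N x Set.univ

/-- The Markovian kernel `N' = λ_o⁻¹ N + (1 - λ / λ_o) I` of a bounded kernel `N ≠ 0`, where
`λ(x) = N_x(E)` and `λ_o = ‖N1‖_∞`. -/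
def normalizedKernel (N : Kernel E E) : Kernel E E where
  toFun x := (massSup N)⁻¹ • N x + (1 - (massSup N)⁻¹ * N x Set.univ) • Measure.dirac x
  measurable' := by
    refine Measure.measurable_of_measurable_coe _ fun s hs => ?_
    simp only [Measure.coe_add, Measure.coe_smul, Pi.add_apply, Pi.smul_apply, smul_eq_mul]
    exact ((N.measurable_coe hs).const_mul _).add
      ((measurable_const.sub ((N.measurable_coe MeasurableSet.univ).const_mul _)).mul
        ((Measure.measurable_coe hs).comp Measure.measurable_dirac))

/-- `Y` is a time-homogeneous Markov chain with transition kernel `κ` and initial law `ν`: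
`E[f(Y_{k+1}) | Y_0, …, Y_k] = κf(Y_k)` for all bounded positive measurable `f`. -/
structure IsMarkovChain (κ : Kernel E E) (ν : Measure E) (P : Measure Ω) (Y : ℕ → Ω → E) :
    Prop where
  measurable : ∀ k, Measurable (Y k)
  initial : HasLaw (Y 0) ν P
  transition : ∀ (k : ℕ) (f : E → ℝ), Measurable f → (∀ y, 0 ≤ f y) → (∃ C, ∀ y, f y ≤ C) →
    P[fun ω => f (Y (k + 1) ω) | ⨆ j ≤ k, MeasurableSpace.comap (Y j) inferInstance]
      =ᵐ[P] fun ω => ∫ y, f y ∂(κ (Y k ω))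

/-- `V` is a Poisson process with parameter `c`. The increments are subtractions in `ℕ`, which
do not truncate, as the paths are nondecreasing. -/
structure IsPoissonProcess (c : ℝ≥0) (P : Measure Ω) (V : ℝ≥0 → Ω → ℕ) : Prop where
  measurable : ∀ t, Measurable (V t)
  zero : ∀ ω, V 0 ω = 0
  mono : ∀ ω, Monotone fun t => V t ω
  rightContinuous : ∀ ω t, ContinuousWithinAt (fun s => V s ω) (Set.Ici t) t
  law : ∀ s t, s ≤ t → HasLaw (fun ω => V t ω - V s ω) (poissonMeasure (c * (t - s))) P
  indep : HasIndepIncrements V P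

/-- `X` is the pure jump process of the bounded kernel `N` with initial law `ν`, whose generator
is `f ↦ ∫ (f(y) - f(·)) N(·, dy)`: one has `X_t = Y(V_t)`, with `Y` a Markov chain of transition
kernel `N'` and initial law `ν`, and `V` a Poisson process with parameter `‖N1‖_∞` which is
independent of `Y`. -/
def IsJumpProcess (N : Kernel E E) (ν : Measure E) (P : Measure Ω) (X : ℝ≥0 → Ω → E) : Prop :=
  ∃ (Y : ℕ → Ω → E) (V : ℝ≥0 → Ω → ℕ),
    IsMarkovChain (normalizedKernel N) ν P Y ∧
    IsPoissonProcess (massSup N).toNNReal P V ∧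
    IndepFun (fun ω k => Y k ω) (fun ω t => V t ω) P ∧
    ∀ t ω, X t ω = Y (V t ω) ω

end JumpProcess

/-! ### The discontinuous fragmentation kernel, on the space `E = [0,1]` of sizes -/

/-- `β = r / (1 + r)`, a point of `[0,1]`; `1 - β` is `σ (β r)`. -/
def β (r : Set.Ioo (0 : ℝ) 1) : I :=
  ⟨r / (1 + r), by
    have h0 := r.2.1
    exact ⟨by positivity, (div_le_one (by linarith)).2 (by linarith)⟩⟩

/-- `λ_o = (β² + (1 - β)²) / 4`. -/
def lam (r : Set.Ioo (0 : ℝ) 1) : ℝ := ((β r : ℝ) ^ 2 + (1 - (β r : ℝ)) ^ 2) / 4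

/-- `N^{F^r}_x = λ_o (β x δ_{β x} + (1 - β) x δ_{(1 - β) x})`. -/
def fragKernel (r : Set.Ioo (0 : ℝ) 1) : Kernel I I where
  toFun x :=
    ENNReal.ofReal (lam r * ((β r : ℝ) * x)) • Measure.dirac (β r * x) +
      ENNReal.ofReal (lam r * ((1 - (β r : ℝ)) * x)) • Measure.dirac (σ (β r) * x)
  measurable' := by
    refine Measure.measurable_of_measurable_coe _ fun s hs => ?_
    simp only [Measure.coe_add, Measure.coe_smul, Pi.add_apply, Pi.smul_apply, smul_eq_mul]
    have h1 : Measurable fun x : I => β r * x := (continuous_const.mul continuous_id).measurable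
    have h2 : Measurable fun x : I => σ (β r) * x :=
      (continuous_const.mul continuous_id).measurable
    refine Measurable.add (Measurable.mul ?_ ?_) (Measurable.mul ?_ ?_)
    · exact ENNReal.measurable_ofReal.comp
        (by fun_prop : Measurable fun x : I => lam r * ((β r : ℝ) * x))
    · exact (Measure.measurable_coe hs).comp (Measure.measurable_dirac.comp h1)
    · exact ENNReal.measurable_ofReal.comp
        (by fun_prop : Measurable fun x : I => lam r * ((1 - (β r : ℝ)) * x))
    · exact (Measure.measurable_coe hs).comp (Measure.measurable_dirac.comp h2)

/-- The constant `λ_o` is `‖N^{F^r}1‖_∞`, so that the two uses of the symbol agree. -/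
theorem massSup_fragKernel (r : Set.Ioo (0 : ℝ) 1) :
    massSup (fragKernel r) = ENNReal.ofReal (lam r) := by
  have hl : 0 ≤ lam r := by unfold lam; positivity
  have hb := (β r).2.1
  have hb' := (β r).2.2
  have key : ∀ x : I, fragKernel r x Set.univ = ENNReal.ofReal (lam r * x) := by
    intro x
    have hx := x.2.1
    change (ENNReal.ofReal (lam r * ((β r : ℝ) * x)) • Measure.dirac (β r * x) +
      ENNReal.ofReal (lam r * ((1 - (β r : ℝ)) * x)) • Measure.dirac (σ (β r) * x)) Set.univ = _
    simp only [Measure.coe_add, Measure.coe_smul, Pi.add_apply, Pi.smul_apply, smul_eq_mul,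
      measure_univ, mul_one]
    rw [← ENNReal.ofReal_add (by positivity)
      (mul_nonneg hl (mul_nonneg (by linarith) hx))]
    congr 1
    ring
  unfold massSup
  refine le_antisymm (iSup_le fun x => ?_) ?_
  · rw [key]
    exact ENNReal.ofReal_le_ofReal (mul_le_of_le_one_right hl x.2.2)
  · refine le_trans ?_ (le_iSup _ (1 : I))
    rw [key]
    simp

/-! ### Poisson random measures -/

section Poisson

variable {S Ω : Type*} [MeasurableSpace S] {mΩ : MeasurableSpace Ω}

/-- `p` is a Poisson random measure on `S` with (σ-finite) intensity `q`. -/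
structure IsPoissonRandomMeasure (q : Measure S) (P : Measure Ω) (p : Ω → Measure S) :
    Prop where
  measurable : ∀ A, MeasurableSet A → Measurable fun ω => p ω A
  integerValued : ∀ ω A, MeasurableSet A → ∃ n : ℕ∞, p ω A = n
  law : ∀ A, MeasurableSet A → q A ≠ ∞ →
    HasLaw (fun ω => p ω A)
      ((poissonMeasure (q A).toNNReal).map fun n : ℕ => (n : ℝ≥0∞)) P
  indep : ∀ (n : ℕ) (A : Fin n → Set S), (∀ i, MeasurableSet (A i)) →
    Pairwise (Function.onFun Disjoint A) → iIndepFun (fun i ω => p ω (A i)) P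

/-- `p` is a Poisson random measure on `ℝ₊ × S` with intensity `q` with respect to the
filtration `ℱ`: it is adapted, and its restriction to `(t, ∞) × S` is independent of `ℱ_t`. -/
structure IsPoissonRandomMeasureWrt (ℱ : Filtration ℝ≥0 mΩ) (q : Measure (ℝ≥0 × S))
    (P : Measure Ω) (p : Ω → Measure (ℝ≥0 × S)) : Prop
    extends IsPoissonRandomMeasure q P p where
  past : ∀ (t : ℝ≥0) (A : Set (ℝ≥0 × S)), MeasurableSet A → A ⊆ Set.Iic t ×ˢ Set.univ →
    Measurable[ℱ t] fun ω => p ω A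
  future : ∀ t : ℝ≥0,
    Indep (⨆ A ∈ {A : Set (ℝ≥0 × S) | MeasurableSet A ∧ A ⊆ Set.Ioi t ×ˢ Set.univ},
      MeasurableSpace.comap (fun ω => p ω A) inferInstance) (ℱ t) P

end Poisson

/-! ### The stochastic equation of fragmentation for avalanches -/

/-- Lebesgue measure on `ℝ₊`. -/
def leb : Measure ℝ≥0 := Measure.comap ((↑) : ℝ≥0 → ℝ) volume

/-- `(1 - β) y 1_{[s / (β λ_o) < y ≤ 1]} + β y 1_{[s / λ_o < y ≤ s / (β λ_o)]}`. -/
def jumpSize (r : Set.Ioo (0 : ℝ) 1) (y : I) (s : ℝ≥0) : ℝ := by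
  classical exact
    (if (s : ℝ) / (β r * lam r) < y ∧ (y : ℝ) ≤ 1 then (1 - (β r : ℝ)) * y else 0) +
    (if (s : ℝ) / lam r < y ∧ (y : ℝ) ≤ s / (β r * lam r) then (β r : ℝ) * y else 0)

/-- A path with values in `[0,1]` which is right continuous and has left limits. -/
def IsCadlag (w : ℝ≥0 → I) : Prop :=
  ∀ t, ContinuousWithinAt w (Set.Ici t) t ∧ ∃ l, Tendsto w (𝓝[<] t) (𝓝 l)

/-- The path `w` solves the stochastic equation of fragmentation driven by the point measure
`m(dα, du, ds)` on `ℝ₊ × [0,1] × ℝ₊` (all the integrals being convergent):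
`w_t = w_0 - 2 λ_o β (1 - β) ∫_0^t w_{α-}² dα - ∫_0^t ∫_0^1 ∫_0^∞ g(w_{α-}, s) m(dα, du, ds)
  + ∫_0^t ∫_0^∞ g(w_{α-}, s) dα ds` for all `t ≥ 0`, where `g` is `jumpSize r`. -/
def SolvesFragmentationEquation (r : Set.Ioo (0 : ℝ) 1) (m : Measure (ℝ≥0 × I × ℝ≥0))
    (w : ℝ≥0 → I) : Prop :=
  ∀ t : ℝ≥0,
    IntegrableOn (fun a : ℝ≥0 => ((Function.leftLim w a : I) : ℝ) ^ 2) (Set.Ioc 0 t) leb ∧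
    IntegrableOn (fun z : ℝ≥0 × I × ℝ≥0 => jumpSize r (Function.leftLim w z.1) z.2.2)
      (Set.Ioc 0 t ×ˢ Set.univ) m ∧
    IntegrableOn (fun z : ℝ≥0 × ℝ≥0 => jumpSize r (Function.leftLim w z.1) z.2)
      (Set.Ioc 0 t ×ˢ Set.univ) (leb.prod leb) ∧
    (w t : ℝ) = w 0
      - 2 * lam r * β r * (1 - β r) * ∫ a in Set.Ioc 0 t, ((Function.leftLim w a : I) : ℝ) ^ 2 ∂leb
      - ∫ z in Set.Ioc 0 t ×ˢ Set.univ, jumpSize r (Function.leftLim w z.1) z.2.2 ∂m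
      + ∫ z in Set.Ioc (0 : ℝ≥0) t ×ˢ (Set.univ : Set ℝ≥0),
          jumpSize r (Function.leftLim w z.1) z.2 ∂(leb.prod leb)

/-- `(Ω, ℱ, P, p, X)` is a weak solution, with initial law `ν`, of the stochastic equation of
fragmentation: the filtration is right continuous, `p` is a Poisson random measure with respect
to it, of intensity `dα du ds` on `ℝ₊ × [0,1] × ℝ₊`, and `X` is a càdlàg adapted process which
almost surely solves the equation driven by `p`. -/
structure IsWeakSolution {Ω : Type*} {mΩ : MeasurableSpace Ω} (r : Set.Ioo (0 : ℝ) 1)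
    (ν : Measure I) (P : Measure Ω) (ℱ : Filtration ℝ≥0 mΩ)
    (p : Ω → Measure (ℝ≥0 × I × ℝ≥0)) (X : ℝ≥0 → Ω → I) : Prop where
  rightContinuous : ℱ.IsRightContinuous
  poisson : IsPoissonRandomMeasureWrt ℱ (leb.prod (volume.prod leb)) P p
  adapted : Adapted ℱ X
  cadlag : ∀ ω, IsCadlag fun t => X t ω
  initial : HasLaw (X 0) ν P
  equation : ∀ᵐ ω ∂P, SolvesFragmentationEquation r (p ω) fun t => X t ω

end

end Avalanche

/-!
The marks `s` for which `jumpSize r y s ≠ 0` satisfy `s < λ_o`, whatever `y ∈ [0, 1]` is. So only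
the points of the Poisson random measure with `s < λ_o` act on the solution. They arrive at the
times of a Poisson process with parameter `λ_o`, and their marks `s` are independent and uniform on
`[0, λ_o)`. At such a point the state `y` becomes `y - jumpSize r y s`, which is `β y` with
probability `β y`, `(1 - β) y` with probability `(1 - β) y`, and `y` otherwise: this is exactly one
step of the chain with kernel `N'` (`map_fragStep`). Moreover
`∫ jumpSize r y s ds = 2 λ_o β (1 - β) y²`, so that the drift of the equation cancels the
compensator of the jumps (`lintegral_jumpSize`), and the equation says only that the solution is
the initial state minus the sum of its jumps.

The probability space is built accordingly. For each `n`, the points with mark in the strip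
`[n λ_o, (n + 1) λ_o)` come from a renewal process with exponential waiting times and independent
marks, and the random measure is the sum of these point measures for independent renewal
processes. That it is a Poisson random measure follows from its Laplace functional:

* the Laplace functional `E exp (-∫ f dp) = exp (-∫ (1 - e^{-f}) dq)` implies all the properties of
  a Poisson random measure, since a finite measure on `[0, ∞]^ι` is determined by its Laplace
  transform (`ext_of_lintegral_expNeg`, a consequence of the Stone-Weierstrass theorem);
* marked renewal processes have this functional (`IsMarkedRenewal.hasPoissonLaplace`), because the
  expectation of the contribution of the first `n` points times the exponential of the mean
  contribution of the future does not depend on `n`;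
* the functional is preserved by independent sums (`HasPoissonLaplace.sum`).

The solution is a function of the renewal process of the strip `0`, and the filtration is the right
continuous version of the one generated by the random measure. The solution is adapted to it, since
each point with its mark can be read off the random measure before time `t` by isolating it between
two times of a countable set (`measurableSet_mark_past`). Its jump times are independent of the
marks, so it is a jump process of the kernel (`isJumpProcess_fragProcess`), and all the jump
processes of a kernel with a given initial law have the same law (`IsJumpProcess.map_eq`).
-/

namespace Avalanche

/-! ### Laplace transforms of random vectors with values in `[0, ∞]` -/

/-- The function `x ↦ e^{-x}` on `[0, ∞]`, with `e^{-∞} = 0`. -/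
noncomputable def expNeg (x : ℝ≥0∞) : ℝ≥0∞ := EReal.exp (-(x : EReal))

@[simp] lemma expNeg_zero : expNeg 0 = 1 := by simp [expNeg]

@[simp] lemma expNeg_top : expNeg ∞ = 0 := by simp [expNeg]

lemma expNeg_antitone : Antitone expNeg := fun _ _ h =>
  EReal.exp_monotone (EReal.neg_le_neg_iff.2 (EReal.coe_ennreal_le_coe_ennreal_iff.2 h))

lemma expNeg_le_one (x : ℝ≥0∞) : expNeg x ≤ 1 := by
  simpa using expNeg_antitone ((zero_le : 0 ≤ x))

lemma expNeg_ne_top (x : ℝ≥0∞) : expNeg x ≠ ∞ := ((expNeg_le_one x).trans_lt ENNReal.one_lt_top).ne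

lemma expNeg_coe (x : ℝ≥0) : expNeg x = ENNReal.ofReal (Real.exp (-x)) := by
  simp only [expNeg]
  rw [show ((x : ℝ≥0∞) : EReal) = ((x : ℝ) : EReal) from rfl, ← EReal.coe_neg, EReal.exp_coe]

lemma expNeg_ofReal {x : ℝ} (hx : 0 ≤ x) :
    expNeg (ENNReal.ofReal x) = ENNReal.ofReal (Real.exp (-x)) := by
  lift x to ℝ≥0 using hx
  rw [ENNReal.ofReal_coe_nnreal, expNeg_coe]

lemma expNeg_add (x y : ℝ≥0∞) : expNeg (x + y) = expNeg x * expNeg y := by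
  have h := EReal.exp_add (-(x : EReal)) (-(y : EReal))
  rw [expNeg, expNeg, expNeg, ← h, EReal.coe_ennreal_add, EReal.neg_add]
  · rfl
  · exact Or.inl (EReal.coe_ennreal_ne_bot x)
  · exact Or.inr (EReal.coe_ennreal_ne_bot y)

lemma expNeg_sum {ι : Type*} (s : Finset ι) (f : ι → ℝ≥0∞) :
    expNeg (∑ i ∈ s, f i) = ∏ i ∈ s, expNeg (f i) := by
  classical
  induction s using Finset.induction_on with
  | empty => simp
  | insert a s ha ih => rw [Finset.sum_insert ha, Finset.prod_insert ha, expNeg_add, ih]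

lemma expNeg_injective : Function.Injective expNeg := fun a b h => by
  simpa using EReal.exp_strictMono.injective h

@[fun_prop] lemma continuous_expNeg : Continuous expNeg :=
  (EReal.expHomeomorph.continuous.comp continuous_neg).comp continuous_coe_ennreal_ereal

@[fun_prop] lemma measurable_expNeg : Measurable expNeg := continuous_expNeg.measurable

/-- Two finite measures on a Polish space agree as soon as they give the same integrals to the
members of a separating family of bounded continuous functions which is closed under products. -/
lemma ext_of_monoidHom {M E : Type*} [Monoid M] [TopologicalSpace E] [PolishSpace E]
    [MeasurableSpace E] [BorelSpace E] (e : M →* BoundedContinuousFunction E ℝ)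
    (hsep : ∀ x y, x ≠ y → ∃ m, e m x ≠ e m y) {μ ν : Measure E} [IsFiniteMeasure μ]
    [IsFiniteMeasure ν] (h : ∀ m, ∫ x, e m x ∂μ = ∫ x, e m x ∂ν) : μ = ν := by
  let A : StarSubalgebra ℝ (BoundedContinuousFunction E ℝ) :=
    { Algebra.adjoin ℝ (MonoidHom.mrange e : Set (BoundedContinuousFunction E ℝ)) with
      star_mem' := fun {a} ha => by
        have : star a = a := by ext; simp
        rw [this]; exact ha }
  refine ext_of_forall_mem_subalgebra_integral_eq_of_polish (𝕜 := ℝ) (A := A) ?_ ?_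
  · intro x y hxy
    obtain ⟨m, hm⟩ := hsep x y hxy
    refine ⟨e m, ⟨BoundedContinuousFunction.toContinuousMapStarₐ ℝ (e m), ⟨e m, ?_, rfl⟩, rfl⟩, hm⟩
    exact Algebra.subset_adjoin ⟨m, rfl⟩
  · intro g hg
    have hg' : g ∈ Submodule.span ℝ (MonoidHom.mrange e : Set (BoundedContinuousFunction E ℝ)) := by
      have := Algebra.adjoin_eq_span ℝ (MonoidHom.mrange e : Set (BoundedContinuousFunction E ℝ))
      rw [Submonoid.closure_eq] at this
      rw [← this]; exact hg
    have hi (μ : Measure E) [IsFiniteMeasure μ] (f : BoundedContinuousFunction E ℝ) :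
        Integrable (fun x => f x) μ := f.integrable μ
    change ∫ x, g x ∂μ = ∫ x, g x ∂ν
    clear hg
    induction hg' using Submodule.span_induction with
    | mem x hx => obtain ⟨m, rfl⟩ := hx; exact h m
    | zero => simp
    | add f g hf hg h1 h2 =>
      simp only [BoundedContinuousFunction.coe_add, Pi.add_apply]
      rw [integral_add (hi μ f) (hi μ g), integral_add (hi ν f) (hi ν g), h1, h2]
    | smul a f hf h1 =>
      simp only [BoundedContinuousFunction.coe_smul, smul_eq_mul]
      rw [integral_const_mul, integral_const_mul, h1]

/-- The function `e^{-f}`, as a bounded continuous real function. -/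
noncomputable def expNegBCF {E : Type*} [TopologicalSpace E] (f : E → ℝ≥0∞) (hf : Continuous f) :
    BoundedContinuousFunction E ℝ :=
  BoundedContinuousFunction.ofNormedAddCommGroup (fun x => (expNeg (f x)).toReal)
    (ENNReal.continuousOn_toReal.comp_continuous (by fun_prop) fun x => expNeg_ne_top _) 1
    (fun x => by
      rw [Real.norm_of_nonneg ENNReal.toReal_nonneg]
      exact ENNReal.toReal_le_of_le_ofReal zero_le_one (by simpa using expNeg_le_one _))

lemma expNegBCF_apply {E : Type*} [TopologicalSpace E] (f : E → ℝ≥0∞) (hf : Continuous f) (x : E) :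
    expNegBCF f hf x = (expNeg (f x)).toReal := rfl

/-- A finite measure on `E` is determined by the integrals of the functions `e^{-Σ a_i f_i}`, for
natural numbers `a_i`, where the `f_i : E → [0, ∞]` are continuous and separate points. -/
lemma ext_of_lintegral_expNeg {ι E : Type*} [Fintype ι] [TopologicalSpace E] [PolishSpace E]
    [MeasurableSpace E] [BorelSpace E] (f : ι → E → ℝ≥0∞) (hf : ∀ i, Continuous (f i))
    (hsep : ∀ x y, (∀ i, f i x = f i y) → x = y) {μ ν : Measure E} [IsFiniteMeasure μ]
    [IsFiniteMeasure ν]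
    (h : ∀ a : ι → ℕ, ∫⁻ x, expNeg (∑ i, (a i : ℝ≥0∞) * f i x) ∂μ =
      ∫⁻ x, expNeg (∑ i, (a i : ℝ≥0∞) * f i x) ∂ν) : μ = ν := by
  classical
  have hc (a : ι → ℕ) : Continuous fun x => ∑ i, (a i : ℝ≥0∞) * f i x :=
    continuous_finsetSum _ fun i _ => (ENNReal.continuous_const_mul (by simp)).comp (hf i)
  let e : Multiplicative (ι → ℕ) →* BoundedContinuousFunction E ℝ :=
    { toFun := fun a => expNegBCF (fun x => ∑ i, (Multiplicative.toAdd a i : ℝ≥0∞) * f i x) (hc _)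
      map_one' := by ext x; simp [expNegBCF_apply]
      map_mul' := fun a b => by
        ext x
        simp [expNegBCF_apply, add_mul, Finset.sum_add_distrib, expNeg_add] }
  have he (a) (x : E) : e a x = (expNeg (∑ i, (Multiplicative.toAdd a i : ℝ≥0∞) * f i x)).toReal :=
    rfl
  refine ext_of_monoidHom e (fun x y hxy => ?_) fun a => ?_
  · by_contra! hcon
    refine hxy (hsep x y fun i => expNeg_injective ?_)
    have := hcon (Multiplicative.ofAdd (Pi.single i 1))
    rw [he, he, ENNReal.toReal_eq_toReal_iff' (expNeg_ne_top _) (expNeg_ne_top _)] at this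
    simpa [Pi.single_apply] using this
  · have hi (μ : Measure E) : ∫ x, e a x ∂μ =
        (∫⁻ x, expNeg (∑ i, (Multiplicative.toAdd a i : ℝ≥0∞) * f i x) ∂μ).toReal := by
      simp_rw [he]
      exact integral_toReal (measurable_expNeg.comp (hc _).measurable).aemeasurable
        (ae_of_all _ fun x => (expNeg_ne_top _).lt_top)
    rw [hi, hi, h]

/-! ### Poisson random measures and their Laplace functional -/

section Laplace

variable {S Ω : Type*} [MeasurableSpace S] {mΩ : MeasurableSpace Ω}

/-- The Laplace functional of `p` is that of a Poisson random measure with intensity `q`: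
`E[exp(-∫ f dp)] = exp(-∫ (1 - e^{-f}) dq)` for all measurable `f : S → [0, ∞]`. -/
def HasPoissonLaplace (q : Measure S) (P : Measure Ω) (p : Ω → Measure S) : Prop :=
  ∀ f : S → ℝ≥0∞, Measurable f →
    ∫⁻ ω, expNeg (∫⁻ z, f z ∂(p ω)) ∂P = expNeg (∫⁻ z, (1 - expNeg (f z)) ∂q)

variable {q : Measure S} {P : Measure Ω} {p : Ω → Measure S}

lemma lintegral_expNeg_poissonMeasure (c : ℝ≥0) (a : ℕ) :
    ∫⁻ k : ℕ, expNeg (a * k) ∂(poissonMeasure c) = expNeg ((1 - expNeg a) * c) := by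
  have h1 : ∀ k : ℕ, expNeg (a * k) = ENNReal.ofReal (Real.exp (-a) ^ k) := fun k => by
    rw [← Real.exp_nat_mul, show (a : ℝ≥0∞) * k = ENNReal.ofReal (a * k) by
      rw [ENNReal.ofReal_mul (by positivity)]; simp, expNeg_ofReal (by positivity)]
    congr 2; ring
  have h2 : (1 - expNeg a) * c = ENNReal.ofReal ((1 - Real.exp (-a)) * c) := by
    rw [show (a : ℝ≥0∞) = ENNReal.ofReal a by simp, expNeg_ofReal (by positivity),
      ENNReal.ofReal_mul (by simp), ENNReal.ofReal_sub _ (by positivity)]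
    simp
  rw [h2, expNeg_ofReal (x := (1 - Real.exp (-a)) * c) (mul_nonneg (by simp) c.2)]
  rw [lintegral_countable']
  simp_rw [h1, poissonMeasure_singleton]
  have h3 : HasSum (fun k : ℕ => Real.exp (-a) ^ k * (Real.exp (-c) * c ^ k / (k.factorial)))
      (Real.exp (-((1 - Real.exp (-a)) * c))) := by
    have := (NormedSpace.expSeries_div_hasSum_exp (𝔸 := ℝ) (Real.exp (-a) * c)).mul_left
      (Real.exp (-c))
    rw [← Real.exp_eq_exp_ℝ, ← Real.exp_add] at this
    have e : -((1 - Real.exp (-a)) * c) = -c + Real.exp (-a) * c := by ring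
    rw [e]
    refine this.congr_fun fun k => ?_
    rw [mul_pow]; ring
  rw [← h3.tsum_eq, ENNReal.ofReal_tsum_of_nonneg (fun k => by positivity) h3.summable]
  congr 1 with k
  rw [ENNReal.ofReal_mul (by positivity)]

lemma expNeg_lintegral_add (f g : S → ℝ≥0∞) (hf : Measurable f) (hd : ∀ z, f z = 0 ∨ g z = 0) :
    expNeg (∫⁻ z, (1 - expNeg (f z + g z)) ∂q) =
      expNeg (∫⁻ z, (1 - expNeg (f z)) ∂q) * expNeg (∫⁻ z, (1 - expNeg (g z)) ∂q) := by
  rw [← expNeg_add, ← lintegral_add_left (by fun_prop)]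
  congr 2 with z
  rcases hd z with h | h <;> simp [h]

/-- The integral against `m` of the step function `Σ a_i 1_{A_i}`. -/
lemma lintegral_sum_indicator {ι : Type*} [Fintype ι] (m : Measure S) (a : ι → ℕ) {A : ι → Set S}
    (hA : ∀ i, MeasurableSet (A i)) :
    ∫⁻ z, ∑ i, (A i).indicator (fun _ => (a i : ℝ≥0∞)) z ∂m = ∑ i, (a i : ℝ≥0∞) * m (A i) := by
  rw [lintegral_finsetSum _ fun i _ => measurable_const.indicator (hA i)]
  simp [lintegral_indicator (hA _)]

lemma measurable_sum_indicator {ι : Type*} [Fintype ι] (a : ι → ℕ) {A : ι → Set S}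
    (hA : ∀ i, MeasurableSet (A i)) :
    Measurable fun z => ∑ i, (A i).indicator (fun _ => (a i : ℝ≥0∞)) z :=
  Finset.measurable_sum _ fun i _ => measurable_const.indicator (hA i)

/-- Under a Poisson Laplace functional, the counts of finitely many sets are independent of the
counts of finitely many other sets which are disjoint from the former. -/
lemma HasPoissonLaplace.indepFun_pi [IsProbabilityMeasure P] (hL : HasPoissonLaplace q P p)
    (hm : ∀ A, MeasurableSet A → Measurable fun ω => p ω A) {ι κ : Type*} [Fintype ι] [Fintype κ]
    {A : ι → Set S} {B : κ → Set S} (hA : ∀ i, MeasurableSet (A i)) (hB : ∀ i, MeasurableSet (B i))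
    (hd : ∀ i j, Disjoint (A i) (B j)) :
    IndepFun (fun ω i => p ω (A i)) (fun ω j => p ω (B j)) P := by
  have mA : Measurable fun ω i => p ω (A i) := measurable_pi_lambda _ fun i => hm _ (hA i)
  have mB : Measurable fun ω i => p ω (B i) := measurable_pi_lambda _ fun i => hm _ (hB i)
  rw [indepFun_iff_map_prod_eq_prod_map_map mA.aemeasurable mB.aemeasurable]
  have := Measure.isProbabilityMeasure_map (μ := P) mA.aemeasurable
  have := Measure.isProbabilityMeasure_map (μ := P) mB.aemeasurable
  have := Measure.isProbabilityMeasure_map (μ := P) (mA.prodMk mB).aemeasurable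
  refine ext_of_lintegral_expNeg (ι := ι ⊕ κ)
    (Sum.elim (fun i x => x.1 i) (fun j x => x.2 j)) ?_ ?_ fun a => ?_
  · rintro (i | j) <;> simp only [Sum.elim_inl, Sum.elim_inr] <;> fun_prop
  · rintro ⟨x, x'⟩ ⟨y, y'⟩ h
    ext i
    · exact h (Sum.inl i)
    · exact h (Sum.inr i)
  · simp only [Fintype.sum_sum_type, Sum.elim_inl, Sum.elim_inr]
    have g1 : Measurable fun x : ι → ℝ≥0∞ => expNeg (∑ i, (a (Sum.inl i) : ℝ≥0∞) * x i) := by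
      fun_prop
    have g2 : Measurable fun x : κ → ℝ≥0∞ => expNeg (∑ i, (a (Sum.inr i) : ℝ≥0∞) * x i) := by
      fun_prop
    have f1 := measurable_sum_indicator (fun i => a (Sum.inl i)) hA
    have f2 := measurable_sum_indicator (fun i => a (Sum.inr i)) hB
    simp_rw [expNeg_add]
    rw [lintegral_map (by fun_prop) (mA.prodMk mB), lintegral_prod_mul g1.aemeasurable
      g2.aemeasurable, lintegral_map g1 mA, lintegral_map g2 mB]
    simp_rw [← expNeg_add, ← lintegral_sum_indicator _ _ hA, ← lintegral_sum_indicator _ _ hB]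
    rw [hL _ f1, hL _ f2, ← expNeg_lintegral_add _ _ f1]
    · simp_rw [← lintegral_add_left f1]
      exact hL _ (f1.add f2)
    · intro z
      by_contra! h
      obtain ⟨i, -, hi⟩ := Finset.exists_ne_zero_of_sum_ne_zero h.1
      obtain ⟨j, -, hj⟩ := Finset.exists_ne_zero_of_sum_ne_zero h.2
      exact Set.disjoint_left.1 (hd i j) (Set.mem_of_indicator_ne_zero hi)
        (Set.mem_of_indicator_ne_zero hj)

/-- The Laplace functional of the counts of finitely many disjoint sets. -/
lemma HasPoissonLaplace.lintegral_expNeg_sum (hL : HasPoissonLaplace q P p)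
    {ι : Type*} [Fintype ι] {A : ι → Set S} (hA : ∀ i, MeasurableSet (A i))
    (hd : Pairwise (Function.onFun Disjoint A)) (a : ι → ℕ) :
    ∫⁻ ω, expNeg (∑ i, (a i : ℝ≥0∞) * p ω (A i)) ∂P =
      ∏ i, expNeg ((1 - expNeg (a i)) * q (A i)) := by
  simp_rw [← lintegral_sum_indicator _ _ hA]
  rw [hL _ (measurable_sum_indicator _ hA), ← expNeg_sum]
  congr 1
  have (i : ι) : (1 - expNeg (a i)) * q (A i) =
      ∫⁻ z, (A i).indicator (fun _ => 1 - expNeg (a i)) z ∂q := by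
    simp [lintegral_indicator (hA i)]
  simp_rw [this]
  rw [← lintegral_finsetSum _ fun i _ => measurable_const.indicator (hA i)]
  congr 1 with z
  classical
  by_cases hz : ∃ i, z ∈ A i
  · obtain ⟨i, hi⟩ := hz
    have hj : ∀ j ≠ i, z ∉ A j := fun j hj hzj =>
      Set.disjoint_left.1 (hd hj) hzj hi
    rw [Finset.sum_eq_single i, Finset.sum_eq_single i] <;> simp +contextual [hi, hj]
  · push Not at hz
    simp [hz]

lemma HasPoissonLaplace.lintegral_expNeg (hL : HasPoissonLaplace q P p) {A : Set S}
    (hA : MeasurableSet A) (a : ℕ) :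
    ∫⁻ ω, expNeg (a * p ω A) ∂P = expNeg ((1 - expNeg a) * q A) := by
  simpa using hL.lintegral_expNeg_sum (ι := Unit) (A := fun _ => A) (fun _ => hA)
    (fun i j h => absurd rfl h) (fun _ => a)

lemma HasPoissonLaplace.hasLaw [IsProbabilityMeasure P] (hL : HasPoissonLaplace q P p)
    (hm : ∀ A, MeasurableSet A → Measurable fun ω => p ω A) {A : Set S} (hA : MeasurableSet A)
    (hq : q A ≠ ∞) :
    HasLaw (fun ω => p ω A)
      ((poissonMeasure (q A).toNNReal).map fun n : ℕ => (n : ℝ≥0∞)) P := by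
  refine ⟨(hm A hA).aemeasurable, ?_⟩
  have mc : Measurable fun n : ℕ => (n : ℝ≥0∞) := measurable_from_nat
  have := Measure.isProbabilityMeasure_map (μ := P) (hm A hA).aemeasurable
  have := Measure.isProbabilityMeasure_map (μ := poissonMeasure (q A).toNNReal) mc.aemeasurable
  refine ext_of_lintegral_expNeg (ι := Unit) (fun _ x => x) (fun _ => continuous_id)
    (fun x y h => h ()) fun a => ?_
  simp only [Finset.univ_unique, Finset.sum_singleton]
  rw [lintegral_map (by fun_prop) (hm A hA), lintegral_map (by fun_prop) mc, hL.lintegral_expNeg hA,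
    lintegral_expNeg_poissonMeasure, ENNReal.coe_toNNReal hq]

lemma HasPoissonLaplace.iIndepFun [IsProbabilityMeasure P] (hL : HasPoissonLaplace q P p)
    (hm : ∀ A, MeasurableSet A → Measurable fun ω => p ω A) {ι : Type*} [Fintype ι]
    {A : ι → Set S} (hA : ∀ i, MeasurableSet (A i)) (hd : Pairwise (Function.onFun Disjoint A)) :
    ProbabilityTheory.iIndepFun (fun i ω => p ω (A i)) P := by
  rw [iIndepFun_iff_map_fun_eq_pi_map fun i => (hm _ (hA i)).aemeasurable]
  have mA : Measurable fun ω i => p ω (A i) := measurable_pi_lambda _ fun i => hm _ (hA i)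
  have := Measure.isProbabilityMeasure_map (μ := P) mA.aemeasurable
  have (i : ι) := Measure.isProbabilityMeasure_map (μ := P) (hm _ (hA i)).aemeasurable
  refine ext_of_lintegral_expNeg (fun i x => x i) (fun i => continuous_apply i)
    (fun x y h => funext h) fun a => ?_
  rw [lintegral_map (by fun_prop) mA, hL.lintegral_expNeg_sum hA hd]
  simp_rw [expNeg_sum]
  rw [lintegral_prod_eq_prod_lintegral_of_indepFun _ (fun i (x : ι → ℝ≥0∞) => expNeg (a i * x i))
    (iIndepFun_pi (X := fun i x => expNeg (a i * x)) fun i => by fun_prop) fun i => by fun_prop]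
  refine Finset.prod_congr rfl fun i _ => ?_
  rw [← lintegral_map (f := fun x => expNeg (a i * x)) (by fun_prop) (measurable_pi_apply i),
    (measurePreserving_eval _ i).map_eq, lintegral_map (by fun_prop) (hm _ (hA i)),
    hL.lintegral_expNeg (hA i)]

end Laplace

/-! ### Lebesgue measure on the half-line -/

lemma measurableEmbedding_coe : MeasurableEmbedding ((↑) : ℝ≥0 → ℝ) :=
  NNReal.isClosedEmbedding_coe.measurableEmbedding

lemma map_coe_leb : leb.map ((↑) : ℝ≥0 → ℝ) = volume.restrict (Set.Ici 0) := by
  rw [leb, measurableEmbedding_coe.map_comap]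
  congr 1
  ext x
  exact ⟨fun ⟨y, hy⟩ => hy ▸ y.2, fun hx => ⟨⟨x, hx⟩, rfl⟩⟩

lemma lintegral_leb (f : ℝ → ℝ≥0∞) :
    ∫⁻ r : ℝ≥0, f r ∂leb = ∫⁻ x in Set.Ici 0, f x := by
  rw [← map_coe_leb, measurableEmbedding_coe.lintegral_map]

lemma leb_apply (A : Set ℝ≥0) : leb A = volume ((↑) '' A : Set ℝ) :=
  measurableEmbedding_coe.comap_apply _ _

lemma image_coe_Ioc (s t : ℝ≥0) : ((↑) '' Set.Ioc s t : Set ℝ) = Set.Ioc (s : ℝ) t := by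
  ext x
  constructor
  · rintro ⟨y, hy, rfl⟩; exact_mod_cast hy
  · rintro ⟨h1, h2⟩
    exact ⟨⟨x, s.2.trans h1.le⟩, ⟨h1, h2⟩, rfl⟩

lemma image_coe_Ico (s t : ℝ≥0) : ((↑) '' Set.Ico s t : Set ℝ) = Set.Ico (s : ℝ) t := by
  ext x
  constructor
  · rintro ⟨y, hy, rfl⟩; exact_mod_cast hy
  · rintro ⟨h1, h2⟩
    exact ⟨⟨x, s.2.trans h1⟩, ⟨h1, h2⟩, rfl⟩

lemma leb_Ioc (s t : ℝ≥0) : leb (Set.Ioc s t) = ((t - s : ℝ≥0) : ℝ≥0∞) := by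
  rw [leb_apply, image_coe_Ioc, Real.volume_Ioc]
  rfl

lemma leb_Ico (s t : ℝ≥0) : leb (Set.Ico s t) = ((t - s : ℝ≥0) : ℝ≥0∞) := by
  rw [leb_apply, image_coe_Ico, Real.volume_Ico]
  rfl

instance : NullSingletonClass leb := ⟨fun x => by rw [leb_apply]; simp⟩

instance : SigmaFinite leb := by
  have h : SigmaFinite (leb.map ((↑) : ℝ≥0 → ℝ)) := by rw [map_coe_leb]; infer_instance
  exact h.of_map _ measurableEmbedding_coe.measurable.aemeasurable

/-- Translations carry Lebesgue measure on `[0, ∞)` to Lebesgue measure on `[s, ∞)`. -/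
lemma lintegral_leb_add (s : ℝ≥0) (f : ℝ≥0 → ℝ≥0∞) :
    ∫⁻ r, f (s + r) ∂leb = ∫⁻ v in Set.Ici s, f v ∂leb := by
  have h1 : ∫⁻ v in Set.Ici s, f v ∂leb =
      ∫⁻ x : ℝ, (Set.Ici (s : ℝ)).indicator (fun x => f x.toNNReal) x := by
    rw [← lintegral_indicator measurableSet_Ici]
    have := lintegral_leb ((Set.Ici (s : ℝ)).indicator fun x => f x.toNNReal)
    rw [← lintegral_indicator measurableSet_Ici, Set.indicator_indicator,
      Set.inter_eq_right.2 (Set.Ici_subset_Ici.2 s.2 : Set.Ici (s : ℝ) ⊆ Set.Ici 0)] at this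
    rw [← this]
    congr 1 with r
    simp [Set.indicator_apply]
  have h2 := lintegral_leb fun x => f (s + x.toNNReal)
  simp only [Real.toNNReal_coe] at h2
  rw [h1, h2, ← lintegral_indicator measurableSet_Ici,
    ← lintegral_add_right_eq_self (Set.indicator (Set.Ici (s : ℝ)) _) (s : ℝ)]
  congr 1 with x
  simp only [Set.indicator_apply, Set.mem_Ici, le_add_iff_nonneg_left]
  split_ifs with hx
  · rw [Real.toNNReal_add hx s.coe_nonneg, Real.toNNReal_coe, add_comm]
  · rfl

/-! ### The exponential law -/

/-- The exponential law with parameter `c`, on `[0, ∞)`. -/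
noncomputable def expLaw (c : ℝ≥0) : Measure ℝ≥0 := leb.withDensity fun r => c * expNeg (c * r)

lemma lintegral_expLaw (c : ℝ≥0) (f : ℝ≥0 → ℝ≥0∞) (hf : Measurable f) :
    ∫⁻ r, f r ∂(expLaw c) = ∫⁻ r : ℝ≥0, c * expNeg (c * r) * f r ∂leb := by
  rw [expLaw, lintegral_withDensity_eq_lintegral_mul _ (by fun_prop) hf]
  rfl

/-- For bounded measurable `φ ≥ 0` with infinite integral, `φ(r) e^{-∫_0^r φ}` is a probability
density on the half-line. -/
lemma lintegral_hazard (φ : ℝ → ℝ) (hφ : Measurable φ) (h0 : ∀ x, 0 ≤ φ x) {C : ℝ}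
    (hC : ∀ x, φ x ≤ C) (hinf : Tendsto (fun R => ∫ x in (0 : ℝ)..R, φ x) atTop atTop) :
    ∫⁻ r in Set.Ioi 0, ENNReal.ofReal (φ r * Real.exp (-∫ x in (0 : ℝ)..r, φ x)) = 1 := by
  have hloc : LocallyIntegrable φ volume := by
    refine (locallyIntegrable_const C).mono hφ.aestronglyMeasurable (ae_of_all _ fun x => ?_)
    rw [Real.norm_of_nonneg (h0 x)]
    exact (hC x).trans (le_abs_self C)
  have hint (a b : ℝ) : IntervalIntegrable φ volume a b :=
    (hloc.integrableOn_isCompact isCompact_uIcc).intervalIntegrable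
  set F : ℝ → ℝ := fun r => ∫ x in (0 : ℝ)..r, φ x with hF
  have hC0 : 0 ≤ C := (h0 0).trans (hC 0)
  have hFd (a b : ℝ) : F b - F a = ∫ x in a..b, φ x :=
    intervalIntegral.integral_interval_sub_left (hint _ _) (hint _ _)
  have hmono : Monotone F := fun a b hab => by
    have := intervalIntegral.integral_nonneg hab (fun x _ => h0 x) (μ := volume)
    rw [← hFd] at this
    linarith
  have hF0 : F 0 = 0 := by simp [hF]
  have hFlip : LipschitzWith C.toNNReal F := LipschitzWith.of_dist_le_mul fun a b => by
    rw [Real.dist_eq, Real.dist_eq, Real.coe_toNNReal _ hC0, hFd]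
    refine intervalIntegral.norm_integral_le_of_norm_le_const (f := φ) fun x _ => ?_
    rw [Real.norm_of_nonneg (h0 x)]; exact hC x
  have hFcont : Continuous F := hFlip.continuous
  have key (R : ℝ) (hR : 0 ≤ R) :
      ∫ r in (0 : ℝ)..R, φ r * Real.exp (-F r) = 1 - Real.exp (-F R) := by
    have hac : AbsolutelyContinuousOnInterval (fun r => -Real.exp (-F r)) 0 R := by
      refine AbsolutelyContinuousOnInterval.neg (LipschitzOnWith.absolutelyContinuousOnInterval
        (K := C.toNNReal) (LipschitzOnWith.of_dist_le_mul fun a ha b hb => ?_))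
      rw [Set.uIcc_of_le hR] at ha hb
      refine le_trans ?_ (hFlip.dist_le_mul a b)
      have h2 : ∀ u v : ℝ, 0 ≤ u → u ≤ v → |Real.exp (-u) - Real.exp (-v)| ≤ |u - v| := by
        intro u v hu huv
        rw [abs_of_nonneg (by simpa using huv), abs_of_nonpos (by linarith)]
        have e1 := Real.add_one_le_exp (u - v)
        have e2 : Real.exp (-v) = Real.exp (-u) * Real.exp (u - v) := by
          rw [← Real.exp_add]; congr 1; ring
        have e3 : Real.exp (-u) ≤ 1 := Real.exp_le_one_iff.2 (by linarith)
        have e4 : 0 < Real.exp (-u) := Real.exp_pos _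
        rw [e2]
        nlinarith
      rw [Real.dist_eq, Real.dist_eq]
      rcases le_total a b with h | h
      · exact h2 _ _ (hF0 ▸ hmono ha.1) (hmono h)
      · rw [abs_sub_comm, abs_sub_comm (F a)]
        exact h2 _ _ (hF0 ▸ hmono hb.1) (hmono h)
    have hd : ∀ᵐ r, deriv (fun r => -Real.exp (-F r)) r = φ r * Real.exp (-F r) := by
      filter_upwards [_root_.LocallyIntegrable.ae_hasDerivAt_integral hloc] with r hr
      have := ((hr 0).neg.exp).neg
      rw [HasDerivAt.deriv (f := fun r => -Real.exp (-F r)) this]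
      change -(Real.exp (-F r) * -φ r) = _
      ring
    have := hac.integral_deriv_eq_sub
    rw [intervalIntegral.integral_congr_ae (hd.mono fun r hr _ => hr)] at this
    rw [this, hF0]; simp
    ring
  have hlim : Tendsto (fun R => ∫ r in (0 : ℝ)..R, φ r * Real.exp (-F r)) atTop (𝓝 1) := by
    have h1 : Tendsto (fun R => 1 - Real.exp (-F R)) atTop (𝓝 (1 - 0)) :=
      (Real.tendsto_exp_neg_atTop_nhds_zero.comp hinf).const_sub 1
    rw [sub_zero] at h1
    exact h1.congr' ((eventually_ge_atTop 0).mono fun R hR => (key R hR).symm)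
  have hnn : ∀ r, 0 ≤ φ r * Real.exp (-F r) := fun r => mul_nonneg (h0 r) (Real.exp_pos _).le
  have hii (R : ℝ) : IntegrableOn (fun r => φ r * Real.exp (-F r)) (Set.Ioc 0 R) := by
    have : IntervalIntegrable (fun r => φ r * Real.exp (-F r)) volume 0 R :=
      (hint 0 R).mul_continuousOn (Continuous.continuousOn (by fun_prop))
    exact this.1
  have hI : IntegrableOn (fun r => φ r * Real.exp (-F r)) (Set.Ioi 0) :=
    integrableOn_Ioi_of_intervalIntegral_norm_tendsto 1 0 hii tendsto_id (by
      simpa only [Real.norm_of_nonneg (hnn _)] using hlim)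
  rw [← ofReal_integral_eq_lintegral_ofReal hI (ae_of_all _ hnn),
    tendsto_nhds_unique (intervalIntegral_tendsto_integral_Ioi 0 hI tendsto_id) hlim]
  simp

lemma lintegral_leb_Ico (a b : ℝ≥0) (f : ℝ → ℝ≥0∞) :
    ∫⁻ v : ℝ≥0 in Set.Ico a b, f v ∂leb = ∫⁻ x in Set.Ico (a : ℝ) b, f x := by
  have hsub : Set.Ico (a : ℝ) b ⊆ Set.Ici 0 := fun x hx => a.coe_nonneg.trans hx.1
  rw [← lintegral_indicator measurableSet_Ico]
  have := lintegral_leb ((Set.Ico (a : ℝ) b).indicator f)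
  rw [← lintegral_indicator measurableSet_Ici, Set.indicator_indicator, Set.inter_eq_right.2 hsub,
    lintegral_indicator measurableSet_Ico] at this
  rw [← this]
  congr 1

/-- The survival identity behind the Laplace functional of renewal points: an exponential
waiting time `r` satisfies
`E[h(r) exp(-c ∫_r^∞ (1 - h))] = exp(-c ∫_0^∞ (1 - h))`. -/
lemma lintegral_expLaw_survival_zero {c : ℝ≥0} (hc : 0 < c) {h : ℝ≥0 → ℝ≥0∞} (hm : Measurable h)
    (h1 : ∀ v, h v ≤ 1) {t : ℝ≥0} (ht : ∀ v, t < v → h v = 1) :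
    ∫⁻ r, h r * expNeg (c * ∫⁻ v in Set.Ici r, (1 - h v) ∂leb) ∂(expLaw c) =
      expNeg (c * ∫⁻ v, (1 - h v) ∂leb) := by
  set φ : ℝ → ℝ := fun x => c * (h x.toNNReal).toReal with hφ
  have hφ0 (x) : 0 ≤ φ x := by positivity
  have hφm : Measurable φ := by fun_prop
  have hφC (x) : φ x ≤ c := by
    refine mul_le_of_le_one_right c.coe_nonneg ?_
    exact ENNReal.toReal_le_of_le_ofReal zero_le_one (by simpa using h1 _)
  have hofReal (x) : ENNReal.ofReal (φ x) = c * h x.toNNReal := by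
    rw [hφ, ENNReal.ofReal_mul c.coe_nonneg, ENNReal.ofReal_coe_nnreal, ENNReal.ofReal_toReal]
    exact ((h1 _).trans_lt ENNReal.one_lt_top).ne
  have hloc : LocallyIntegrable φ volume := by
    refine (locallyIntegrable_const (c : ℝ)).mono hφm.aestronglyMeasurable (ae_of_all _ fun x => ?_)
    rw [Real.norm_of_nonneg (hφ0 x)]
    exact (hφC x).trans (le_abs_self _)
  have hint (a b : ℝ) : IntervalIntegrable φ volume a b :=
    (hloc.integrableOn_isCompact isCompact_uIcc).intervalIntegrable
  have hinf : Tendsto (fun R => ∫ x in (0 : ℝ)..R, φ x) atTop atTop := by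
    have h2 : Tendsto (fun R : ℝ => (R - t) * c) atTop atTop :=
      (tendsto_atTop_add_const_right _ (-(t : ℝ)) tendsto_id).atTop_mul_const (by exact_mod_cast hc)
    refine tendsto_atTop_mono' _ ((eventually_ge_atTop (t : ℝ)).mono fun R hR => ?_) h2
    change _ ≤ ∫ x in (0 : ℝ)..R, φ x
    rw [← intervalIntegral.integral_add_adjacent_intervals (hint 0 t) (hint t R)]
    have e1 : 0 ≤ ∫ x in (0 : ℝ)..t, φ x :=
      intervalIntegral.integral_nonneg t.coe_nonneg fun x _ => hφ0 x
    have e2 : ∫ x in (t : ℝ)..R, φ x = ∫ x in (t : ℝ)..R, (c : ℝ) := by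
      refine intervalIntegral.integral_congr_ae (ae_of_all _ fun x hx => ?_)
      rw [Set.uIoc_of_le hR] at hx
      simp only [hφ]
      rw [ht _ ((Real.lt_toNNReal_iff_coe_lt).2 hx.1)]
      simp
    rw [intervalIntegral.integral_const, smul_eq_mul] at e2
    linarith
  have hF (r : ℝ≥0) : ENNReal.ofReal (∫ x in (0 : ℝ)..r, φ x) =
      c * ∫⁻ v in Set.Ico 0 r, h v ∂leb := by
    rw [intervalIntegral.integral_of_le r.coe_nonneg, ofReal_integral_eq_lintegral_ofReal
      (hint 0 r).1 (ae_of_all _ hφ0), ← lintegral_const_mul _ hm,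
      setLIntegral_congr Ioo_ae_eq_Ioc.symm, setLIntegral_congr Ioo_ae_eq_Ico]
    have := lintegral_leb_Ico 0 r fun x => ENNReal.ofReal (φ x)
    simp only [NNReal.coe_zero, hofReal, Real.toNNReal_coe] at this
    simp only [hofReal]
    exact this.symm
  have hsplit (r : ℝ≥0) : (c : ℝ≥0∞) * r + c * ∫⁻ v in Set.Ici r, (1 - h v) ∂leb =
      c * ∫⁻ v, (1 - h v) ∂leb + c * ∫⁻ v in Set.Ico 0 r, h v ∂leb := by
    rw [← mul_add, ← mul_add]
    congr 1
    have e1 : (r : ℝ≥0∞) = ∫⁻ v in Set.Ico 0 r, (1 - h v) ∂leb + ∫⁻ v in Set.Ico 0 r, h v ∂leb := by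
      rw [← lintegral_add_right _ hm]
      simp only [tsub_add_cancel_of_le (h1 _)]
      simp [leb_Ico]
    have e2 : ∫⁻ v, (1 - h v) ∂leb = ∫⁻ v in Set.Ico 0 r, (1 - h v) ∂leb +
        ∫⁻ v in Set.Ici r, (1 - h v) ∂leb := by
      rw [← lintegral_union measurableSet_Ici (Set.disjoint_left.2 fun x h h' => h.2.not_ge h'),
        Set.Ico_union_Ici_eq_Ici (zero_le : 0 ≤ r)]
      simp
    rw [e2]
    nth_rewrite 1 [e1]
    ring
  have hHm : Measurable fun r : ℝ≥0 => ∫⁻ v in Set.Ici r, (1 - h v) ∂leb := by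
    refine Antitone.measurable fun a b hab => ?_
    exact lintegral_mono_set (Set.Ici_subset_Ici.2 hab)
  rw [lintegral_expLaw _ _ (by fun_prop)]
  have hpt (r : ℝ≥0) : c * expNeg (c * r) * (h r * expNeg (c * ∫⁻ v in Set.Ici r, (1 - h v) ∂leb)) =
      expNeg (c * ∫⁻ v, (1 - h v) ∂leb) *
        ENNReal.ofReal (φ r * Real.exp (-∫ x in (0 : ℝ)..r, φ x)) := by
    rw [ENNReal.ofReal_mul (hφ0 _), hofReal, Real.toNNReal_coe, ← expNeg_ofReal
      (intervalIntegral.integral_nonneg r.coe_nonneg fun x _ => hφ0 x), hF]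
    calc _ = c * h r * (expNeg (c * r) * expNeg (c * ∫⁻ v in Set.Ici r, (1 - h v) ∂leb)) := by ring
      _ = _ := by rw [← expNeg_add, hsplit, expNeg_add]; ring
  simp_rw [hpt]
  rw [lintegral_const_mul' _ _ (expNeg_ne_top _),
    lintegral_leb fun x => ENNReal.ofReal (φ x * Real.exp (-∫ x in (0 : ℝ)..x, φ x)),
    setLIntegral_congr Ioi_ae_eq_Ici.symm, lintegral_hazard φ hφm hφ0 hφC hinf, mul_one]

lemma isProbabilityMeasure_expLaw {c : ℝ≥0} (hc : 0 < c) : IsProbabilityMeasure (expLaw c) := by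
  constructor
  simpa using lintegral_expLaw_survival_zero hc (h := fun _ => 1) measurable_const
    (fun _ => le_rfl) (t := 0) (fun _ _ => rfl)

lemma lintegral_expNeg_expLaw {c : ℝ≥0} (hc : 0 < c) :
    ∫⁻ r : ℝ≥0, expNeg r ∂(expLaw c) = c / (c + 1) := by
  have := isProbabilityMeasure_expLaw (c := c + 1) (by positivity)
  have h := lintegral_expLaw (c + 1) (fun _ => 1) measurable_const
  simp only [lintegral_const, measure_univ, mul_one] at h
  rw [lintegral_expLaw _ _ (by fun_prop)]
  have h2 (r : ℝ≥0) : c * expNeg (c * r) * expNeg r =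
      (c / (c + 1)) * (((c + 1 : ℝ≥0) : ℝ≥0∞) * expNeg (((c + 1 : ℝ≥0) : ℝ≥0∞) * r)) := by
    have : (((c + 1 : ℝ≥0) : ℝ≥0∞)) = c + 1 := by simp
    rw [this, add_mul (c : ℝ≥0∞) 1 r, one_mul, expNeg_add, ← mul_assoc,
      ENNReal.div_mul_cancel (by simp) (by simp)]
    ring
  simp_rw [h2]
  rw [lintegral_const_mul _ (by fun_prop), ← h, mul_one]

/-- The survival identity for exponential waiting times, started at time `s`. -/
lemma lintegral_expLaw_survival {c : ℝ≥0} (hc : 0 < c) {h : ℝ≥0 → ℝ≥0∞} (hm : Measurable h)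
    (h1 : ∀ v, h v ≤ 1) {t : ℝ≥0} (ht : ∀ v, t < v → h v = 1) (s : ℝ≥0) :
    ∫⁻ r, h (s + r) * expNeg (c * ∫⁻ v in Set.Ici (s + r), (1 - h v) ∂leb) ∂(expLaw c) =
      expNeg (c * ∫⁻ v in Set.Ici s, (1 - h v) ∂leb) := by
  have key := lintegral_expLaw_survival_zero hc (h := fun r => h (s + r)) (by fun_prop)
    (fun _ => h1 _) (t := t) (fun v hv => ht _ (hv.trans_le le_add_self))
  rw [lintegral_leb_add s (fun v => 1 - h v)] at key
  rw [← key]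
  congr 1 with r
  congr 3
  have := lintegral_leb_add s ((Set.Ici (s + r)).indicator fun v => 1 - h v)
  rw [lintegral_indicator measurableSet_Ici, Measure.restrict_restrict measurableSet_Ici,
    Set.inter_eq_left.2 (Set.Ici_subset_Ici.2 le_self_add)] at this
  rw [← this, ← lintegral_indicator measurableSet_Ici]
  congr 1 with v
  simp [Set.indicator_apply]

/-! ### Points of a renewal process with independent marks -/

section PastOfSequence

variable {Ω E α : Type*} [MeasurableSpace E] [MeasurableSpace α] {mΩ : MeasurableSpace Ω}
  {P : Measure Ω} {ξ : ℕ → Ω → E}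

/-- The σ-algebra generated by the first `n` terms of a sequence of random variables. -/
abbrev pastAlgebra (ξ : ℕ → Ω → E) (n : ℕ) : MeasurableSpace Ω :=
  ⨆ i ∈ Set.Iio n, MeasurableSpace.comap (ξ i) inferInstance

lemma measurable_pastAlgebra {i n : ℕ} (h : i < n) : Measurable[pastAlgebra ξ n] (ξ i) :=
  measurable_iff_comap_le.2 (le_iSup₂ (f := fun i (_ : i ∈ Set.Iio n) =>
    MeasurableSpace.comap (ξ i) inferInstance) i h)

lemma pastAlgebra_mono : Monotone (pastAlgebra ξ) := fun _ _ h =>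
  biSup_mono fun _ hi => lt_of_lt_of_le hi h

lemma pastAlgebra_le (hm : ∀ i, Measurable (ξ i)) (n : ℕ) : pastAlgebra ξ n ≤ mΩ :=
  iSup₂_le fun i _ => measurable_iff_comap_le.1 (hm i)

lemma indepFun_of_pastAlgebra (hξ : iIndepFun ξ P) (hm : ∀ i, Measurable (ξ i)) {n : ℕ} {U : Ω → α}
    (hU : Measurable[pastAlgebra ξ n] U) : IndepFun U (ξ n) P := by
  have h := indep_iSup_of_disjoint (S := Set.Iio n) (T := {n})
    (fun i => measurable_iff_comap_le.1 (hm i)) hξ (by simp)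
  rw [IndepFun_iff_Indep]
  refine indep_of_indep_of_le_left (indep_of_indep_of_le_right h ?_) (measurable_iff_comap_le.1 hU)
  exact le_iSup₂ (f := fun i (_ : i ∈ ({n} : Set ℕ)) =>
    MeasurableSpace.comap (ξ i) inferInstance) n rfl

end PastOfSequence

lemma lintegral_comp_of_indepFun {Ω α β : Type*} [MeasurableSpace α] [MeasurableSpace β]
    {mΩ : MeasurableSpace Ω} {P : Measure Ω} [IsFiniteMeasure P] {U : Ω → α} {W : Ω → β}
    (hU : Measurable U) (hW : Measurable W) (hi : IndepFun U W P) {Φ : α × β → ℝ≥0∞}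
    (hΦ : Measurable Φ) :
    ∫⁻ ω, Φ (U ω, W ω) ∂P = ∫⁻ ω, ∫⁻ w, Φ (U ω, w) ∂(P.map W) ∂P := by
  have h := hi.map_prod_eq_prod_map_map hU.aemeasurable hW.aemeasurable
  rw [← lintegral_map hΦ (hU.prodMk hW), h, lintegral_prod _ hΦ.aemeasurable,
    lintegral_map hΦ.lintegral_prod_right' hU]

/-- `ξ` is a sequence of waiting times with marks: the terms `(τ_k, m_k)` are independent, with
`τ_k` exponential of parameter `c` and `m_k` of law `μ` independent of `τ_k`. All paths (and not
just almost all) have positive waiting times with infinite sum, and marks in the set `M`. -/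
structure IsMarkedRenewal {Ω K : Type*} [MeasurableSpace K] {mΩ : MeasurableSpace Ω} (c : ℝ≥0)
    (μ : Measure K) (M : Set K) (P : Measure Ω) (ξ : ℕ → Ω → ℝ≥0 × K) : Prop where
  measurable : ∀ k, Measurable (ξ k)
  indep : iIndepFun ξ P
  law : ∀ k, P.map (ξ k) = (expLaw c).prod μ
  pos : ∀ k ω, 0 < (ξ k ω).1
  diverges : ∀ ω, ∑' k, ((ξ k ω).1 : ℝ≥0∞) = ∞
  mark_mem : ∀ k ω, (ξ k ω).2 ∈ M

/-- The sum of the first `n` waiting times: the points are `arrival ξ (k + 1)`, for `k ≥ 0`. -/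
def arrival {Ω K : Type*} (ξ : ℕ → Ω → ℝ≥0 × K) (n : ℕ) (ω : Ω) : ℝ≥0 :=
  ∑ i ∈ Finset.range n, (ξ i ω).1

/-- The point measure `Σ_k δ_{(T_k, m_k)}` of the points `T_k` with their marks `m_k`. -/
noncomputable def markedPoints {Ω K : Type*} [MeasurableSpace K] (ξ : ℕ → Ω → ℝ≥0 × K) (ω : Ω) :
    Measure (ℝ≥0 × K) :=
  Measure.sum fun k => Measure.dirac (arrival ξ (k + 1) ω, (ξ k ω).2)

section Arrival

variable {Ω K : Type*} {ξ : ℕ → Ω → ℝ≥0 × K}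

lemma arrival_succ (n : ℕ) (ω : Ω) : arrival ξ (n + 1) ω = arrival ξ n ω + (ξ n ω).1 :=
  Finset.sum_range_succ _ _

@[simp] lemma arrival_zero (ω : Ω) : arrival ξ 0 ω = 0 := rfl

lemma tendsto_arrival (hd : ∀ ω, ∑' k, ((ξ k ω).1 : ℝ≥0∞) = ∞) (ω : Ω) :
    Tendsto (fun n => arrival ξ n ω) atTop atTop := by
  have h := ENNReal.tendsto_nat_tsum fun k => ((ξ k ω).1 : ℝ≥0∞)
  rw [hd ω] at h
  rw [← ENNReal.tendsto_coe_nhds_top]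
  simpa [arrival] using h

end Arrival

section Renewal

variable {Ω K : Type*} [MeasurableSpace K] {mΩ : MeasurableSpace Ω} {c : ℝ≥0}
  {μ : Measure K} {M : Set K} {P : Measure Ω} {ξ : ℕ → Ω → ℝ≥0 × K}

lemma measurable_arrival_pastAlgebra (n : ℕ) : Measurable[pastAlgebra ξ n] (arrival ξ n) :=
  Finset.measurable_sum _ fun _ hi =>
    measurable_fst.comp (measurable_pastAlgebra (Finset.mem_range.1 hi))

lemma measurable_arrival (hm : ∀ i, Measurable (ξ i)) (n : ℕ) : Measurable (arrival ξ n) :=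
  (measurable_arrival_pastAlgebra n).mono (pastAlgebra_le hm n) le_rfl

lemma lintegral_markedPoints (f : ℝ≥0 × K → ℝ≥0∞) (hf : Measurable f) (ω : Ω) :
    ∫⁻ z, f z ∂(markedPoints ξ ω) = ∑' k, f (arrival ξ (k + 1) ω, (ξ k ω).2) := by
  rw [markedPoints, lintegral_sum_measure]
  congr 1 with k
  rw [lintegral_dirac' _ hf]

lemma measurable_point (hm : ∀ i, Measurable (ξ i)) (k : ℕ) :
    Measurable fun ω => (arrival ξ (k + 1) ω, (ξ k ω).2) :=
  (measurable_arrival hm _).prodMk (measurable_snd.comp (hm k))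

lemma measurable_lintegral_markedPoints (hm : ∀ i, Measurable (ξ i)) {f : ℝ≥0 × K → ℝ≥0∞}
    (hf : Measurable f) : Measurable fun ω => ∫⁻ z, f z ∂(markedPoints ξ ω) := by
  simp_rw [lintegral_markedPoints f hf]
  exact Measurable.tsum fun k => hf.comp (measurable_point hm k)

/-- Before the `n`-th point, and with the contribution of the future replaced by its
mean, the Laplace functional has an expectation which does not depend on `n`. -/
lemma lintegral_prod_arrival [IsProbabilityMeasure P] (hc : 0 < c) [IsProbabilityMeasure μ]
    (hm : ∀ k, Measurable (ξ k)) (hi : iIndepFun ξ P)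
    (hl : ∀ k, P.map (ξ k) = (expLaw c).prod μ) {g : ℝ≥0 × K → ℝ≥0∞} (hg : Measurable g)
    (hg1 : ∀ z, g z ≤ 1) {t : ℝ≥0} (ht : ∀ z, t < z.1 → g z = 1) (n : ℕ) :
    ∫⁻ ω, (∏ k ∈ Finset.range n, g (arrival ξ (k + 1) ω, (ξ k ω).2)) *
        expNeg (c * ∫⁻ v in Set.Ici (arrival ξ n ω), (1 - ∫⁻ m, g (v, m) ∂μ) ∂leb) ∂P =
      expNeg (c * ∫⁻ v, (1 - ∫⁻ m, g (v, m) ∂μ) ∂leb) := by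
  have := isProbabilityMeasure_expLaw hc
  set h : ℝ≥0 → ℝ≥0∞ := fun v => ∫⁻ m, g (v, m) ∂μ with hh
  have hhm : Measurable h := hg.lintegral_prod_right'
  have hh1 (v) : h v ≤ 1 := by
    calc h v ≤ ∫⁻ m, 1 ∂μ := lintegral_mono fun m => hg1 _
      _ = 1 := by simp
  have hht (v) (hv : t < v) : h v = 1 := by
    simp only [hh, ht _ (show t < (v, _).1 from hv)]; simp
  have hHm : Measurable fun r : ℝ≥0 => ∫⁻ v in Set.Ici r, (1 - h v) ∂leb :=
    Antitone.measurable fun a b hab => lintegral_mono_set (Set.Ici_subset_Ici.2 hab)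
  induction n with
  | zero => simp [show Set.Ici (0 : ℝ≥0) = Set.univ from Set.Ici_bot]
  | succ n ih =>
    rw [← ih]
    have hU : Measurable[pastAlgebra ξ n] fun ω =>
        (∏ k ∈ Finset.range n, g (arrival ξ (k + 1) ω, (ξ k ω).2), arrival ξ n ω) := by
      refine Measurable.prodMk (Finset.measurable_prod _ fun k hk => hg.comp
        (Measurable.prodMk ?_ ?_)) (measurable_arrival_pastAlgebra n)
      · exact (measurable_arrival_pastAlgebra (k + 1)).mono
          (pastAlgebra_mono (Finset.mem_range.1 hk)) le_rfl
      · exact measurable_snd.comp (measurable_pastAlgebra (Finset.mem_range.1 hk))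
    have hind := indepFun_of_pastAlgebra hi hm hU
    have hΦ : Measurable fun z : (ℝ≥0∞ × ℝ≥0) × (ℝ≥0 × K) => z.1.1 * g (z.1.2 + z.2.1, z.2.2) *
        expNeg (c * ∫⁻ v in Set.Ici (z.1.2 + z.2.1), (1 - h v) ∂leb) := by
      have h1 : Measurable fun z : (ℝ≥0∞ × ℝ≥0) × (ℝ≥0 × K) => z.1.2 + z.2.1 := by fun_prop
      have h2 := hHm.comp h1
      have h3 := hg.comp (h1.prodMk (measurable_snd.comp measurable_snd))
      simp only [Function.comp_def] at h2 h3
      fun_prop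
    have key := lintegral_comp_of_indepFun (hU.mono (pastAlgebra_le hm n) le_rfl) (hm n) hind hΦ
    simp only [hl] at key
    simp_rw [Finset.prod_range_succ, arrival_succ]
    simp_rw [arrival_succ] at key
    rw [key]
    congr 1 with ω
    have hΦ' := hΦ.comp (measurable_prodMk_left (x := (∏ k ∈ Finset.range n,
      g (arrival ξ (k + 1) ω, (ξ k ω).2), arrival ξ n ω)))
    simp only [Function.comp_def, arrival_succ] at hΦ'
    rw [lintegral_prod _ hΦ'.aemeasurable]
    have hHm' : Measurable fun r : ℝ≥0 =>
        ∫⁻ v in Set.Ici (arrival ξ n ω + r), (1 - h v) ∂leb := hHm.comp (by fun_prop)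
    have hm' : Measurable fun r : ℝ≥0 => h (arrival ξ n ω + r) *
        expNeg (c * ∫⁻ v in Set.Ici (arrival ξ n ω + r), (1 - h v) ∂leb) :=
      (hhm.comp (by fun_prop)).mul (measurable_expNeg.comp (hHm'.const_mul _))
    rw [← lintegral_expLaw_survival hc hhm hh1 hht (arrival ξ n ω), ← lintegral_const_mul _ hm']
    congr 1 with r
    dsimp only
    rw [lintegral_mul_const _ (by fun_prop), lintegral_const_mul _ (by fun_prop), mul_assoc]

lemma IsMarkedRenewal.tendsto_arrival (hξ : IsMarkedRenewal c μ M P ξ) (ω : Ω) :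
    Tendsto (fun n => arrival ξ n ω) atTop atTop :=
  Avalanche.tendsto_arrival hξ.diverges ω

/-- The marked points of a renewal process with exponential waiting times have the Laplace
functional of a Poisson random measure. -/
lemma IsMarkedRenewal.hasPoissonLaplace [IsProbabilityMeasure P] (hc : 0 < c)
    [IsProbabilityMeasure μ] (hξ : IsMarkedRenewal c μ M P ξ) :
    HasPoissonLaplace (leb.prod (c • μ)) P (markedPoints ξ) := by
  have hq (f : ℝ≥0 × K → ℝ≥0∞) (hf : Measurable f) : ∫⁻ z, (1 - expNeg (f z)) ∂(leb.prod (c • μ)) =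
      c * ∫⁻ v, (1 - ∫⁻ m, expNeg (f (v, m)) ∂μ) ∂leb := by
    rw [lintegral_prod _ (by fun_prop), ← lintegral_const_mul _ (by fun_prop)]
    congr 1 with v
    rw [lintegral_smul_measure, lintegral_sub (by fun_prop)
      (ne_top_of_le_ne_top ENNReal.one_ne_top ?_) (ae_of_all _ fun m => expNeg_le_one _)]
    · simp [ENNReal.smul_def]
    · calc ∫⁻ m, expNeg (f (v, m)) ∂μ ≤ ∫⁻ m, 1 ∂μ := lintegral_mono fun m => expNeg_le_one _
        _ = 1 := by simp
  -- the case of a test function which vanishes after time `t`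
  have main (f : ℝ≥0 × K → ℝ≥0∞) (hf : Measurable f) (t : ℝ≥0) (ht : ∀ z, t < z.1 → f z = 0) :
      ∫⁻ ω, expNeg (∫⁻ z, f z ∂(markedPoints ξ ω)) ∂P =
        expNeg (∫⁻ z, (1 - expNeg (f z)) ∂(leb.prod (c • μ))) := by
    rw [hq f hf]
    have hg : Measurable fun z => expNeg (f z) := by fun_prop
    have hHm : Measurable fun r : ℝ≥0 =>
        ∫⁻ v in Set.Ici r, (1 - ∫⁻ m, expNeg (f (v, m)) ∂μ) ∂leb :=
      Antitone.measurable fun a b hab => lintegral_mono_set (Set.Ici_subset_Ici.2 hab)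
    have hlim : Tendsto (fun n => ∫⁻ ω, (∏ k ∈ Finset.range n,
        expNeg (f (arrival ξ (k + 1) ω, (ξ k ω).2))) * expNeg (c * ∫⁻ v in Set.Ici (arrival ξ n ω),
          (1 - ∫⁻ m, expNeg (f (v, m)) ∂μ) ∂leb) ∂P) atTop
        (𝓝 (∫⁻ ω, expNeg (∫⁻ z, f z ∂(markedPoints ξ ω)) ∂P)) := by
      refine tendsto_lintegral_of_dominated_convergence (fun _ => 1) (fun n => ?_) (fun n => ?_)
        (by simp) (ae_of_all _ fun ω => ?_)
      · refine Measurable.mul (Finset.measurable_prod _ fun k _ =>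
          hg.comp (measurable_point hξ.measurable k)) ?_
        have := hHm.comp (measurable_arrival hξ.measurable n)
        simp only [Function.comp_def] at this
        fun_prop
      · exact ae_of_all _ fun ω => mul_le_one' (Finset.prod_le_one' fun k _ => expNeg_le_one _)
          (expNeg_le_one _)
      · have h1 : Tendsto (fun n => ∏ k ∈ Finset.range n,
            expNeg (f (arrival ξ (k + 1) ω, (ξ k ω).2))) atTop
            (𝓝 (expNeg (∫⁻ z, f z ∂(markedPoints ξ ω)))) := by
          rw [lintegral_markedPoints f hf]
          simp_rw [← expNeg_sum]
          exact (continuous_expNeg.tendsto _).comp (ENNReal.tendsto_nat_tsum _)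
        refine h1.congr' ?_
        filter_upwards [(hξ.tendsto_arrival ω).eventually_gt_atTop t] with n hn
        have : ∫⁻ v in Set.Ici (arrival ξ n ω), (1 - ∫⁻ m, expNeg (f (v, m)) ∂μ) ∂leb = 0 := by
          rw [setLIntegral_congr_fun (g := fun _ => 0) measurableSet_Ici]
          · simp
          · intro v hv
            simp [ht (v, _) (hn.trans_le hv)]
        rw [this]; simp
    refine tendsto_nhds_unique hlim ?_
    simp_rw [lintegral_prod_arrival hc hξ.measurable hξ.indep hξ.law hg
      (fun z => expNeg_le_one _) (t := t) (fun z hz => by simp [ht z hz])]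
    exact tendsto_const_nhds
  intro f hf
  set F : ℕ → ℝ≥0 × K → ℝ≥0∞ := fun N => (Set.Iic (N : ℝ≥0) ×ˢ Set.univ).indicator f with hF
  have hFm (N) : Measurable (F N) := hf.indicator (measurableSet_Iic.prod .univ)
  have hFmono : Monotone F := fun a b hab =>
    Set.indicator_le_indicator_of_subset (Set.prod_mono
      (Set.Iic_subset_Iic.2 (by exact_mod_cast hab)) subset_rfl) (fun _ => zero_le)
  have hFlim (z) : ∀ᶠ N in atTop, F N z = f z := by
    filter_upwards [tendsto_natCast_atTop_atTop.eventually_ge_atTop z.1] with N hN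
    simp [hF, hN]
  have hl (m : Measure (ℝ≥0 × K)) : Tendsto (fun N => ∫⁻ z, F N z ∂m) atTop (𝓝 (∫⁻ z, f z ∂m)) :=
    lintegral_tendsto_of_tendsto_of_monotone (fun N => (hFm N).aemeasurable)
      (ae_of_all _ fun z a b hab => hFmono hab z)
      (ae_of_all _ fun z => tendsto_const_nhds.congr' ((hFlim z).mono fun _ h => h.symm))
  have hl' : Tendsto (fun N => ∫⁻ z, (1 - expNeg (F N z)) ∂(leb.prod (c • μ))) atTop
      (𝓝 (∫⁻ z, (1 - expNeg (f z)) ∂(leb.prod (c • μ)))) :=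
    lintegral_tendsto_of_tendsto_of_monotone (fun N => by have := hFm N; fun_prop)
      (ae_of_all _ fun z a b hab => tsub_le_tsub_left (expNeg_antitone (hFmono hab z)) _)
      (ae_of_all _ fun z => tendsto_const_nhds.congr' ((hFlim z).mono fun N h => by
        simp only [h]))
  have h1 : Tendsto (fun N => ∫⁻ ω, expNeg (∫⁻ z, F N z ∂(markedPoints ξ ω)) ∂P) atTop
      (𝓝 (∫⁻ ω, expNeg (∫⁻ z, f z ∂(markedPoints ξ ω)) ∂P)) :=
    tendsto_lintegral_of_dominated_convergence (fun _ => 1)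
      (fun N => measurable_expNeg.comp (measurable_lintegral_markedPoints hξ.measurable (hFm N)))
      (fun N => ae_of_all _ fun ω => expNeg_le_one _) (by simp)
      (ae_of_all _ fun ω => (continuous_expNeg.tendsto _).comp (hl _))
  refine tendsto_nhds_unique h1 ?_
  have h2 := (continuous_expNeg.tendsto _).comp hl'
  refine h2.congr fun N => ?_
  refine (main (F N) (hFm N) N fun z hz => ?_).symm
  exact Set.indicator_of_notMem (fun h => (h.1 : z.1 ≤ N).not_gt hz) _

/-- Marked renewal sequences exist, on a probability space on which all paths are regular. -/
lemma exists_isMarkedRenewal {K : Type} [MeasurableSpace K] {c : ℝ≥0} (hc : 0 < c) (μ : Measure K)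
    [IsProbabilityMeasure μ] {M : Set K} (hM : MeasurableSet M) (hμ : ∀ᵐ m ∂μ, m ∈ M) :
    ∃ (Ω : Type) (_ : MeasurableSpace Ω) (P : Measure Ω) (_ : IsProbabilityMeasure P)
      (ξ : ℕ → Ω → ℝ≥0 × K), IsMarkedRenewal c μ M P ξ := by
  have := isProbabilityMeasure_expLaw hc
  obtain ⟨m₀, hm₀⟩ := hμ.exists
  set ν := (expLaw c).prod μ
  set P : Measure (ℕ → ℝ≥0 × K) := Measure.infinitePi fun _ => ν
  have hev (k : ℕ) : MeasurePreserving (fun ω : ℕ → ℝ≥0 × K => ω k) P ν :=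
    measurePreserving_eval_infinitePi (fun _ => ν) k
  have hind : iIndepFun (fun k (ω : ℕ → ℝ≥0 × K) => ω k) P :=
    iIndepFun_infinitePi (X := fun _ z => z) fun _ => measurable_id
  set G : Set (ℕ → ℝ≥0 × K) :=
    {ω | (∀ k, 0 < (ω k).1 ∧ (ω k).2 ∈ M) ∧ ∑' k, ((ω k).1 : ℝ≥0∞) = ∞} with hG
  have hGm : MeasurableSet G := by
    rw [hG, Set.ofPred_and, Set.ofPred_forall]
    refine (MeasurableSet.iInter fun k => ?_).inter ?_
    · rw [Set.ofPred_and]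
      refine MeasurableSet.inter ?_ ?_
      · exact measurableSet_lt measurable_const (measurable_fst.comp (measurable_pi_apply k))
      · exact (measurable_snd.comp (measurable_pi_apply k)) hM
    · exact (Measurable.tsum fun k => measurable_coe_nnreal_ennreal.comp
        (measurable_fst.comp (measurable_pi_apply k))) (measurableSet_singleton ∞)
  have hν : ∀ᵐ z ∂ν, 0 < z.1 ∧ z.2 ∈ M := by
    have h1 : ∀ᵐ r ∂(expLaw c), 0 < r := by
      refine (withDensity_absolutelyContinuous leb _).ae_le ?_
      filter_upwards [compl_mem_ae_iff.2 (measure_singleton (μ := leb) 0)] with r hr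
      exact pos_iff_ne_zero.2 hr
    filter_upwards [Measure.quasiMeasurePreserving_fst.ae h1,
      Measure.quasiMeasurePreserving_snd.ae hμ] with z hz hz' using ⟨hz, hz'⟩
  have hdiv : ∀ᵐ ω ∂P, ∑' k, ((ω k).1 : ℝ≥0∞) = ∞ := by
    have hlt : (c : ℝ≥0∞) / (c + 1) < 1 := by
      rw [ENNReal.div_lt_iff (by simp) (by simp), one_mul]
      exact ENNReal.lt_add_right ENNReal.coe_ne_top one_ne_zero
    have hpow (n : ℕ) : ∫⁻ ω, expNeg (∑ k ∈ Finset.range n, ((ω k).1 : ℝ≥0∞)) ∂P =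
        ((c : ℝ≥0∞) / (c + 1)) ^ n := by
      simp_rw [expNeg_sum]
      rw [lintegral_prod_eq_prod_lintegral_of_indepFun _
        (fun k (ω : ℕ → ℝ≥0 × K) => expNeg ((ω k).1 : ℝ≥0∞))
        (hind.comp (fun _ z => expNeg (z.1 : ℝ≥0∞)) fun _ => by fun_prop) fun k => by fun_prop]
      rw [Finset.prod_congr rfl fun k _ => ?_, Finset.prod_const, Finset.card_range]
      rw [(hev k).lintegral_comp (f := fun z => expNeg (z.1 : ℝ≥0∞)) (by fun_prop),
        lintegral_prod _ (by fun_prop)]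
      simp [lintegral_expNeg_expLaw hc]
    have hmeas : Measurable fun ω : ℕ → ℝ≥0 × K => expNeg (∑' k, ((ω k).1 : ℝ≥0∞)) :=
      measurable_expNeg.comp (Measurable.tsum fun k => by fun_prop)
    have h0 : ∫⁻ ω, expNeg (∑' k, ((ω k).1 : ℝ≥0∞)) ∂P = 0 := by
      refine le_antisymm (ge_of_tendsto' (ENNReal.tendsto_pow_atTop_nhds_zero_of_lt_one hlt)
        fun n => ?_) zero_le
      rw [← hpow n]
      exact lintegral_mono fun ω => expNeg_antitone (ENNReal.sum_le_tsum _)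
    rw [lintegral_eq_zero_iff hmeas] at h0
    filter_upwards [h0] with ω hω
    exact expNeg_injective (hω.trans expNeg_top.symm)
  have hae : ∀ᵐ ω ∂P, ω ∈ G := by
    filter_upwards [ae_all_iff.2 fun k => (hev k).quasiMeasurePreserving.ae hν, hdiv] with ω h1 h2
    exact ⟨h1, h2⟩
  classical
  set ξ : ℕ → (ℕ → ℝ≥0 × K) → ℝ≥0 × K := fun k ω => if ω ∈ G then ω k else (1, m₀) with hξ
  have hξae (k : ℕ) : (fun ω : ℕ → ℝ≥0 × K => ω k) =ᵐ[P] ξ k := by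
    filter_upwards [hae] with ω hω
    simp [hξ, hω]
  refine ⟨ℕ → ℝ≥0 × K, inferInstance, P, inferInstance, ξ, ?_, hind.congr hξae, ?_, ?_, ?_, ?_⟩
  · exact fun k => Measurable.ite hGm (measurable_pi_apply k) measurable_const
  · intro k
    rw [← Measure.map_congr (hξae k), (hev k).map_eq]
  · intro k ω
    by_cases h : ω ∈ G
    · simpa [hξ, h] using (h.1 k).1
    · simp [hξ, h]
  · intro ω
    by_cases h : ω ∈ G
    · simpa [hξ, h] using h.2
    · simp [hξ, h]
  · intro k ω
    by_cases h : ω ∈ G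
    · simpa [hξ, h] using (h.1 k).2
    · simpa [hξ, h] using hm₀

end Renewal

/-! ### Superposition of independent Poisson random measures -/

lemma lintegral_prod_infinitePi {Ω : ℕ → Type*} [∀ n, MeasurableSpace (Ω n)]
    (P : ∀ n, Measure (Ω n)) [∀ n, IsProbabilityMeasure (P n)] (F : ∀ n, Ω n → ℝ≥0∞)
    (hF : ∀ n, Measurable (F n)) (s : Finset ℕ) :
    ∫⁻ ω, ∏ n ∈ s, F n (ω n) ∂(Measure.infinitePi P) = ∏ n ∈ s, ∫⁻ ω, F n ω ∂(P n) := by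
  rw [lintegral_prod_eq_prod_lintegral_of_indepFun s (fun n (ω : ∀ n, Ω n) => F n (ω n))
    (iIndepFun_infinitePi hF) fun n => (hF n).comp (measurable_pi_apply n)]
  exact Finset.prod_congr rfl fun n _ =>
    (measurePreserving_eval_infinitePi P n).lintegral_comp (hF n)

/-- The sum of a sequence of independent random measures with Poisson Laplace functionals. -/
lemma HasPoissonLaplace.sum {S : Type*} [MeasurableSpace S] {Ω : ℕ → Type*}
    [∀ n, MeasurableSpace (Ω n)] {P : ∀ n, Measure (Ω n)} [∀ n, IsProbabilityMeasure (P n)]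
    {p : ∀ n, Ω n → Measure S} {q : ℕ → Measure S}
    (hm : ∀ n (f : S → ℝ≥0∞), Measurable f → Measurable fun ω => ∫⁻ z, f z ∂(p n ω))
    (hL : ∀ n, HasPoissonLaplace (q n) (P n) (p n)) :
    HasPoissonLaplace (Measure.sum q) (Measure.infinitePi P)
      fun ω => Measure.sum fun n => p n (ω n) := by
  intro f hf
  simp_rw [lintegral_sum_measure]
  have h1 : Tendsto (fun N => ∫⁻ ω, expNeg (∑ n ∈ Finset.range N, ∫⁻ z, f z ∂(p n (ω n)))
      ∂(Measure.infinitePi P)) atTop (𝓝 (∫⁻ ω, expNeg (∑' n, ∫⁻ z, f z ∂(p n (ω n)))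
      ∂(Measure.infinitePi P))) := by
    refine tendsto_lintegral_of_dominated_convergence (fun _ => 1) (fun N => ?_)
      (fun N => ae_of_all _ fun ω => expNeg_le_one _) (by simp) (ae_of_all _ fun ω =>
        (continuous_expNeg.tendsto _).comp (ENNReal.tendsto_nat_tsum _))
    exact measurable_expNeg.comp (Finset.measurable_sum _ fun n _ =>
      (hm n f hf).comp (measurable_pi_apply n))
  refine tendsto_nhds_unique h1 ?_
  have h2 (N : ℕ) : ∫⁻ ω, expNeg (∑ n ∈ Finset.range N, ∫⁻ z, f z ∂(p n (ω n)))
      ∂(Measure.infinitePi P) =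
      expNeg (∑ n ∈ Finset.range N, ∫⁻ z, (1 - expNeg (f z)) ∂(q n)) := by
    simp_rw [expNeg_sum]
    rw [lintegral_prod_infinitePi P (fun n ω => expNeg (∫⁻ z, f z ∂(p n ω)))
      fun n => measurable_expNeg.comp (hm n f hf)]
    exact Finset.prod_congr rfl fun n _ => hL n f hf
  simp_rw [h2]
  exact (continuous_expNeg.tendsto _).comp (ENNReal.tendsto_nat_tsum _)

/-- A countable sum of Dirac masses takes its values in `ℕ ∪ {∞}`. -/
lemma exists_enat_sum_dirac {S ι : Type*} [MeasurableSpace S] (z : ι → S) {A : Set S}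
    (hA : MeasurableSet A) : ∃ n : ℕ∞, (Measure.sum fun i => Measure.dirac (z i)) A = n := by
  refine ⟨{i | z i ∈ A}.encard, ?_⟩
  let : MeasurableSpace ι := ⊤
  rw [← Measure.count_apply MeasurableSpace.measurableSet_top, Measure.count,
    Measure.sum_apply _ hA, Measure.sum_apply _ MeasurableSpace.measurableSet_top]
  congr 1 with i
  rw [Measure.dirac_apply' _ hA, Measure.dirac_apply' _ MeasurableSpace.measurableSet_top]
  rfl

/-! ### The filtration of a Poisson random measure -/

section Filtration

variable {S Ω : Type*} [MeasurableSpace S] {mΩ : MeasurableSpace Ω}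
  {q : Measure (ℝ≥0 × S)} {P : Measure Ω} {p : Ω → Measure (ℝ≥0 × S)}

/-- The filtration generated by the restrictions of `p` to the time intervals `[0, t]`. -/
def pointFiltration (p : Ω → Measure (ℝ≥0 × S))
    (hm : ∀ A, MeasurableSet A → Measurable fun ω => p ω A) : Filtration ℝ≥0 mΩ where
  seq t := ⨆ A ∈ {A : Set (ℝ≥0 × S) | MeasurableSet A ∧ A ⊆ Set.Iic t ×ˢ Set.univ},
    MeasurableSpace.comap (fun ω => p ω A) inferInstance
  mono' _ _ h := biSup_mono fun _ hA =>
    ⟨hA.1, hA.2.trans (Set.prod_mono (Set.Iic_subset_Iic.2 h) subset_rfl)⟩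
  le' _ := iSup₂_le fun A hA => measurable_iff_comap_le.1 (hm A hA.1)

lemma measurable_pointFiltration {hm : ∀ A, MeasurableSet A → Measurable fun ω => p ω A} {t : ℝ≥0}
    {A : Set (ℝ≥0 × S)} (hA : MeasurableSet A) (hAt : A ⊆ Set.Iic t ×ˢ Set.univ) :
    Measurable[pointFiltration p hm t] fun ω => p ω A :=
  measurable_iff_comap_le.2 (le_iSup₂ (f := fun A
    (_ : A ∈ {A : Set (ℝ≥0 × S) | MeasurableSet A ∧ A ⊆ Set.Iic t ×ˢ Set.univ}) =>
    MeasurableSpace.comap (fun ω => p ω A) inferInstance) A ⟨hA, hAt⟩)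

lemma comap_process_eq_iSup {𝓐 : Set (Set (ℝ≥0 × S))} :
    MeasurableSpace.comap (fun ω (A : 𝓐) => p ω A) inferInstance =
      ⨆ A ∈ 𝓐, MeasurableSpace.comap (fun ω => p ω A) inferInstance := by
  rw [iSup_subtype', MeasurableSpace.pi, MeasurableSpace.comap_iSup]
  congr 1 with A : 1
  rw [MeasurableSpace.comap_comp]
  rfl

/-- The restrictions of `p` to `[0, s]` and to `(t, ∞)` are independent, for `s ≤ t`. -/
lemma HasPoissonLaplace.indep_pointFiltration [IsProbabilityMeasure P]
    (hL : HasPoissonLaplace q P p) (hm : ∀ A, MeasurableSet A → Measurable fun ω => p ω A)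
    {s t : ℝ≥0} (hst : s ≤ t) :
    Indep (⨆ A ∈ {A : Set (ℝ≥0 × S) | MeasurableSet A ∧ A ⊆ Set.Ioi t ×ˢ Set.univ},
      MeasurableSpace.comap (fun ω => p ω A) inferInstance) (pointFiltration p hm s) P := by
  simp only [pointFiltration]
  rw [← comap_process_eq_iSup, ← comap_process_eq_iSup, ← IndepFun_iff_Indep]
  refine IndepFun.process_indepFun_process (fun A => hm A A.2.1) (fun A => hm A A.2.1) fun I J => ?_
  refine hL.indepFun_pi hm (fun A => A.1.2.1) (fun A => A.1.2.1) fun A B => ?_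
  refine Set.disjoint_left.2 fun z hz hz' => ?_
  exact (lt_of_le_of_lt hst (A.1.2.2 hz).1).not_ge (B.1.2.2 hz').1

/-- A random measure with a Poisson Laplace functional is a Poisson random measure with respect to
the right-continuous filtration which it generates. -/
lemma HasPoissonLaplace.isPoissonRandomMeasureWrt [IsProbabilityMeasure P]
    (hL : HasPoissonLaplace q P p) (hm : ∀ A, MeasurableSet A → Measurable fun ω => p ω A)
    (hn : ∀ ω A, MeasurableSet A → ∃ n : ℕ∞, p ω A = n) :
    IsPoissonRandomMeasureWrt (pointFiltration p hm).rightCont q P p where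
  measurable := hm
  integerValued := hn
  law A hA hq := hL.hasLaw hm hA hq
  indep n A hA hd := hL.iIndepFun hm hA hd
  past t A hA hAt := (measurable_pointFiltration (hm := hm) hA hAt).mono
    ((pointFiltration p hm).le_rightCont t) le_rfl
  future t := by
    set 𝓕 := (pointFiltration p hm).rightCont with h𝓕
    -- `(t, ∞)` is the increasing union of the intervals `(t + 1 / (n + 1), ∞)`
    set u : ℕ → ℝ≥0 := fun n => t + 1 / (n + 1) with hu
    have htu (n) : t < u n := lt_add_of_pos_right t (by positivity)
    have huanti : Antitone u := fun a b hab => by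
      simp only [hu]; gcongr
    have hulim : Tendsto u atTop (𝓝 t) := by
      have := (tendsto_const_nhds (x := t)).add (NNReal.tendsto_coe.1
        (by simpa using tendsto_one_div_add_atTop_nhds_zero_nat (𝕜 := ℝ)) :
          Tendsto (fun n : ℕ => (1 / (n + 1) : ℝ≥0)) atTop (𝓝 0))
      simpa [hu] using this
    set m : ℕ → MeasurableSpace Ω := fun n =>
      ⨆ A ∈ {A : Set (ℝ≥0 × S) | MeasurableSet A ∧ A ⊆ Set.Ioi (u n) ×ˢ Set.univ},
        MeasurableSpace.comap (fun ω => p ω A) inferInstance with hmdef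
    have hmeas (n) {A : Set (ℝ≥0 × S)} (hA : MeasurableSet A)
        (hAu : A ⊆ Set.Ioi (u n) ×ˢ Set.univ) :
        Measurable[m n] fun ω => p ω A :=
      measurable_iff_comap_le.2 (le_iSup₂ (f := fun A
        (_ : A ∈ {A : Set (ℝ≥0 × S) | MeasurableSet A ∧ A ⊆ Set.Ioi (u n) ×ˢ Set.univ}) =>
        MeasurableSpace.comap (fun ω => p ω A) inferInstance) A ⟨hA, hAu⟩)
    have hmono : Monotone m := fun a b hab => biSup_mono fun A hA =>
      ⟨hA.1, hA.2.trans (Set.prod_mono (Set.Ioi_subset_Ioi (huanti hab)) subset_rfl)⟩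
    have hind : Indep (⨆ n, m n) (𝓕 t) P := by
      refine indep_iSup_of_directed_le (fun n => ?_) (fun n => ?_) (𝓕.le t) hmono.directed_le
      · refine indep_of_indep_of_le_right (hL.indep_pointFiltration hm le_rfl (s := u n)) ?_
        rw [h𝓕, Filtration.rightCont_eq]
        exact iInf₂_le (u n) (htu n)
      · exact iSup₂_le fun A hA => measurable_iff_comap_le.1 (hm A hA.1)
    refine indep_of_indep_of_le_left hind (iSup₂_le fun A hA => measurable_iff_comap_le.1 ?_)
    set B : ℕ → Set (ℝ≥0 × S) := fun n => A ∩ Set.Ioi (u n) ×ˢ Set.univ with hB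
    have hBm (n) : MeasurableSet (B n) := hA.1.inter (measurableSet_Ioi.prod .univ)
    have hBA : A = ⋃ n, B n := by
      ext z
      simp only [hB, Set.mem_iUnion, Set.mem_inter_iff, Set.mem_prod, Set.mem_univ, and_true,
        exists_and_left]
      refine ⟨fun hz => ⟨hz, ?_⟩, fun h => h.1⟩
      exact (hulim.eventually_lt_const (hA.2 hz).1).exists
    have hBmono : Monotone B := fun a b hab => Set.inter_subset_inter_right _
      (Set.prod_mono (Set.Ioi_subset_Ioi (huanti hab)) subset_rfl)
    have : (fun ω => p ω A) = fun ω => ⨆ n, p ω (B n) := by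
      ext ω
      rw [hBA, hBmono.measure_iUnion]
    rw [this]
    exact Measurable.iSup fun n => (hmeas n (hBm n) Set.inter_subset_right).mono
      (le_iSup m n) le_rfl

end Filtration

/-! ### Independence of waiting times and marks -/

section Renewal

variable {Ω K : Type*} [MeasurableSpace K] {mΩ : MeasurableSpace Ω} {c : ℝ≥0}
  {μ : Measure K} {M : Set K} {P : Measure Ω} {ξ : ℕ → Ω → ℝ≥0 × K}

lemma iIndepFun_bool {E : Type*} [MeasurableSpace E] [IsProbabilityMeasure P] {X : Bool → Ω → E}
    (h : IndepFun (X false) (X true) P) : iIndepFun X P := by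
  rw [iIndepFun_iff_measure_inter_preimage_eq_mul]
  intro S sets hs
  have key := h.measure_inter_preimage_eq_mul
  by_cases hf : false ∈ S <;> by_cases ht : true ∈ S
  · have : S = {false, true} := by ext b; cases b <;> simp [hf, ht]
    subst this
    rw [Finset.set_biInter_insert, Finset.set_biInter_singleton, Finset.prod_pair (by simp)]
    exact key _ _ (hs _ hf) (hs _ ht)
  · have : S = {false} := by ext b; cases b <;> simp [hf, ht]
    subst this; simp
  · have : S = {true} := by ext b; cases b <;> simp [hf, ht]
    subst this; simp
  · have : S = ∅ := by ext b; cases b <;> simp [hf, ht]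
    subst this; simp

/-- The sequence of all the waiting times is independent of the sequence of all the marks. -/
lemma IsMarkedRenewal.indepFun_times_marks [IsProbabilityMeasure P] (hc : 0 < c)
    [IsProbabilityMeasure μ] (hξ : IsMarkedRenewal c μ M P ξ) :
    IndepFun (fun ω k => (ξ k ω).1) (fun ω k => (ξ k ω).2) P := by
  have := isProbabilityMeasure_expLaw hc
  obtain ⟨ω₀⟩ := nonempty_of_isProbabilityMeasure P
  set m₀ := (ξ 0 ω₀).2
  set X : ℕ → Bool → Ω → ℝ≥0 × K := fun k b ω => if b then (0, (ξ k ω).2) else ((ξ k ω).1, m₀)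
  have e1 : Measurable fun z : ℝ≥0 × K => (z.1, m₀) := by fun_prop
  have e2 : Measurable fun z : ℝ≥0 × K => ((0 : ℝ≥0), z.2) := by fun_prop
  have hX : ∀ k b, Measurable (X k b) := by
    rintro k (_ | _)
    · exact e1.comp (hξ.measurable k)
    · exact e2.comp (hξ.measurable k)
  have hX2 : ∀ k, iIndepFun (X k) P := fun k => by
    have h := hξ.law k
    have hind : IndepFun (fun ω => (ξ k ω).1) (fun ω => (ξ k ω).2) P := by
      have m1 : Measurable fun ω => (ξ k ω).1 := measurable_fst.comp (hξ.measurable k)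
      have m2 : Measurable fun ω => (ξ k ω).2 := measurable_snd.comp (hξ.measurable k)
      rw [indepFun_iff_map_prod_eq_prod_map_map m1.aemeasurable m2.aemeasurable]
      have a1 : P.map (fun ω => (ξ k ω).1) = expLaw c := by
        have := congrArg Measure.fst h
        rwa [Measure.fst_prod, Measure.fst, Measure.map_map measurable_fst (hξ.measurable k)]
          at this
      have a2 : P.map (fun ω => (ξ k ω).2) = μ := by
        have := congrArg Measure.snd h
        rwa [Measure.snd_prod, Measure.snd, Measure.map_map measurable_snd (hξ.measurable k)]
          at this
      rw [a1, a2, ← h]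
    refine iIndepFun_bool ?_
    exact hind.comp (φ := fun r => (r, m₀)) (ψ := fun m => ((0 : ℝ≥0), m)) (by fun_prop)
      (by fun_prop)
  have hX1 : iIndepFun (fun k ω => (X k · ω)) P := by
    refine hξ.indep.comp (fun _ z (b : Bool) => if b then (0, z.2) else (z.1, m₀)) fun _ => ?_
    refine measurable_pi_lambda _ ?_
    rintro (_ | _)
    · exact e1
    · exact e2
  have hall := iIndepFun_uncurry' hX hX1 hX2
  have hsup := indep_iSup_of_disjoint (S := {i : ℕ × Bool | i.2 = false})
    (T := {i : ℕ × Bool | i.2 = true})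
    (m := fun i : ℕ × Bool => MeasurableSpace.comap (fun ω => X i.1 i.2 ω) inferInstance)
    (fun i => measurable_iff_comap_le.1 (hX i.1 i.2)) hall
    (Set.disjoint_left.2 fun i hi hi' => by
      have h1 : i.2 = false := hi
      have h2 : i.2 = true := hi'
      simp [h1] at h2)
  rw [IndepFun_iff_Indep]
  have key (T : Set (ℕ × Bool)) (i : ℕ × Bool) (hi : i ∈ T) :
      Measurable[⨆ i ∈ T, MeasurableSpace.comap (fun ω => X i.1 i.2 ω) inferInstance] (X i.1 i.2) :=
    measurable_iff_comap_le.2 (le_iSup₂ (f := fun i (_ : i ∈ T) =>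
      MeasurableSpace.comap (fun ω => X i.1 i.2 ω) inferInstance) i hi)
  refine indep_of_indep_of_le_left (indep_of_indep_of_le_right hsup ?_) ?_
  · exact measurable_iff_comap_le.1 (@measurable_pi_lambda _ _ _ (_) _ _ fun k =>
      @Measurable.comp _ _ _ (_) _ _ _ (X k true) measurable_snd (key _ (k, true) rfl))
  · exact measurable_iff_comap_le.1 (@measurable_pi_lambda _ _ _ (_) _ _ fun k =>
      @Measurable.comp _ _ _ (_) _ _ _ (X k false) measurable_fst (key _ (k, false) rfl))

end Renewal

/-! ### The counting process -/

/-- The number of the times `S 1 < S 2 < …` which are at most `t`. -/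
noncomputable def counting (S : ℕ → ℝ≥0) (t : ℝ≥0) : ℕ := sInf {n | t < S (n + 1)}

section Counting

variable {S : ℕ → ℝ≥0}

lemma le_counting_iff (hS : StrictMono S) (h0 : S 0 = 0) (hlim : Tendsto S atTop atTop) {n : ℕ}
    {t : ℝ≥0} : n ≤ counting S t ↔ S n ≤ t := by
  have hne : {n | t < S (n + 1)}.Nonempty := by
    obtain ⟨n, hn⟩ := ((tendsto_add_atTop_iff_nat 1).2 hlim |>.eventually_gt_atTop t).exists
    exact ⟨n, hn⟩
  constructor
  · intro h
    rcases n with _ | n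
    · simp [h0]
    · by_contra! hcon
      exact (Nat.sInf_le (s := {n | t < S (n + 1)}) hcon).not_gt h
  · intro h
    by_contra! hcon
    have h1 : t < S (counting S t + 1) := Nat.sInf_mem hne
    exact (h1.trans_le (hS.monotone hcon)).not_ge h

lemma counting_eq_iff (hS : StrictMono S) (h0 : S 0 = 0) (hlim : Tendsto S atTop atTop) {n : ℕ}
    {t : ℝ≥0} : counting S t = n ↔ S n ≤ t ∧ t < S (n + 1) := by
  rw [← le_counting_iff hS h0 hlim, ← not_le, ← le_counting_iff hS h0 hlim]
  omega

lemma counting_mono (hS : StrictMono S) (h0 : S 0 = 0) (hlim : Tendsto S atTop atTop) :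
    Monotone (counting S) := fun _ _ h =>
  (le_counting_iff hS h0 hlim).2 (((le_counting_iff hS h0 hlim).1 le_rfl).trans h)

lemma counting_zero (hS : StrictMono S) (h0 : S 0 = 0) (hlim : Tendsto S atTop atTop) :
    counting S 0 = 0 :=
  (counting_eq_iff hS h0 hlim).2 ⟨h0.le, h0.symm.trans_lt (hS Nat.zero_lt_one)⟩

lemma eventually_counting_eq (hS : StrictMono S) (h0 : S 0 = 0) (hlim : Tendsto S atTop atTop)
    (t : ℝ≥0) : ∀ᶠ s in 𝓝[≥] t, counting S s = counting S t := by
  obtain ⟨h1, h2⟩ := (counting_eq_iff hS h0 hlim).1 (rfl : counting S t = _)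
  filter_upwards [self_mem_nhdsWithin, mem_nhdsWithin_of_mem_nhds (Iio_mem_nhds h2)] with s hs hs'
  exact (counting_eq_iff hS h0 hlim).2 ⟨h1.trans hs, hs'⟩

end Counting

section CountingProcess

variable {Ω K : Type*} [MeasurableSpace K] {mΩ : MeasurableSpace Ω} {c : ℝ≥0}
  {μ : Measure K} {M : Set K} {P : Measure Ω} {ξ : ℕ → Ω → ℝ≥0 × K}

lemma IsMarkedRenewal.strictMono_arrival (hξ : IsMarkedRenewal c μ M P ξ) (ω : Ω) :
    StrictMono fun n => arrival ξ n ω :=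
  strictMono_nat_of_lt_succ fun n => by
    rw [arrival_succ]; exact lt_add_of_pos_right _ (hξ.pos n ω)

/-- The number of points up to time `t`. -/
noncomputable def pointCount (ξ : ℕ → Ω → ℝ≥0 × K) (t : ℝ≥0) (ω : Ω) : ℕ :=
  counting (fun n => arrival ξ n ω) t

lemma IsMarkedRenewal.le_pointCount_iff (hξ : IsMarkedRenewal c μ M P ξ) {n : ℕ} {t : ℝ≥0} {ω : Ω} :
    n ≤ pointCount ξ t ω ↔ arrival ξ n ω ≤ t :=
  le_counting_iff (hξ.strictMono_arrival ω) rfl (hξ.tendsto_arrival ω)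

lemma IsMarkedRenewal.pointCount_eq_iff (hξ : IsMarkedRenewal c μ M P ξ) {n : ℕ} {t : ℝ≥0} {ω : Ω} :
    pointCount ξ t ω = n ↔ arrival ξ n ω ≤ t ∧ t < arrival ξ (n + 1) ω :=
  counting_eq_iff (hξ.strictMono_arrival ω) rfl (hξ.tendsto_arrival ω)

lemma IsMarkedRenewal.pointCount_mono (hξ : IsMarkedRenewal c μ M P ξ) (ω : Ω) :
    Monotone fun t => pointCount ξ t ω :=
  counting_mono (hξ.strictMono_arrival ω) rfl (hξ.tendsto_arrival ω)

lemma IsMarkedRenewal.measurable_pointCount (hξ : IsMarkedRenewal c μ M P ξ) (t : ℝ≥0) :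
    Measurable (pointCount ξ t) := by
  refine measurable_of_Ici fun n => ?_
  have : pointCount ξ t ⁻¹' Set.Ici n = {ω | arrival ξ n ω ≤ t} := by
    ext ω; exact hξ.le_pointCount_iff
  rw [this]
  exact measurableSet_le (measurable_arrival hξ.measurable n) measurable_const

/-- The number of marked points in a set of times in `(s, t]`, as a finite sum. -/
lemma IsMarkedRenewal.lintegral_markedPoints_eq_sum (hξ : IsMarkedRenewal c μ M P ξ) {s t : ℝ≥0}
    (f : ℝ≥0 × K → ℝ≥0∞) (hf : Measurable f) (hs : ∀ z, z.1 ∉ Set.Ioc s t → f z = 0) (ω : Ω) :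
    ∫⁻ z, f z ∂(markedPoints ξ ω) = ∑ k ∈ Finset.Ico (pointCount ξ s ω) (pointCount ξ t ω),
      f (arrival ξ (k + 1) ω, (ξ k ω).2) := by
  rw [lintegral_markedPoints f hf]
  refine tsum_eq_sum fun k hk => hs _ fun hk' => hk ?_
  rw [Finset.mem_Ico, ← not_lt, ← Nat.succ_le_iff, ← Nat.succ_le_iff, hξ.le_pointCount_iff,
    hξ.le_pointCount_iff, not_le]
  exact hk'

lemma IsMarkedRenewal.markedPoints_Ioc (hξ : IsMarkedRenewal c μ M P ξ) (s t : ℝ≥0) (ω : Ω) :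
    markedPoints ξ ω (Set.Ioc s t ×ˢ Set.univ) =
      ((pointCount ξ t ω - pointCount ξ s ω : ℕ) : ℝ≥0∞) := by
  have hm : MeasurableSet (Set.Ioc s t ×ˢ (Set.univ : Set K)) := measurableSet_Ioc.prod .univ
  rw [← lintegral_indicator_one hm, hξ.lintegral_markedPoints_eq_sum (s := s) (t := t) _
    (measurable_one.indicator hm) (fun z hz => Set.indicator_of_notMem (fun h => hz h.1) _)]
  refine (Finset.sum_congr rfl (g := fun _ => (1 : ℝ≥0∞)) fun k hk => ?_).trans (by simp)
  rw [Finset.mem_Ico, ← not_lt, ← Nat.succ_le_iff, ← Nat.succ_le_iff, hξ.le_pointCount_iff,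
    hξ.le_pointCount_iff, not_le] at hk
  have hz : (arrival ξ (k + 1) ω, (ξ k ω).2) ∈ Set.Ioc s t ×ˢ (Set.univ : Set K) :=
    Set.mk_mem_prod hk (Set.mem_univ _)
  exact Set.indicator_of_mem hz _

lemma measurable_floor_toReal : Measurable fun x : ℝ≥0∞ => ⌊x.toReal⌋₊ :=
  Nat.measurable_floor.comp ENNReal.measurable_toReal

/-- The points of a renewal process with exponential waiting times form a Poisson process. -/
lemma IsMarkedRenewal.isPoissonProcess [IsProbabilityMeasure P] (hc : 0 < c)
    [IsProbabilityMeasure μ] (hξ : IsMarkedRenewal c μ M P ξ) :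
    IsPoissonProcess c P (pointCount ξ) := by
  have hL := hξ.hasPoissonLaplace hc
  have hm (A : Set (ℝ≥0 × K)) (hA : MeasurableSet A) : Measurable fun ω => markedPoints ξ ω A := by
    have := measurable_lintegral_markedPoints hξ.measurable (measurable_one.indicator hA)
    simpa only [lintegral_indicator_one hA] using this
  have hA (s t : ℝ≥0) : MeasurableSet (Set.Ioc s t ×ˢ (Set.univ : Set K)) :=
    measurableSet_Ioc.prod .univ
  have hq (s t : ℝ≥0) : (leb.prod (c • μ)) (Set.Ioc s t ×ˢ Set.univ) =
      ((c * (t - s) : ℝ≥0) : ℝ≥0∞) := by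
    rw [Measure.prod_prod, leb_Ioc, Measure.smul_apply, measure_univ, ENNReal.smul_def, smul_eq_mul,
      mul_one, mul_comm, ENNReal.coe_mul]
  have hfl (s t : ℝ≥0) (ω : Ω) : ⌊(markedPoints ξ ω (Set.Ioc s t ×ˢ Set.univ)).toReal⌋₊ =
      pointCount ξ t ω - pointCount ξ s ω := by
    rw [hξ.markedPoints_Ioc, ENNReal.toReal_natCast, Nat.floor_natCast]
  refine ⟨hξ.measurable_pointCount, fun ω => counting_zero (hξ.strictMono_arrival ω) rfl
    (hξ.tendsto_arrival ω), hξ.pointCount_mono, fun ω t => ?_, fun s t hst => ?_, fun n t ht => ?_⟩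
  · refine tendsto_const_nhds.congr' ?_
    filter_upwards [eventually_counting_eq (hξ.strictMono_arrival ω) rfl (hξ.tendsto_arrival ω) t]
      with s hs using hs.symm
  · have h := (hL.hasLaw hm (hA s t) (by rw [hq]; exact ENNReal.coe_ne_top)).map_eq
    refine ⟨((hξ.measurable_pointCount t).sub (hξ.measurable_pointCount s)).aemeasurable, ?_⟩
    have h' := congrArg (Measure.map fun x : ℝ≥0∞ => ⌊x.toReal⌋₊) h
    rw [Measure.map_map measurable_floor_toReal (hm _ (hA s t)),
      Measure.map_map measurable_floor_toReal measurable_from_nat, hq] at h'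
    simpa [Function.comp_def, hfl] using h'
  · have h := hL.iIndepFun hm (A := fun i : Fin n => Set.Ioc (t i.castSucc) (t i.succ) ×ˢ Set.univ)
      (fun i => hA _ _) (fun i j hij => ?_)
    · have := h.comp (fun _ x => ⌊x.toReal⌋₊) fun _ => measurable_floor_toReal
      simpa [Function.comp_def, hfl] using this
    · have aux : ∀ i j : Fin n, i < j → Disjoint (Set.Ioc (t i.castSucc) (t i.succ) ×ˢ Set.univ)
          (Set.Ioc (t j.castSucc) (t j.succ) ×ˢ (Set.univ : Set K)) := fun i j hij =>
        Set.disjoint_left.2 fun z hz hz' =>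
          (hz.1.2.trans (ht (Fin.succ_le_castSucc_iff.2 hij))).not_gt
          hz'.1.1
      rcases lt_or_gt_of_ne hij with h | h
      · exact aux i j h
      · exact (aux j i h).symm

end CountingProcess

/-! ### Markov chains driven by independent variables -/

section Chain

variable {Ω E W : Type*} [MeasurableSpace E] [MeasurableSpace W] {mΩ : MeasurableSpace Ω}
  {P : Measure Ω} {ξ : ℕ → Ω → W} {Y : ℕ → Ω → E} {step : E × W → E}

lemma measurable_chain_pastAlgebra (hstep : Measurable step) (x : E) (h0 : ∀ ω, Y 0 ω = x)
    (hs : ∀ k ω, Y (k + 1) ω = step (Y k ω, ξ k ω)) (k : ℕ) :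
    Measurable[pastAlgebra ξ k] (Y k) := by
  induction k with
  | zero =>
    rw [show Y 0 = fun _ => x from funext h0]
    exact measurable_const
  | succ k ih =>
    rw [show Y (k + 1) = fun ω => step (Y k ω, ξ k ω) from funext (hs k)]
    exact hstep.comp ((ih.mono (pastAlgebra_mono k.le_succ) le_rfl).prodMk
      (measurable_pastAlgebra k.lt_succ_self))

/-- A chain obtained by applying a random map to the current state, with independent and
identically distributed randomness, is a Markov chain. -/
lemma isMarkovChain_of_iid [IsProbabilityMeasure P] {ρ : Measure W} {κ : Kernel E E}
    (hm : ∀ k, Measurable (ξ k)) (hi : iIndepFun ξ P) (hl : ∀ k, P.map (ξ k) = ρ)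
    (hstep : Measurable step) (hκ : ∀ y, ρ.map (fun w => step (y, w)) = κ y) (x : E)
    (h0 : ∀ ω, Y 0 ω = x) (hs : ∀ k ω, Y (k + 1) ω = step (Y k ω, ξ k ω)) :
    IsMarkovChain κ (Measure.dirac x) P Y := by
  have hYp := measurable_chain_pastAlgebra hstep x h0 hs
  have hY (k) : Measurable (Y k) := (hYp k).mono (pastAlgebra_le hm k) le_rfl
  have : IsProbabilityMeasure ρ := hl 0 ▸ Measure.isProbabilityMeasure_map (hm 0).aemeasurable
  refine ⟨hY, ⟨(hY 0).aemeasurable, ?_⟩, fun k f hf hf0 ⟨C, hC⟩ => ?_⟩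
  · rw [show Y 0 = fun _ => x from funext h0]
    simp
  have hmp : (⨆ j ≤ k, MeasurableSpace.comap (Y j) inferInstance) ≤
      pastAlgebra ξ k := iSup₂_le fun j hj =>
    measurable_iff_comap_le.1 ((hYp j).mono (pastAlgebra_mono hj) le_rfl)
  have hmle : (⨆ j ≤ k, MeasurableSpace.comap (Y j) inferInstance) ≤ mΩ :=
    hmp.trans (pastAlgebra_le hm k)
  have hYm : Measurable[⨆ j ≤ k, MeasurableSpace.comap (Y j) inferInstance] (Y k) :=
    measurable_iff_comap_le.2
    (le_iSup₂ (f := fun j (_ : j ≤ k) => MeasurableSpace.comap (Y j) inferInstance) k le_rfl)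
  set F : E → ℝ := fun y => ∫ w, f (step (y, w)) ∂ρ with hF
  have hFκ (y) : ∫ z, f z ∂(κ y) = F y := by
    rw [← hκ, integral_map (φ := fun w => step (y, w))
      (hstep.comp measurable_prodMk_left).aemeasurable
      hf.aestronglyMeasurable]
  have hFm : Measurable F :=
    (StronglyMeasurable.integral_prod_right' (f := fun z : E × W => f (step z))
      (hf.comp hstep).stronglyMeasurable).measurable
  have hFC (y) : ‖F y‖ ≤ C := by
    refine (norm_integral_le_of_norm_le_const (C := C) (ae_of_all _ fun w => ?_)).trans (by simp)
    rw [Real.norm_of_nonneg (hf0 _)]; exact hC _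
  simp_rw [hFκ]
  refine (ae_eq_condExp_of_forall_setIntegral_eq hmle ?_ ?_ ?_ ?_).symm
  · exact Integrable.of_bound (hf.comp (hY _)).aestronglyMeasurable C (ae_of_all _ fun y => by
      rw [Real.norm_of_nonneg (hf0 _)]; exact hC _)
  · exact fun s _ _ => (Integrable.of_bound (hFm.comp (hY k)).aestronglyMeasurable C
      (ae_of_all _ fun ω => hFC _)).integrableOn
  · intro A hA _
    have hU : Measurable[pastAlgebra ξ k] fun ω => (A.indicator (fun _ => (1 : ℝ)) ω, Y k ω) :=
      (measurable_const.indicator (hmp A hA)).prodMk (hYp k)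
    have hU' := hU.mono (pastAlgebra_le hm k) le_rfl
    have hind := (indepFun_of_pastAlgebra hi hm hU).map_prod_eq_prod_map_map hU'.aemeasurable
      (hm k).aemeasurable
    have := Measure.isProbabilityMeasure_map (μ := P) hU'.aemeasurable
    set Φ : (ℝ × E) × W → ℝ := fun z => (max 0 (min 1 z.1.1)) * f (step (z.1.2, z.2)) with hΦ
    have hΦm : Measurable Φ := by
      have : Measurable fun z : (ℝ × E) × W => f (step (z.1.2, z.2)) :=
        hf.comp (hstep.comp (by fun_prop))
      fun_prop
    have hΦC (z) : ‖Φ z‖ ≤ C := by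
      have h1 : 0 ≤ max 0 (min 1 z.1.1) := le_max_left _ _
      have h2 : max 0 (min 1 z.1.1) ≤ 1 := max_le zero_le_one (min_le_left _ _)
      rw [Real.norm_of_nonneg (mul_nonneg h1 (hf0 _))]
      exact (mul_le_of_le_one_left (hf0 _) h2).trans (hC _)
    have hI (a : ℝ) (ha : a = 0 ∨ a = 1) : max 0 (min 1 a) = a := by
      rcases ha with rfl | rfl <;> simp
    have hA1 (ω) : A.indicator (fun _ => (1 : ℝ)) ω = 0 ∨ A.indicator (fun _ => (1 : ℝ)) ω = 1 := by
      by_cases h : ω ∈ A <;> simp [h]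
    have hset (g : Ω → ℝ) : ∫ ω in A, g ω ∂P = ∫ ω, A.indicator (fun _ => (1 : ℝ)) ω * g ω ∂P := by
      rw [← integral_indicator (hmle A hA)]
      congr 1 with ω
      by_cases h : ω ∈ A <;> simp [h]
    rw [hset, hset]
    have e1 : ∫ ω, A.indicator (fun _ => (1 : ℝ)) ω * f (Y (k + 1) ω) ∂P =
        ∫ z, Φ z ∂(P.map fun ω => ((A.indicator (fun _ => (1 : ℝ)) ω, Y k ω), ξ k ω)) := by
      rw [integral_map (hU'.prodMk (hm k)).aemeasurable hΦm.aestronglyMeasurable]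
      congr 1 with ω
      simp only [hΦ, hI _ (hA1 ω), hs]
    rw [e1, hind, hl, integral_prod _ (Integrable.of_bound hΦm.aestronglyMeasurable C
      (ae_of_all _ hΦC)), integral_map hU'.aemeasurable]
    · congr 1 with ω
      simp only [hΦ, hI _ (hA1 ω)]
      rw [integral_const_mul]
    · exact (StronglyMeasurable.integral_prod_right' (f := Φ)
        hΦm.stronglyMeasurable).aestronglyMeasurable
  · exact (hFm.comp hYm).stronglyMeasurable.aestronglyMeasurable

end Chain

/-! ### The fragmentation chain -/

section Fragmentation

variable (r : Set.Ioo (0 : ℝ) 1)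

lemma β_pos : 0 < (β r : ℝ) := div_pos r.2.1 (by linarith [r.2.1])

lemma lam_pos : 0 < lam r := by
  have := β_pos r
  unfold lam; positivity

/-- The constant `λ_o`, as a nonnegative real. -/
noncomputable def rate : ℝ≥0 := (lam r).toNNReal

lemma coe_rate : (rate r : ℝ) = lam r := Real.coe_toNNReal _ (lam_pos r).le

lemma rate_pos : 0 < rate r := Real.toNNReal_pos.2 (lam_pos r)

lemma massSup_eq : massSup (fragKernel r) = rate r := massSup_fragKernel r

open scoped Classical in
/-- The state which follows `y` when the mark of the Poisson point is `s`. -/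
noncomputable def fragStep (y : I) (s : ℝ≥0) : I :=
  if (s : ℝ) < lam r * (β r * y) then β r * y else if (s : ℝ) < lam r * y then σ (β r) * y else y

lemma coe_fragStep (y : I) (s : ℝ≥0) : (fragStep r y s : ℝ) = y - jumpSize r y s := by
  have hβ := β_pos r
  have hl := lam_pos r
  have hβ1 := (β r).2.2
  have hy := y.2.1
  have h1 : (s : ℝ) / (β r * lam r) < y ∧ (y : ℝ) ≤ 1 ↔ (s : ℝ) < lam r * (β r * y) := by
    rw [div_lt_iff₀ (by positivity)]
    refine ⟨fun h => h.1.trans_le (by nlinarith), fun h => ⟨h.trans_le (by nlinarith), y.2.2⟩⟩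
  have h2 : (s : ℝ) / lam r < y ∧ (y : ℝ) ≤ s / (β r * lam r) ↔
      (s : ℝ) < lam r * y ∧ ¬ (s : ℝ) < lam r * (β r * y) := by
    rw [div_lt_iff₀ hl, le_div_iff₀ (by positivity), not_lt, mul_comm (lam r) (y : ℝ)]
    refine and_congr_right fun _ => ?_
    rw [show lam r * (β r * y) = (y : ℝ) * (β r * lam r) by ring]
  unfold jumpSize fragStep
  simp only [h1, h2]
  split_ifs with a b c <;> simp_all <;> ring

lemma measurable_fragStep : Measurable fun z : I × ℝ≥0 => fragStep r z.1 z.2 := by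
  unfold fragStep
  refine Measurable.ite (measurableSet_lt ?_ ?_) ?_ (Measurable.ite (measurableSet_lt ?_ ?_) ?_ ?_)
  · fun_prop
  · fun_prop
  · exact (by fun_prop : Continuous fun z : I × ℝ≥0 => β r * z.1).measurable
  · fun_prop
  · fun_prop
  · exact (by fun_prop : Continuous fun z : I × ℝ≥0 => σ (β r) * z.1).measurable
  · fun_prop

/-- The marks of the `n`-th strip, `n λ_o ≤ s < (n + 1) λ_o`. -/
def strip (n : ℕ) : Set ℝ≥0 := Set.Ico (n * rate r) ((n + 1) * rate r)

lemma measurableSet_strip (n : ℕ) : MeasurableSet (strip r n) := measurableSet_Ico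

/-- The law of a mark `(u, s)` in the `n`-th strip: the uniform law on `[0, 1]` times a strip. -/
noncomputable def markLaw (n : ℕ) : Measure (I × ℝ≥0) :=
  volume.prod ((rate r)⁻¹ • leb.restrict (strip r n))

lemma rate_smul_markLaw (n : ℕ) :
    rate r • markLaw r n = volume.prod (leb.restrict (strip r n)) := by
  rw [markLaw, ENNReal.smul_def, ← Measure.prod_smul_right, ← ENNReal.smul_def, smul_smul,
    mul_inv_cancel₀ (rate_pos r).ne', one_smul]

lemma leb_strip (n : ℕ) : leb (strip r n) = rate r := by
  rw [strip, leb_Ico]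
  congr 1
  rw [add_mul, one_mul, add_tsub_cancel_left]

instance (n : ℕ) : IsProbabilityMeasure ((rate r)⁻¹ • leb.restrict (strip r n)) := by
  constructor
  rw [Measure.smul_apply, Measure.restrict_apply_univ, leb_strip, ENNReal.smul_def, smul_eq_mul,
    ← ENNReal.coe_mul, inv_mul_cancel₀ (rate_pos r).ne', ENNReal.coe_one]

instance (n : ℕ) : IsProbabilityMeasure (markLaw r n) := by
  unfold markLaw; infer_instance

lemma markLaw_mem_strip (n : ℕ) : ∀ᵐ m ∂(markLaw r n), m ∈ Set.univ ×ˢ strip r n := by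
  have h : ∀ᵐ s ∂((rate r)⁻¹ • leb.restrict (strip r n)), s ∈ strip r n :=
    Measure.ae_smul_measure (ae_restrict_mem (measurableSet_strip r n)) _
  filter_upwards [Measure.quasiMeasurePreserving_snd.ae h] with m hm using ⟨trivial, hm⟩

lemma restrict_leb_Ico {a b c : ℝ≥0} (hab : a ≤ b) (hbc : b ≤ c) :
    leb.restrict (Set.Ico a c) = leb.restrict (Set.Ico a b) + leb.restrict (Set.Ico b c) := by
  rw [← Set.Ico_union_Ico_eq_Ico hab hbc, Measure.restrict_union _ measurableSet_Ico]
  exact Set.disjoint_left.2 fun x hx hx' => hx.2.not_ge hx'.1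

/-- The law of the state which follows `y`. -/
lemma map_fragStep (y : I) : (markLaw r 0).map (fun m => fragStep r y m.2) =
    normalizedKernel (fragKernel r) y := by
  have hβ := β_pos r
  have hl := lam_pos r
  have hβ1 := (β r).2.2
  have hy := y.2.1
  have hy1 := y.2.2
  have hmy : Measurable fun s => fragStep r y s := 
    (measurable_fragStep r).comp (measurable_prodMk_left (x := y))
  have hmy' : Measurable fun m : I × ℝ≥0 => fragStep r y m.2 := hmy.comp measurable_snd
  set a : ℝ≥0 := (lam r * (β r * y)).toNNReal with ha
  set b : ℝ≥0 := (lam r * y).toNNReal with hb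
  have ca : (a : ℝ) = lam r * (β r * y) := Real.coe_toNNReal _ (by positivity)
  have cb : (b : ℝ) = lam r * y := Real.coe_toNNReal _ (by positivity)
  have hab : a ≤ b := by
    rw [← NNReal.coe_le_coe, ca, cb]
    exact mul_le_mul_of_nonneg_left (mul_le_of_le_one_left hy hβ1) hl.le
  have hbr : b ≤ rate r := by
    rw [← NNReal.coe_le_coe, coe_rate, cb]
    exact mul_le_of_le_one_right hl.le hy1
  have hs0 : strip r 0 = Set.Ico 0 (rate r) := by simp [strip]
  have hconst (u v : ℝ≥0) (z : I) (hz : ∀ s ∈ Set.Ico u v, fragStep r y s = z) :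
      (leb.restrict (Set.Ico u v)).map (fun s => fragStep r y s) =
        ((v - u : ℝ≥0) : ℝ≥0∞) • Measure.dirac z := by
    rw [Measure.map_congr (g := fun _ => z) ((ae_restrict_mem measurableSet_Ico).mono hz),
      Measure.map_const, Measure.restrict_apply_univ, leb_Ico]
  have hmap : (markLaw r 0).map (fun m => fragStep r y m.2) = ((rate r)⁻¹ : ℝ≥0) •
      ((a : ℝ≥0∞) • Measure.dirac (β r * y) + ((b - a : ℝ≥0) : ℝ≥0∞) • Measure.dirac (σ (β r) * y) +
        ((rate r - b : ℝ≥0) : ℝ≥0∞) • Measure.dirac y) := by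
    rw [show (fun m : I × ℝ≥0 => fragStep r y m.2) = (fun s => fragStep r y s) ∘ Prod.snd from rfl,
      ← Measure.map_map hmy measurable_snd, markLaw,
      Measure.map_snd_prod, measure_univ, one_smul, ENNReal.smul_def, ENNReal.smul_def,
      Measure.map_smul, hs0,
      restrict_leb_Ico (zero_le : 0 ≤ b) hbr, restrict_leb_Ico (zero_le : 0 ≤ a) hab,
      Measure.map_add _ _ hmy, Measure.map_add _ _ hmy, hconst 0 a (β r * y),
      hconst a b (σ (β r) * y),
      hconst b (rate r) y, tsub_zero]
    · intro s hs
      have h2 : ¬ (s : ℝ) < lam r * y := by rw [← cb]; exact_mod_cast hs.1.not_gt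
      have h1 : ¬ (s : ℝ) < lam r * (β r * y) := by
        rw [← ca]; exact_mod_cast (hab.trans hs.1).not_gt
      simp [fragStep, h1, h2]
    · intro s hs
      have h2 : (s : ℝ) < lam r * y := by rw [← cb]; exact_mod_cast hs.2
      have h1 : ¬ (s : ℝ) < lam r * (β r * y) := by
        rw [← ca]; exact_mod_cast hs.1.not_gt
      simp [fragStep, h1, h2]
    · intro s hs
      have h1 : (s : ℝ) < lam r * (β r * y) := by rw [← ca]; exact_mod_cast hs.2
      simp [fragStep, h1]
  have hba : ((b - a : ℝ≥0) : ℝ≥0∞) = ENNReal.ofReal (lam r * ((1 - (β r : ℝ)) * y)) := by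
    have h1 : 0 ≤ 1 - (β r : ℝ) := by linarith
    rw [ENNReal.ofReal]
    congr 1
    ext
    rw [NNReal.coe_sub hab, ca, cb, Real.coe_toNNReal _ (by positivity)]
    ring
  have hN : fragKernel r y = (a : ℝ≥0∞) • Measure.dirac (β r * y) +
      ((b - a : ℝ≥0) : ℝ≥0∞) • Measure.dirac (σ (β r) * y) := by
    rw [hba]; rfl
  have hNu : fragKernel r y Set.univ = b := by
    rw [hN]
    simp only [Measure.coe_add, Measure.coe_smul, Pi.add_apply, Pi.smul_apply, measure_univ,
      smul_eq_mul, mul_one]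
    rw [← ENNReal.coe_add, add_tsub_cancel_of_le hab]
  have hnorm : normalizedKernel (fragKernel r) y = (rate r : ℝ≥0∞)⁻¹ • fragKernel r y +
      (1 - (rate r : ℝ≥0∞)⁻¹ * fragKernel r y Set.univ) • Measure.dirac y := by
    rw [← massSup_eq]; rfl
  have hr0 : (rate r : ℝ≥0∞) ≠ 0 := by exact_mod_cast (rate_pos r).ne'
  have hc : (1 - (rate r : ℝ≥0∞)⁻¹ * b) = (rate r : ℝ≥0∞)⁻¹ * ((rate r - b : ℝ≥0) : ℝ≥0∞) := by
    rw [ENNReal.coe_sub, ENNReal.mul_sub (fun _ _ => by simpa using hr0),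
      ENNReal.inv_mul_cancel hr0 ENNReal.coe_ne_top]
  rw [hmap, hnorm, hNu, hc, ← hN, ENNReal.smul_def, ENNReal.coe_inv (rate_pos r).ne', smul_add,
    smul_smul]

/-- The successive states from `x`, when the marks of the Poisson points are `s 0, s 1, …`. -/
noncomputable def fragChain (x : I) (s : ℕ → ℝ≥0) : ℕ → I
  | 0 => x
  | n + 1 => fragStep r (fragChain x s n) (s n)

lemma measurable_fragChain (x : I) (n : ℕ) : Measurable fun s => fragChain r x s n := by
  induction n with
  | zero => exact measurable_const
  | succ n ih => exact (measurable_fragStep r).comp (ih.prodMk (measurable_pi_apply n))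

lemma fragChain_congr (x : I) {s s' : ℕ → ℝ≥0} {n : ℕ} (h : ∀ k < n, s k = s' k) :
    fragChain r x s n = fragChain r x s' n := by
  induction n with
  | zero => rfl
  | succ n ih =>
    rw [fragChain, fragChain, ih fun k hk => h k (hk.trans n.lt_succ_self), h n n.lt_succ_self]

/-- The process which jumps at the times of the points, according to their marks. -/
noncomputable def fragProcess {Ω : Type*} (x : I) (ξ : ℕ → Ω → ℝ≥0 × I × ℝ≥0) (t : ℝ≥0)
    (ω : Ω) : I :=
  fragChain r x (fun k => (ξ k ω).2.2) (pointCount ξ t ω)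

lemma isJumpProcess_fragProcess {Ω : Type*} {mΩ : MeasurableSpace Ω} {P : Measure Ω}
    [IsProbabilityMeasure P] {M : Set (I × ℝ≥0)} {ξ : ℕ → Ω → ℝ≥0 × I × ℝ≥0}
    (hξ : IsMarkedRenewal (rate r) (markLaw r 0) M P ξ) (x : I) :
    IsJumpProcess (fragKernel r) (Measure.dirac x) P (fragProcess r x ξ) := by
  have := isProbabilityMeasure_expLaw (rate_pos r)
  refine ⟨fun k ω => fragChain r x (fun k => (ξ k ω).2.2) k, pointCount ξ, ?_, ?_, ?_,
    fun t ω => rfl⟩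
  · refine isMarkovChain_of_iid (step := fun z : I × ℝ≥0 × I × ℝ≥0 => fragStep r z.1 z.2.2.2)
      hξ.measurable hξ.indep hξ.law
      ((measurable_fragStep r).comp (g := fun z : I × ℝ≥0 => fragStep r z.1 z.2)
        (f := fun z : I × ℝ≥0 × I × ℝ≥0 => (z.1, z.2.2.2)) (by fun_prop)) (fun y => ?_)
      x (fun _ => rfl) fun _ _ => rfl
    have hm : Measurable fun m : I × ℝ≥0 => fragStep r y m.2 :=
      (measurable_fragStep r).comp (g := fun z : I × ℝ≥0 => fragStep r z.1 z.2)
        (f := fun m : I × ℝ≥0 => (y, m.2)) (by fun_prop)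
    rw [← map_fragStep, show (fun w : ℝ≥0 × I × ℝ≥0 => fragStep r y w.2.2) =
      (fun m : I × ℝ≥0 => fragStep r y m.2) ∘ Prod.snd from rfl,
      ← Measure.map_map hm measurable_snd, Measure.map_snd_prod, measure_univ, one_smul]
  · rw [massSup_eq, ENNReal.toNNReal_coe]
    exact hξ.isPoissonProcess (rate_pos r)
  · have h := (hξ.indepFun_times_marks (rate_pos r)).symm
    rw [IndepFun_iff_Indep] at h ⊢
    refine indep_of_indep_of_le_left (indep_of_indep_of_le_right h ?_) ?_
    · rw [← measurable_iff_comap_le]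
      refine @measurable_pi_lambda _ _ _ (_) _ _ fun t => ?_
      refine measurable_of_Ici (f := pointCount ξ t) fun n => ?_
      have : pointCount ξ t ⁻¹' Set.Ici n = (fun ω k => (ξ k ω).1) ⁻¹'
          {τ | ∑ i ∈ Finset.range n, τ i ≤ t} := by
        ext ω; exact hξ.le_pointCount_iff
      rw [this]
      exact ⟨_, measurableSet_le (by fun_prop) measurable_const, rfl⟩
    · rw [← measurable_iff_comap_le]
      refine @measurable_pi_lambda _ _ _ (_) _ _ fun k => ?_
      exact (((measurable_fragChain r x k).comp (by fun_prop :
        Measurable fun (m : ℕ → I × ℝ≥0) k => (m k).2))).comp (comap_measurable _)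

end Fragmentation

/-! ### The driving Poisson random measure -/

section Driving

/-- A marked renewal process stays one after a measure preserving change of space. -/
lemma IsMarkedRenewal.comp {Ω Ω' K : Type*} [MeasurableSpace K] {mΩ : MeasurableSpace Ω}
    {mΩ' : MeasurableSpace Ω'} {c : ℝ≥0} {μ : Measure K} {M : Set K} {P : Measure Ω}
    {P' : Measure Ω'} {ξ : ℕ → Ω → ℝ≥0 × K} (hξ : IsMarkedRenewal c μ M P ξ) {φ : Ω' → Ω}
    (hφ : MeasurePreserving φ P' P) : IsMarkedRenewal c μ M P' fun k ω => ξ k (φ ω) where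
  measurable k := (hξ.measurable k).comp hφ.measurable
  indep := by
    have h := hξ.indep
    rw [← hφ.map_eq] at h
    rw [iIndepFun_iff_measure_inter_preimage_eq_mul] at h ⊢
    intro S sets hs
    have := h S hs
    rw [Measure.map_apply hφ.measurable
      (Finset.measurableSet_biInter _ fun i hi => hξ.measurable i (hs i hi))] at this
    simp only [Set.preimage_iInter] at this
    rw [show (⋂ i ∈ S, (fun ω => ξ i (φ ω)) ⁻¹' sets i) = ⋂ i ∈ S, φ ⁻¹' (ξ i ⁻¹' sets i) from rfl,
      this]
    exact Finset.prod_congr rfl fun i hi =>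
      Measure.map_apply hφ.measurable (hξ.measurable i (hs i hi))
  law k := by
    rw [← hξ.law k, ← hφ.map_eq, Measure.map_map (hξ.measurable k) hφ.measurable]
    rfl
  pos k ω := hξ.pos k _
  diverges ω := hξ.diverges _
  mark_mem k ω := hξ.mark_mem k _

variable (r : Set.Ioo (0 : ℝ) 1)

lemma mem_strip_iff {n : ℕ} {s : ℝ≥0} : s ∈ strip r n ↔ ⌊s / rate r⌋₊ = n := by
  rw [Nat.floor_eq_iff (zero_le), le_div_iff₀ (rate_pos r), div_lt_iff₀ (rate_pos r)]
  rfl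

lemma pairwise_disjoint_strip : Pairwise (Function.onFun Disjoint (strip r)) := by
  intro m n hmn
  refine Set.disjoint_left.2 fun s hs hs' => hmn ?_
  rw [mem_strip_iff] at hs hs'
  rw [← hs, ← hs']

lemma iUnion_strip : ⋃ n, strip r n = Set.univ :=
  Set.eq_univ_of_forall fun _ => Set.mem_iUnion.2 ⟨_, (mem_strip_iff r).2 rfl⟩

lemma sum_intensity : (Measure.sum fun n => leb.prod (rate r • markLaw r n)) =
    leb.prod ((volume : Measure I).prod leb) := by
  simp_rw [rate_smul_markLaw]
  rw [← Measure.prod_sum_right, ← Measure.prod_sum_right,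
    ← Measure.restrict_iUnion (pairwise_disjoint_strip r) (measurableSet_strip r), iUnion_strip,
    Measure.restrict_univ]

/-- The superposition, over the strips, of the marked points of renewal processes. -/
noncomputable def superposition {K : Type*} [MeasurableSpace K] {Ω : ℕ → Type*}
    (ξ : ∀ n, ℕ → Ω n → ℝ≥0 × K) (ω : ∀ n, Ω n) : Measure (ℝ≥0 × K) :=
  Measure.sum fun n => markedPoints (ξ n) (ω n)

variable {Ω : ℕ → Type*} {ξ : ∀ n, ℕ → Ω n → ℝ≥0 × I × ℝ≥0}

lemma lintegral_superposition (f : ℝ≥0 × I × ℝ≥0 → ℝ≥0∞) (ω : ∀ n, Ω n) :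
    ∫⁻ z, f z ∂(superposition ξ ω) = ∑' n, ∫⁻ z, f z ∂(markedPoints (ξ n) (ω n)) :=
  lintegral_sum_measure _ _

variable [∀ n, MeasurableSpace (Ω n)] {P : ∀ n, Measure (Ω n)}

lemma measurable_superposition (hξ : ∀ n, IsMarkedRenewal (rate r) (markLaw r n)
    (Set.univ ×ˢ strip r n) (P n) (ξ n)) (A : Set (ℝ≥0 × I × ℝ≥0)) (hA : MeasurableSet A) :
    Measurable fun ω => superposition ξ ω A := by
  simp_rw [← lintegral_indicator_one hA, lintegral_superposition]
  exact Measurable.tsum fun n => (measurable_lintegral_markedPoints (hξ n).measurable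
    (measurable_one.indicator hA)).comp (measurable_pi_apply n)

/-- The superposition is a Poisson random measure of intensity `dα du ds`. -/
lemma isPoissonRandomMeasureWrt_superposition [∀ n, IsProbabilityMeasure (P n)]
    (hξ : ∀ n, IsMarkedRenewal (rate r) (markLaw r n)
    (Set.univ ×ˢ strip r n) (P n) (ξ n)) :
    IsPoissonRandomMeasureWrt
      (pointFiltration (superposition ξ) (measurable_superposition r hξ)).rightCont
      (leb.prod (volume.prod leb)) (Measure.infinitePi P) (superposition ξ) := by
  refine HasPoissonLaplace.isPoissonRandomMeasureWrt ?_ _ fun ω A hA => ?_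
  · rw [← sum_intensity r]
    exact HasPoissonLaplace.sum
      (fun n f hf => measurable_lintegral_markedPoints (hξ n).measurable hf)
      fun n => (hξ n).hasPoissonLaplace (rate_pos r)
  · have : superposition ξ ω = Measure.sum fun z : ℕ × ℕ =>
        Measure.dirac (arrival (ξ z.1) (z.2 + 1) (ω z.1), (ξ z.1 z.2 (ω z.1)).2) := by
      ext B hB
      simp only [superposition, markedPoints, Measure.sum_apply _ hB]
      rw [ENNReal.tsum_prod']
    rw [this]
    exact exists_enat_sum_dirac _ hA

end Driving

/-! ### Paths which are constant between the points -/

/-- The number of the times `S 1 < S 2 < …` which are less than `t`. -/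
noncomputable def countingLT (S : ℕ → ℝ≥0) (t : ℝ≥0) : ℕ := sInf {n | t ≤ S (n + 1)}

section Step

variable {S : ℕ → ℝ≥0} {Y : ℕ → I}

lemma countingLT_spec (hlim : Tendsto S atTop atTop) (t : ℝ≥0) : t ≤ S (countingLT S t + 1) := by
  obtain ⟨n, hn⟩ := ((tendsto_add_atTop_iff_nat 1).2 hlim |>.eventually_ge_atTop t).exists
  exact Nat.sInf_mem (s := {n | t ≤ S (n + 1)}) ⟨n, hn⟩

lemma monotone_countingLT (hlim : Tendsto S atTop atTop) : Monotone (countingLT S) :=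
  fun _ t h => Nat.sInf_le (h.trans (countingLT_spec hlim t))

lemma lt_of_countingLT (h0 : S 0 = 0) {t : ℝ≥0} (ht : 0 < t) : S (countingLT S t) < t := by
  cases h : countingLT S t with
  | zero => rwa [h0]
  | succ n =>
    by_contra! h'
    have : countingLT S t ≤ n := Nat.sInf_le h'
    omega

lemma countingLT_eq (hS : StrictMono S) (h0 : S 0 = 0) (hlim : Tendsto S atTop atTop) {n : ℕ}
    {t : ℝ≥0} (h1 : S n < t) (h2 : t ≤ S (n + 1)) : countingLT S t = n := by
  have a := hS.lt_iff_lt.1 ((lt_of_countingLT h0 (zero_le.trans_lt h1)).trans_le h2)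
  have b := hS.lt_iff_lt.1 (h1.trans_le (countingLT_spec hlim t))
  omega

lemma tendsto_step (hS : StrictMono S) (h0 : S 0 = 0) (hlim : Tendsto S atTop atTop) {t : ℝ≥0}
    (ht : 0 < t) : Tendsto (fun s => Y (counting S s)) (𝓝[<] t) (𝓝 (Y (countingLT S t))) := by
  refine tendsto_const_nhds.congr' ?_
  filter_upwards [self_mem_nhdsWithin,
    mem_nhdsWithin_of_mem_nhds (Ioi_mem_nhds (lt_of_countingLT h0 ht))] with s hs hs'
  rw [(counting_eq_iff hS h0 hlim).2 ⟨le_of_lt hs', lt_of_lt_of_le hs (countingLT_spec hlim t)⟩]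

lemma isCadlag_step (hS : StrictMono S) (h0 : S 0 = 0) (hlim : Tendsto S atTop atTop) :
    IsCadlag fun t => Y (counting S t) := by
  refine fun t => ⟨?_, ?_⟩
  · refine tendsto_const_nhds.congr' ?_
    filter_upwards [eventually_counting_eq hS h0 hlim t] with s hs
    rw [hs]
  · rcases eq_or_ne t 0 with rfl | ht
    · refine ⟨0, ?_⟩
      have : (𝓝[<] (0 : ℝ≥0)) = ⊥ := by
        rw [show Set.Iio (0 : ℝ≥0) = ∅ from by ext; simp, nhdsWithin_empty]
      rw [this]
      exact tendsto_bot
    · exact ⟨_, tendsto_step hS h0 hlim (pos_iff_ne_zero.2 ht)⟩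

lemma leftLim_step (hS : StrictMono S) (h0 : S 0 = 0) (hlim : Tendsto S atTop atTop) (t : ℝ≥0) :
    Function.leftLim (fun s => Y (counting S s)) t = Y (countingLT S t) := by
  rcases eq_or_ne t 0 with rfl | ht
  · rw [leftLim_eq_of_isBot fun _ => zero_le]
    congr 1
    rw [counting_zero hS h0 hlim]
    exact (Nat.le_zero.1 (Nat.sInf_le (by simp))).symm
  · have : (𝓝[<] t).NeBot := nhdsLT_neBot_of_exists_lt ⟨0, pos_iff_ne_zero.2 ht⟩
    exact leftLim_eq_of_tendsto (tendsto_step hS h0 hlim (pos_iff_ne_zero.2 ht))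

lemma measurable_leftLim_step (hS : StrictMono S) (h0 : S 0 = 0) (hlim : Tendsto S atTop atTop) :
    Measurable (Function.leftLim fun s => Y (counting S s)) := by
  rw [show Function.leftLim (fun s => Y (counting S s)) = Y ∘ countingLT S from
    funext (leftLim_step hS h0 hlim)]
  exact (measurable_of_countable Y).comp (monotone_countingLT hlim).measurable

end Step

/-! ### The integrals of the equation -/

lemma integrable_and_integral_eq {α : Type*} {mα : MeasurableSpace α} {μ : Measure α} {f : α → ℝ}
    (hf : Measurable f) (hf0 : ∀ x, 0 ≤ f x) {c : ℝ} (hc : 0 ≤ c)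
    (h : ∫⁻ x, ENNReal.ofReal (f x) ∂μ = ENNReal.ofReal c) :
    Integrable f μ ∧ ∫ x, f x ∂μ = c := by
  refine ⟨⟨hf.aestronglyMeasurable, ?_⟩, ?_⟩
  · rw [hasFiniteIntegral_iff_ofReal (ae_of_all _ hf0), h]
    exact ENNReal.ofReal_lt_top
  · rw [integral_eq_lintegral_of_nonneg_ae (ae_of_all _ hf0) hf.aestronglyMeasurable, h,
      ENNReal.toReal_ofReal hc]

section Equation

variable (r : Set.Ioo (0 : ℝ) 1)

lemma jumpSize_eq (y : I) (s : ℝ≥0) : jumpSize r y s = y - fragStep r y s := by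
  rw [coe_fragStep]; ring

lemma fragStep_le (y : I) (s : ℝ≥0) : fragStep r y s ≤ y := by
  unfold fragStep
  split_ifs
  · exact mul_le_of_le_one_left' (β r).2.2
  · exact mul_le_of_le_one_left' (σ (β r)).2.2
  · exact le_rfl

lemma jumpSize_nonneg (y : I) (s : ℝ≥0) : 0 ≤ jumpSize r y s := by
  rw [jumpSize_eq]
  exact sub_nonneg.2 (fragStep_le r y s)

lemma measurable_jumpSize : Measurable fun z : I × ℝ≥0 => jumpSize r z.1 z.2 := by
  simp_rw [jumpSize_eq]
  exact (measurable_subtype_coe.comp measurable_fst).sub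
    (measurable_subtype_coe.comp (measurable_fragStep r))

lemma jumpSize_eq_zero (y : I) {s : ℝ≥0} (hs : rate r ≤ s) : jumpSize r y s = 0 := by
  have hl := lam_pos r
  have hs' : lam r ≤ s := by rw [← coe_rate]; exact_mod_cast hs
  have hb := (β r).2.2
  have hb0 := β_pos r
  have hy := y.2.2
  have hy0 := y.2.1
  have h2 : ¬ (s : ℝ) < lam r * y := by nlinarith
  have h1 : ¬ (s : ℝ) < lam r * (β r * y) := fun h => h2 (h.trans_le
    (mul_le_mul_of_nonneg_left (mul_le_of_le_one_left hy0 hb) hl.le))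
  rw [jumpSize_eq, fragStep, if_neg h1, if_neg h2, sub_self]

/-- The mean of the jumps from `y` per unit of time. -/
lemma lintegral_jumpSize (y : I) : ∫⁻ s, ENNReal.ofReal (jumpSize r y s) ∂leb =
    ENNReal.ofReal (2 * lam r * β r * (1 - β r) * (y : ℝ) ^ 2) := by
  have hβ := β_pos r
  have hl := lam_pos r
  have hβ1 : 0 ≤ 1 - (β r : ℝ) := sub_nonneg.2 (β r).2.2
  have hy := y.2.1
  set a : ℝ≥0 := (lam r * (β r * y)).toNNReal with ha
  set b : ℝ≥0 := (lam r * y).toNNReal with hb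
  have ca : (a : ℝ) = lam r * (β r * y) := Real.coe_toNNReal _ (by positivity)
  have cb : (b : ℝ) = lam r * y := Real.coe_toNNReal _ (by positivity)
  have hab : a ≤ b := by
    rw [← NNReal.coe_le_coe, ca, cb]
    exact mul_le_mul_of_nonneg_left (mul_le_of_le_one_left hy (β r).2.2) hl.le
  have key (s : ℝ≥0) : ENNReal.ofReal (jumpSize r y s) =
      (Set.Ico 0 a).indicator (fun _ => ENNReal.ofReal ((1 - β r) * y)) s +
        (Set.Ico a b).indicator (fun _ => ENNReal.ofReal (β r * y)) s := by
    rw [jumpSize_eq, fragStep, ← ca, ← cb]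
    rcases lt_or_ge s a with h | h
    · rw [if_pos (by exact_mod_cast h), Set.indicator_of_mem (by simpa using h),
        Set.indicator_of_notMem (by simp [h]), add_zero]
      congr 1
      simp only [Set.Icc.coe_mul]
      ring
    · rw [if_neg (by exact_mod_cast h.not_gt), Set.indicator_of_notMem (by simpa using h), zero_add]
      rcases lt_or_ge s b with h' | h'
      · rw [if_pos (by exact_mod_cast h'), Set.indicator_of_mem (show s ∈ Set.Ico a b from ⟨h, h'⟩)]
        congr 1
        simp only [Set.Icc.coe_mul, unitInterval.coe_symm_eq]
        ring
      · rw [if_neg (by exact_mod_cast h'.not_gt), Set.indicator_of_notMem (by simp [h'])]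
        simp
  simp_rw [key]
  rw [lintegral_add_left (measurable_const.indicator measurableSet_Ico),
    lintegral_indicator_const measurableSet_Ico, lintegral_indicator_const measurableSet_Ico,
    leb_Ico, leb_Ico, tsub_zero, ← ENNReal.ofReal_coe_nnreal, ← ENNReal.ofReal_coe_nnreal,
    NNReal.coe_sub hab, ca, cb, ← ENNReal.ofReal_mul (by positivity),
    ← ENNReal.ofReal_mul (by positivity), ← ENNReal.ofReal_add (by positivity)]
  · congr 1; ring
  · refine mul_nonneg (by positivity) (sub_nonneg.2 ?_)
    rw [← ca, ← cb]; exact_mod_cast hab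

variable {Ω : ℕ → Type*} {ξ : ∀ n, ℕ → Ω n → ℝ≥0 × I × ℝ≥0} [∀ n, MeasurableSpace (Ω n)]
  {P : ∀ n, Measure (Ω n)}

/-- The jumps of the process up to time `t` add up to its total decrease: only the points
in the strip `0` count, and the `k`-th one takes the process from its `k`-th state to the next. -/
lemma lintegral_jumpSize_superposition (hξ : ∀ n, IsMarkedRenewal (rate r) (markLaw r n)
    (Set.univ ×ˢ strip r n) (P n) (ξ n)) (x : I) (ω : ∀ n, Ω n) (t : ℝ≥0) :
    ∫⁻ z in Set.Ioc 0 t ×ˢ Set.univ, ENNReal.ofReal (jumpSize r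
      (Function.leftLim (fun t => fragProcess r x (ξ 0) t (ω 0)) z.1) z.2.2) ∂(superposition ξ ω) =
      ENNReal.ofReal (x - fragProcess r x (ξ 0) t (ω 0)) := by
  set s : ℕ → ℝ≥0 := fun k => (ξ 0 k (ω 0)).2.2 with hs
  set S : ℕ → ℝ≥0 := fun n => arrival (ξ 0) n (ω 0) with hSdef
  set w : ℝ≥0 → I := fun t => fragProcess r x (ξ 0) t (ω 0) with hw
  have hS : StrictMono S := (hξ 0).strictMono_arrival (ω 0)
  have hlim : Tendsto S atTop atTop := (hξ 0).tendsto_arrival (ω 0)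
  have hwm : Measurable (Function.leftLim w) :=
    measurable_leftLim_step (Y := fragChain r x s) hS rfl hlim
  have hA : MeasurableSet (Set.Ioc 0 t ×ˢ (Set.univ : Set (I × ℝ≥0))) :=
    measurableSet_Ioc.prod .univ
  have hg : Measurable fun z : ℝ≥0 × I × ℝ≥0 =>
      ENNReal.ofReal (jumpSize r (Function.leftLim w z.1) z.2.2) :=
    ((measurable_jumpSize r).comp (g := fun z : I × ℝ≥0 => jumpSize r z.1 z.2)
      (f := fun z : ℝ≥0 × I × ℝ≥0 => (Function.leftLim w z.1, z.2.2))
      ((hwm.comp measurable_fst).prodMk (by fun_prop))).ennreal_ofReal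
  rw [← lintegral_indicator hA, lintegral_superposition, tsum_eq_single 0]
  · rw [(hξ 0).lintegral_markedPoints_eq_sum (s := 0) (t := t) _ (hg.indicator hA)
      fun z hz => Set.indicator_of_notMem (fun h => hz h.1) _]
    have h0 : pointCount (ξ 0) 0 (ω 0) = 0 := counting_zero hS rfl hlim
    have key : ∀ k ∈ Finset.Ico (pointCount (ξ 0) 0 (ω 0)) (pointCount (ξ 0) t (ω 0)),
        (Set.Ioc 0 t ×ˢ (Set.univ : Set (I × ℝ≥0))).indicator (fun z =>
          ENNReal.ofReal (jumpSize r (Function.leftLim w z.1) z.2.2))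
          (arrival (ξ 0) (k + 1) (ω 0), (ξ 0 k (ω 0)).2) =
        ENNReal.ofReal ((fragChain r x s k : ℝ) - fragChain r x s (k + 1)) := by
      intro k hk
      have hk2 := (Finset.mem_Ico.1 hk).2
      rw [Set.indicator_of_mem]
      · rw [jumpSize_eq]
        have : Function.leftLim w (arrival (ξ 0) (k + 1) (ω 0)) = fragChain r x s k := by
          refine (leftLim_step (Y := fragChain r x s) hS rfl hlim _).trans ?_
          rw [countingLT_eq hS rfl hlim (hS k.lt_succ_self) le_rfl]
        simp only [this, fragChain]
        rfl
      · refine ⟨⟨zero_le.trans_lt (hS k.lt_succ_self), ?_⟩, trivial⟩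
        exact (hξ 0).le_pointCount_iff.1 hk2
    rw [Finset.sum_congr rfl key, h0, ← ENNReal.ofReal_sum_of_nonneg, ← Finset.range_eq_Ico,
      Finset.sum_range_sub']
    · rfl
    · exact fun k _ => sub_nonneg.2 (fragStep_le r _ _)
  · intro n hn
    rw [lintegral_markedPoints _ (hg.indicator hA), ENNReal.tsum_eq_zero]
    intro k
    have hk := ((hξ n).mark_mem k (ω n)).2.1
    have : rate r ≤ (ξ n k (ω n)).2.2 := by
      refine le_trans ?_ hk
      have : (1 : ℝ≥0) ≤ n := by exact_mod_cast Nat.one_le_iff_ne_zero.2 hn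
      simpa using mul_le_mul_left this (rate r)
    refine Set.indicator_apply_eq_zero.2 fun _ => ?_
    simp [jumpSize_eq_zero r _ this]

/-- The equation is solved along every path: the drift cancels the compensator of the jumps. -/
lemma solvesFragmentationEquation (hξ : ∀ n, IsMarkedRenewal (rate r) (markLaw r n)
    (Set.univ ×ˢ strip r n) (P n) (ξ n)) (x : I) (ω : ∀ n, Ω n) :
    SolvesFragmentationEquation r (superposition ξ ω)
      fun t => fragProcess r x (ξ 0) t (ω 0) := by
  intro t
  set s : ℕ → ℝ≥0 := fun k => (ξ 0 k (ω 0)).2.2 with hs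
  set S : ℕ → ℝ≥0 := fun n => arrival (ξ 0) n (ω 0) with hSdef
  have hS : StrictMono S := (hξ 0).strictMono_arrival (ω 0)
  have hlim : Tendsto S atTop atTop := (hξ 0).tendsto_arrival (ω 0)
  have hjump := lintegral_jumpSize_superposition r hξ x ω t
  set w : ℝ≥0 → I := fun t => fragProcess r x (ξ 0) t (ω 0) with hw
  have hwm : Measurable (Function.leftLim w) :=
    measurable_leftLim_step (Y := fragChain r x s) hS rfl hlim
  have hw0 : w 0 = x := by
    change fragChain r x s (counting S 0) = x
    rw [counting_zero hS rfl hlim]; rfl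
  have hwt : w t ≤ x := by
    change fragChain r x s (counting S t) ≤ x
    generalize counting S t = n
    induction n with
    | zero => exact le_rfl
    | succ n ih => exact (fragStep_le r _ _).trans ih
  set C : ℝ := 2 * lam r * β r * (1 - β r) with hC
  have hC0 : 0 ≤ C := by
    have := β_pos r
    have := lam_pos r
    have : 0 ≤ 1 - (β r : ℝ) := sub_nonneg.2 (β r).2.2
    positivity
  have hint : IntegrableOn (fun a : ℝ≥0 => ((Function.leftLim w a : I) : ℝ) ^ 2)
      (Set.Ioc 0 t) leb := by
    have : IsFiniteMeasure (leb.restrict (Set.Ioc 0 t)) := ⟨by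
      rw [Measure.restrict_apply_univ, leb_Ioc]; exact ENNReal.coe_lt_top⟩
    refine Integrable.of_bound ((measurable_subtype_coe.comp hwm).pow_const 2).aestronglyMeasurable
      1
      (ae_of_all _ fun a => ?_)
    rw [norm_pow, Real.norm_of_nonneg (Function.leftLim w a).2.1]
    exact pow_le_one₀ (Function.leftLim w a).2.1 (Function.leftLim w a).2.2
  obtain ⟨i1, e1⟩ := integrable_and_integral_eq
    ((measurable_jumpSize r).comp (g := fun z : I × ℝ≥0 => jumpSize r z.1 z.2)
      (f := fun z : ℝ≥0 × I × ℝ≥0 => (Function.leftLim w z.1, z.2.2))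
      ((hwm.comp measurable_fst).prodMk (by fun_prop)))
    (fun z => jumpSize_nonneg r _ _) (sub_nonneg.2 hwt) hjump
  have hg2 : Measurable fun z : ℝ≥0 × ℝ≥0 => jumpSize r (Function.leftLim w z.1) z.2 :=
    (measurable_jumpSize r).comp (g := fun z : I × ℝ≥0 => jumpSize r z.1 z.2)
      (f := fun z : ℝ≥0 × ℝ≥0 => (Function.leftLim w z.1, z.2))
      ((hwm.comp measurable_fst).prodMk measurable_snd)
  obtain ⟨i2, e2⟩ := integrable_and_integral_eq
    (μ := (leb.prod leb).restrict (Set.Ioc 0 t ×ˢ Set.univ))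
    hg2 (fun z => jumpSize_nonneg r _ _)
    (c := C * ∫ a in Set.Ioc 0 t, ((Function.leftLim w a : I) : ℝ) ^ 2 ∂leb)
    (mul_nonneg hC0 (integral_nonneg fun a => sq_nonneg _)) (by
      rw [← Measure.prod_restrict, Measure.restrict_univ, lintegral_prod _
        hg2.ennreal_ofReal.aemeasurable, ← integral_const_mul,
        ofReal_integral_eq_lintegral_ofReal (hint.const_mul C)
          (ae_of_all _ fun a => mul_nonneg hC0 (sq_nonneg _))]
      simp_rw [lintegral_jumpSize]
      rfl)
  refine ⟨hint, i1, i2, ?_⟩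
  have e1' : ∫ z in Set.Ioc 0 t ×ˢ Set.univ, jumpSize r (Function.leftLim w z.1) z.2.2
    ∂(superposition ξ ω) = x - w t := e1
  rw [e1', e2, hw0, hC]
  ring

lemma isCadlag_fragProcess {Ω : Type*} {mΩ : MeasurableSpace Ω} {P : Measure Ω}
    {M : Set (I × ℝ≥0)} {ξ : ℕ → Ω → ℝ≥0 × I × ℝ≥0}
    (hξ : IsMarkedRenewal (rate r) (markLaw r 0) M P ξ) (x : I) (ω : Ω) :
    IsCadlag fun t => fragProcess r x ξ t ω :=
  isCadlag_step (hξ.strictMono_arrival ω) rfl (hξ.tendsto_arrival ω)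

end Equation

/-! ### The past of a marked renewal process -/

section Past

variable {Ω K : Type*} [MeasurableSpace K] {mΩ : MeasurableSpace Ω} {c : ℝ≥0} {μ : Measure K}
  {M : Set K} {P : Measure Ω} {ξ : ℕ → Ω → ℝ≥0 × K} {m : MeasurableSpace Ω} {t : ℝ≥0}

lemma IsMarkedRenewal.measurable_pointCount_past (hξ : IsMarkedRenewal c μ M P ξ)
    (hp : ∀ A : Set (ℝ≥0 × K), MeasurableSet A → A ⊆ Set.Iic t ×ˢ Set.univ →
      Measurable[m] fun ω => markedPoints ξ ω A) {q : ℝ≥0} (hq : q ≤ t) :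
    Measurable[m] (pointCount ξ q) := by
  have h0 (ω) : pointCount ξ 0 ω = 0 :=
    counting_zero (hξ.strictMono_arrival ω) rfl (hξ.tendsto_arrival ω)
  have : pointCount ξ q = fun ω => ⌊(markedPoints ξ ω (Set.Ioc 0 q ×ˢ Set.univ)).toReal⌋₊ := by
    ext ω
    rw [hξ.markedPoints_Ioc, h0]
    simp
  rw [this]
  exact measurable_floor_toReal.comp (hp _ (measurableSet_Ioc.prod .univ)
    (Set.prod_mono (fun a ha => ha.2.trans hq) subset_rfl))

/-- The mark of the `k`-th point is known when this point has arrived. It is found by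
isolating the point between two times `a < b` of a countable set. -/
lemma IsMarkedRenewal.measurableSet_mark_past (hξ : IsMarkedRenewal c μ M P ξ)
    (hp : ∀ A : Set (ℝ≥0 × K), MeasurableSet A → A ⊆ Set.Iic t ×ˢ Set.univ →
      Measurable[m] fun ω => markedPoints ξ ω A) (k : ℕ) {B : Set K} (hB : MeasurableSet B) :
    MeasurableSet[m] {ω | k < pointCount ξ t ω ∧ (ξ k ω).2 ∈ B} := by
  obtain ⟨D, hDc, hDd⟩ := TopologicalSpace.exists_countable_dense ℝ≥0
  set D' : Set ℝ≥0 := insert t D ∩ Set.Iic t with hD'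
  have hD'c : D'.Countable := (hDc.insert t).mono Set.inter_subset_left
  have hsum (a b : ℝ≥0) (ω) : markedPoints ξ ω (Set.Ioc a b ×ˢ B) =
      ∑ j ∈ Finset.Ico (pointCount ξ a ω) (pointCount ξ b ω), B.indicator 1 (ξ j ω).2 := by
    have hm : MeasurableSet (Set.Ioc a b ×ˢ B) := measurableSet_Ioc.prod hB
    rw [← lintegral_indicator_one hm, hξ.lintegral_markedPoints_eq_sum (s := a) (t := b) _
      (measurable_one.indicator hm) (fun z hz => Set.indicator_of_notMem (fun h => hz h.1) _)]
    refine Finset.sum_congr rfl fun j hj => ?_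
    rw [Finset.mem_Ico, ← not_lt, ← Nat.succ_le_iff, ← Nat.succ_le_iff, hξ.le_pointCount_iff,
      hξ.le_pointCount_iff, not_le] at hj
    by_cases h : (ξ j ω).2 ∈ B
    · rw [Set.indicator_of_mem h, Set.indicator_of_mem (show (arrival ξ (j + 1) ω, (ξ j ω).2) ∈
        Set.Ioc a b ×ˢ B from ⟨hj, h⟩)]; rfl
    · rw [Set.indicator_of_notMem h, Set.indicator_of_notMem fun h' => h h'.2]
  have key : {ω | k < pointCount ξ t ω ∧ (ξ k ω).2 ∈ B} = ⋃ a ∈ D', ⋃ b ∈ D',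
      {ω | pointCount ξ a ω = k} ∩ {ω | pointCount ξ b ω = k + 1} ∩
        {ω | markedPoints ξ ω (Set.Ioc a b ×ˢ B) = 1} := by
    ext ω
    simp only [Set.mem_iUnion, Set.mem_inter_iff, Set.mem_ofPred_eq, exists_prop]
    constructor
    · rintro ⟨hk, hkB⟩
      have hk1 : arrival ξ (k + 1) ω ≤ t := hξ.le_pointCount_iff.1 hk
      have hS := hξ.strictMono_arrival ω
      obtain ⟨a, haD, ha1, ha2⟩ := hDd.exists_between (hS k.lt_succ_self)
      obtain ⟨b, hbD, hb1, hb2⟩ : ∃ b ∈ D', arrival ξ (k + 1) ω ≤ b ∧ b < arrival ξ (k + 2) ω := by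
        rcases hk1.eq_or_lt with h | h
        · exact ⟨t, ⟨Set.mem_insert _ _, Set.mem_Iic.2 le_rfl⟩, h.le, h ▸ hS (k + 1).lt_succ_self⟩
        · obtain ⟨b, hbD, hb1, hb2⟩ := hDd.exists_between (lt_min h (hS (k + 1).lt_succ_self))
          exact ⟨b, ⟨Set.mem_insert_of_mem _ hbD, hb2.le.trans (min_le_left _ _)⟩, hb1.le,
            hb2.trans_le (min_le_right _ _)⟩
      have ea : pointCount ξ a ω = k := hξ.pointCount_eq_iff.2 ⟨ha1.le, ha2⟩
      have eb : pointCount ξ b ω = k + 1 := hξ.pointCount_eq_iff.2 ⟨hb1, hb2⟩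
      refine ⟨a, ⟨Set.mem_insert_of_mem _ haD, ha2.le.trans hk1⟩, b, hbD, ⟨ea, eb⟩, ?_⟩
      rw [hsum, ea, eb]
      simp [hkB]
    · rintro ⟨a, ha, b, hb, ⟨ea, eb⟩, h⟩
      rw [hsum, ea, eb] at h
      refine ⟨Nat.lt_of_succ_le (eb.symm.le.trans (hξ.pointCount_mono ω hb.2)), ?_⟩
      by_contra hkB
      simp [hkB] at h
  rw [key]
  refine MeasurableSet.biUnion hD'c fun a ha => MeasurableSet.biUnion hD'c fun b hb =>
    ((hξ.measurable_pointCount_past hp ha.2 (measurableSet_singleton k)).inter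
      (hξ.measurable_pointCount_past hp hb.2 (measurableSet_singleton (k + 1)))).inter
      (hp _ (measurableSet_Ioc.prod hB) (Set.prod_mono (fun s hs => hs.2.trans hb.2)
        (Set.subset_univ _)) (measurableSet_singleton 1))

end Past

section Adapted

variable (r : Set.Ioo (0 : ℝ) 1)

lemma measurable_fragProcess_past {Ω : Type*} {mΩ : MeasurableSpace Ω} {P : Measure Ω}
    {M : Set (I × ℝ≥0)} {ξ : ℕ → Ω → ℝ≥0 × I × ℝ≥0} {m : MeasurableSpace Ω} {t : ℝ≥0}
    (hξ : IsMarkedRenewal (rate r) (markLaw r 0) M P ξ)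
    (hp : ∀ A : Set (ℝ≥0 × I × ℝ≥0), MeasurableSet A → A ⊆ Set.Iic t ×ˢ Set.univ →
      Measurable[m] fun ω => markedPoints ξ ω A) (x : I) :
    Measurable[m] (fragProcess r x ξ t) := by
  classical
  have hV : Measurable[m] (pointCount ξ t) := hξ.measurable_pointCount_past hp le_rfl
  -- The marks of the points which have not arrived at time `t` are replaced by `0`.
  set s' : Ω → ℕ → ℝ≥0 := fun ω k => if k < pointCount ξ t ω then (ξ k ω).2.2 else 0 with hs'
  have hs'm : Measurable[m] s' := by
    refine @measurable_pi_lambda _ _ _ m _ _ fun k B hB => ?_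
    have h1 := hξ.measurableSet_mark_past hp k (B := Prod.snd ⁻¹' B) (measurable_snd hB)
    have h2 : MeasurableSet[m] {ω | k < pointCount ξ t ω} := hV (measurableSet_Ioi (a := k))
    by_cases h0 : (0 : ℝ≥0) ∈ B
    · convert h1.union h2.compl using 1
      ext ω
      by_cases h : k < pointCount ξ t ω <;> simp [hs', h, h0]
    · convert h1 using 1
      ext ω
      by_cases h : k < pointCount ξ t ω <;> simp [hs', h, h0]
  have heq : fragProcess r x ξ t = fun ω => fragChain r x (s' ω) (pointCount ξ t ω) := by
    ext ω : 1
    exact fragChain_congr r x fun k hk => by simp [hs', hk]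
  rw [heq]
  have hΦ : Measurable fun z : (ℕ → ℝ≥0) × ℕ => fragChain r x z.1 z.2 :=
    measurable_from_prod_countable_left fun n => measurable_fragChain r x n
  exact hΦ.comp (hs'm.prodMk hV)

variable {Ω : ℕ → Type*} {ξ : ∀ n, ℕ → Ω n → ℝ≥0 × I × ℝ≥0} [∀ n, MeasurableSpace (Ω n)]
  {P : ∀ n, Measure (Ω n)}

/-- The points of the strip `0` are those of the first renewal process. -/
lemma superposition_inter_strip (hξ : ∀ n, IsMarkedRenewal (rate r) (markLaw r n)
    (Set.univ ×ˢ strip r n) (P n) (ξ n)) {A : Set (ℝ≥0 × I × ℝ≥0)} (hA : MeasurableSet A)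
    (ω : ∀ n, Ω n) : superposition ξ ω (A ∩ {z | z.2.2 ∈ strip r 0}) =
      markedPoints (ξ 0) (ω 0) A := by
  have hs : MeasurableSet {z : ℝ≥0 × I × ℝ≥0 | z.2.2 ∈ strip r 0} :=
    (measurable_snd.comp measurable_snd) (measurableSet_strip r 0)
  rw [superposition, Measure.sum_apply _ (hA.inter hs), tsum_eq_single 0]
  · simp only [markedPoints, Measure.sum_apply _ (hA.inter hs), Measure.sum_apply _ hA]
    congr 1 with k
    rw [Measure.dirac_apply' _ (hA.inter hs), Measure.dirac_apply' _ hA]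
    have h := ((hξ 0).mark_mem k (ω 0)).2
    by_cases hk : (arrival (ξ 0) (k + 1) (ω 0), (ξ 0 k (ω 0)).2) ∈ A
    · rw [Set.indicator_of_mem hk, Set.indicator_of_mem (Set.mem_inter hk h)]
    · rw [Set.indicator_of_notMem hk, Set.indicator_of_notMem fun h' => hk h'.1]
  · intro n hn
    rw [markedPoints, Measure.sum_apply _ (hA.inter hs), ENNReal.tsum_eq_zero]
    intro k
    rw [Measure.dirac_apply' _ (hA.inter hs)]
    exact Set.indicator_of_notMem (fun h => Set.disjoint_left.1 (pairwise_disjoint_strip r hn)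
      ((hξ n).mark_mem k (ω n)).2 h.2) _

lemma measurable_fragProcess_pointFiltration [∀ n, IsProbabilityMeasure (P n)]
    (hξ : ∀ n, IsMarkedRenewal (rate r) (markLaw r n) (Set.univ ×ˢ strip r n) (P n) (ξ n)) (x : I)
    (t : ℝ≥0) :
    Measurable[pointFiltration (superposition ξ) (measurable_superposition r hξ) t]
      fun ω => fragProcess r x (ξ 0) t (ω 0) := by
  refine measurable_fragProcess_past r
    ((hξ 0).comp (measurePreserving_eval_infinitePi P 0)) (fun A hA hAt => ?_) x
  have hs : MeasurableSet {z : ℝ≥0 × I × ℝ≥0 | z.2.2 ∈ strip r 0} :=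
    (measurable_snd.comp measurable_snd) (measurableSet_strip r 0)
  have := measurable_pointFiltration (hm := measurable_superposition r hξ) (hA.inter hs)
    (Set.inter_subset_left.trans hAt)
  simp only [superposition_inter_strip r hξ hA] at this
  exact this

/-- The equation has a weak solution, which is built from the points of the strip `0`. -/
lemma isWeakSolution_fragProcess [∀ n, IsProbabilityMeasure (P n)]
    (hξ : ∀ n, IsMarkedRenewal (rate r) (markLaw r n) (Set.univ ×ˢ strip r n) (P n) (ξ n)) (x : I) :
    IsWeakSolution r (Measure.dirac x) (Measure.infinitePi P)
      (pointFiltration (superposition ξ) (measurable_superposition r hξ)).rightCont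
      (superposition ξ) (fun t ω => fragProcess r x (ξ 0) t (ω 0)) where
  rightContinuous := inferInstance
  poisson := isPoissonRandomMeasureWrt_superposition r hξ
  adapted t := (measurable_fragProcess_pointFiltration r hξ x t).mono
    ((pointFiltration _ _).le_rightCont t) le_rfl
  cadlag ω := isCadlag_fragProcess r (hξ 0) x (ω 0)
  initial := by
    have : (fun ω : ∀ n, Ω n => fragProcess r x (ξ 0) 0 (ω 0)) = fun _ => x := by
      ext ω : 1
      rw [fragProcess, pointCount,
        counting_zero ((hξ 0).strictMono_arrival _) rfl ((hξ 0).tendsto_arrival _)]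
      rfl
    rw [this]
    exact ⟨aemeasurable_const, by simp⟩
  equation := ae_of_all _ fun ω => solvesFragmentationEquation r hξ x ω

end Adapted

/-! ### The law of a jump process -/

section Law

/-- Processes with the same finite-dimensional laws have the same law. -/
lemma map_process_eq {Ω Ω' ι E : Type*} [MeasurableSpace E] {mΩ : MeasurableSpace Ω}
    {mΩ' : MeasurableSpace Ω'} {P : Measure Ω} {P' : Measure Ω'} [IsProbabilityMeasure P]
    [IsProbabilityMeasure P'] {X : ι → Ω → E} {X' : ι → Ω' → E} (hX : ∀ i, Measurable (X i))
    (hX' : ∀ i, Measurable (X' i))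
    (h : ∀ (S : Finset ι) (A : ι → Set E), (∀ i, MeasurableSet (A i)) →
      P (⋂ i ∈ S, X i ⁻¹' A i) = P' (⋂ i ∈ S, X' i ⁻¹' A i)) :
    P.map (fun ω i => X i ω) = P'.map (fun ω i => X' i ω) := by
  have hm : Measurable fun ω i => X i ω := measurable_pi_lambda _ hX
  have hm' : Measurable fun ω i => X' i ω := measurable_pi_lambda _ hX'
  have := Measure.isProbabilityMeasure_map (μ := P) hm.aemeasurable
  have := Measure.isProbabilityMeasure_map (μ := P') hm'.aemeasurable
  refine ext_of_generate_finite _ generateFrom_squareCylinders.symm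
    (isPiSystem_squareCylinders (fun i => MeasurableSpace.isPiSystem_measurableSet)
      fun i => MeasurableSet.univ) ?_ (by simp)
  rintro _ ⟨S, A, hA, rfl⟩
  have hA' (i) : MeasurableSet (A i) := hA i trivial
  have hbox : MeasurableSet ((S : Set ι).pi A) :=
    MeasurableSet.pi S.countable_toSet fun i _ => hA' i
  rw [Measure.map_apply hm hbox, Measure.map_apply hm' hbox]
  convert h S A hA' using 2 <;> · ext ω; simp

lemma integral_prod_indicator {Ω ι E : Type*} [MeasurableSpace E] {mΩ : MeasurableSpace Ω}
    {P : Measure Ω} [IsProbabilityMeasure P] {X : ι → Ω → E} (hX : ∀ i, Measurable (X i))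
    (S : Finset ι) {A : ι → Set E} (hA : ∀ i, MeasurableSet (A i)) :
    ∫ ω, ∏ i ∈ S, (A i).indicator 1 (X i ω) ∂P = P.real (⋂ i ∈ S, X i ⁻¹' A i) := by
  classical
  rw [← integral_indicator_one (S.measurableSet_biInter fun i _ => hX i (hA i))]
  congr 1 with ω
  by_cases h : ω ∈ ⋂ i ∈ S, X i ⁻¹' A i
  · rw [Set.indicator_of_mem h]
    simp only [Set.mem_iInter] at h
    exact Finset.prod_eq_one fun i hi =>
      Set.indicator_of_mem (s := A i) (h i hi) _
  · rw [Set.indicator_of_notMem h]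
    simp only [Set.mem_iInter, not_forall] at h
    obtain ⟨i, hi, h⟩ := h
    exact Finset.prod_eq_zero hi (Set.indicator_of_notMem (s := A i) h _)

lemma prod_update {Ω E : Type*} (f : ℕ → E → ℝ) (g : E → ℝ) (W : ℕ → Ω → E) (n : ℕ) (ω : Ω) :
    ∏ k ∈ Finset.range (n + 1), Function.update f n (fun y => f n y * g y) k (W k ω) =
      (∏ k ∈ Finset.range n, f k (W k ω)) * (f n (W n ω) * g (W n ω)) := by
  rw [Finset.prod_range_succ, Function.update_self]
  congr 1
  exact Finset.prod_congr rfl fun k hk => by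
    rw [Function.update_of_ne (Finset.mem_range.1 hk).ne]

lemma iInter_eq_iInter_ite {Ω ι E : Type*} [DecidableEq ι] (W : ι → Ω → E) (A : ι → Set E)
    {S T : Finset ι} (hST : S ⊆ T) : ⋂ k ∈ S, W k ⁻¹' A k =
      ⋂ k ∈ T, W k ⁻¹' (if k ∈ S then A k else Set.univ) := by
  ext ω
  simp only [Set.mem_iInter, Set.mem_preimage]
  refine ⟨fun h k _ => ?_, fun h k hk => ?_⟩
  · split_ifs with hk
    exacts [h k hk, trivial]
  · simpa [hk] using h k (hST hk)

section Chain

variable {Ω E : Type*} [MeasurableSpace E] {mΩ : MeasurableSpace Ω} {P : Measure Ω}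
  {κ : Kernel E E} {ν : Measure E} {Y : ℕ → Ω → E}

/-- The σ-algebra of the first `n + 1` variables. -/
abbrev chainPast (Y : ℕ → Ω → E) (n : ℕ) : MeasurableSpace Ω :=
  ⨆ j ≤ n, MeasurableSpace.comap (Y j) inferInstance

/-- The last variable is averaged over the transition from the one before it. -/
lemma IsMarkovChain.integral_prod_succ [IsProbabilityMeasure P] [IsMarkovKernel κ]
    (hY : IsMarkovChain κ ν P Y)
    {f : ℕ → E → ℝ} (hf : ∀ k, Measurable (f k)) (hf0 : ∀ k y, 0 ≤ f k y) (hf1 : ∀ k y, f k y ≤ 1)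
    (n : ℕ) : ∫ ω, ∏ k ∈ Finset.range (n + 1 + 1), f k (Y k ω) ∂P =
      ∫ ω, (∏ k ∈ Finset.range n, f k (Y k ω)) *
        (f n (Y n ω) * ∫ y, f (n + 1) y ∂(κ (Y n ω))) ∂P := by
  have hmle : chainPast Y n ≤ mΩ := iSup₂_le fun j _ => measurable_iff_comap_le.1 (hY.measurable j)
  have hYm (j) (hj : j ≤ n) : Measurable[chainPast Y n] (Y j) := measurable_iff_comap_le.2
    (le_iSup₂ (f := fun j (_ : j ≤ n) => MeasurableSpace.comap (Y j) inferInstance) j hj)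
  set g : Ω → ℝ := fun ω => ∏ k ∈ Finset.range (n + 1), f k (Y k ω) with hg
  have hgm : Measurable[chainPast Y n] g := Finset.measurable_fun_prod _ fun k hk =>
    (hf k).comp (hYm k (Nat.lt_succ_iff.1 (Finset.mem_range.1 hk)))
  have hg1 (ω) : ‖g ω‖ ≤ 1 := by
    rw [Real.norm_of_nonneg (Finset.prod_nonneg fun k _ => hf0 k _)]
    exact Finset.prod_le_one (fun k _ => hf0 k _) fun k _ => hf1 k _
  have hi : Integrable (fun ω => f (n + 1) (Y (n + 1) ω)) P :=
    Integrable.of_bound ((hf _).comp (hY.measurable _)).aestronglyMeasurable 1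
      (ae_of_all _ fun ω => by rw [Real.norm_of_nonneg (hf0 _ _)]; exact hf1 _ _)
  have hi' : Integrable (g * fun ω => f (n + 1) (Y (n + 1) ω)) P :=
    hi.bdd_mul (hgm.mono hmle le_rfl).aestronglyMeasurable (ae_of_all _ hg1)
  have e := condExp_mul_of_stronglyMeasurable_left (μ := P) hgm.stronglyMeasurable hi' hi
  have e' := hY.transition n (f (n + 1)) (hf _) (hf0 _) ⟨1, hf1 _⟩
  have : ∫ ω, ∏ k ∈ Finset.range (n + 1 + 1), f k (Y k ω) ∂P =
      ∫ ω, (g * fun ω => f (n + 1) (Y (n + 1) ω)) ω ∂P := by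
    congr 1 with ω
    rw [Finset.prod_range_succ]; rfl
  rw [this, ← integral_condExp hmle]
  refine integral_congr_ae ?_
  filter_upwards [e, e'] with ω h1 h2
  rw [h1, Pi.mul_apply, h2, hg]
  simp only
  rw [Finset.prod_range_succ, mul_assoc]

lemma IsMarkovChain.integral_prod_eq {Ω' : Type*} {mΩ' : MeasurableSpace Ω'} {P' : Measure Ω'}
    {Y' : ℕ → Ω' → E} [IsProbabilityMeasure P] [IsProbabilityMeasure P'] [IsMarkovKernel κ]
    (hY : IsMarkovChain κ ν P Y) (hY' : IsMarkovChain κ ν P' Y') (n : ℕ) :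
    ∀ f : ℕ → E → ℝ, (∀ k, Measurable (f k)) → (∀ k y, 0 ≤ f k y) → (∀ k y, f k y ≤ 1) →
      ∫ ω, ∏ k ∈ Finset.range (n + 1), f k (Y k ω) ∂P =
        ∫ ω, ∏ k ∈ Finset.range (n + 1), f k (Y' k ω) ∂P' := by
  induction n with
  | zero =>
    intro f hf hf0 hf1
    simp only [zero_add, Finset.prod_range_one]
    rw [← integral_map (f := f 0) (hY.measurable 0).aemeasurable (hf 0).aestronglyMeasurable,
      ← integral_map (f := f 0) (hY'.measurable 0).aemeasurable (hf 0).aestronglyMeasurable,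
      hY.initial.map_eq, hY'.initial.map_eq]
  | succ n ih =>
    intro f hf hf0 hf1
    rw [hY.integral_prod_succ hf hf0 hf1, hY'.integral_prod_succ hf hf0 hf1]
    have hκ0 (y) : 0 ≤ ∫ z, f (n + 1) z ∂(κ y) := integral_nonneg (hf0 _)
    have hκ1 (y) : ∫ z, f (n + 1) z ∂(κ y) ≤ 1 := by
      have h := norm_integral_le_of_norm_le_const (C := 1) (μ := κ y) (f := f (n + 1))
        (ae_of_all _ fun z => by rw [Real.norm_of_nonneg (hf0 _ _)]; exact hf1 _ _)
      rw [probReal_univ, mul_one] at h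
      exact (le_abs_self _).trans h
    have hκm : Measurable fun y => ∫ z, f (n + 1) z ∂(κ y) :=
      ((hf (n + 1)).stronglyMeasurable.integral_kernel (κ := κ)).measurable
    -- The `n`-th function absorbs the last one, averaged over the transition.
    have := ih (Function.update f n fun y => f n y * ∫ z, f (n + 1) z ∂(κ y)) ?_ ?_ ?_
    · have h1 := prod_update f (fun y => ∫ z, f (n + 1) z ∂(κ y)) Y n
      have h2 := prod_update f (fun y => ∫ z, f (n + 1) z ∂(κ y)) Y' n
      simpa only [h1, h2] using this
    · intro k
      rcases eq_or_ne k n with rfl | hk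
      · rw [Function.update_self]; exact (hf k).mul hκm
      · rw [Function.update_of_ne hk]; exact hf k
    · intro k y
      rcases eq_or_ne k n with rfl | hk
      · rw [Function.update_self]; exact mul_nonneg (hf0 _ _) (hκ0 _)
      · rw [Function.update_of_ne hk]; exact hf0 k y
    · intro k y
      rcases eq_or_ne k n with rfl | hk
      · rw [Function.update_self]; exact mul_le_one₀ (hf1 _ _) (hκ0 _) (hκ1 _)
      · rw [Function.update_of_ne hk]; exact hf1 k y

/-- The transition kernel and the initial law determine the law of a Markov chain. -/
lemma IsMarkovChain.map_eq {Ω' : Type*} {mΩ' : MeasurableSpace Ω'} {P' : Measure Ω'}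
    {Y' : ℕ → Ω' → E} [IsProbabilityMeasure P] [IsProbabilityMeasure P'] [IsMarkovKernel κ]
    (hY : IsMarkovChain κ ν P Y) (hY' : IsMarkovChain κ ν P' Y') :
    P.map (fun ω k => Y k ω) = P'.map (fun ω k => Y' k ω) := by
  classical
  refine map_process_eq hY.measurable hY'.measurable fun S A hA => ?_
  set B : ℕ → Set E := fun k => if k ∈ S then A k else Set.univ with hB
  have hBm (k) : MeasurableSet (B k) := by
    simp only [hB]; split_ifs; exacts [hA k, .univ]
  obtain ⟨n, hn⟩ := S.exists_nat_subset_range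
  rw [iInter_eq_iInter_ite Y A (hn.trans (Finset.range_mono n.le_succ)),
    iInter_eq_iInter_ite Y' A (hn.trans (Finset.range_mono n.le_succ)),
    ← ENNReal.toReal_eq_toReal_iff' (measure_ne_top _ _) (measure_ne_top _ _)]
  change P.real _ = P'.real _
  rw [← integral_prod_indicator hY.measurable _ hBm, ← integral_prod_indicator hY'.measurable _ hBm]
  refine hY.integral_prod_eq hY' n (fun k => (B k).indicator 1)
    (fun k => measurable_one.indicator (hBm k)) (fun k y => ?_) fun k y => ?_
  · exact Set.indicator_nonneg (fun _ _ => zero_le_one) _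
  · exact Set.indicator_le_self' (f := 1) (fun _ _ => zero_le_one) _

end Chain

section Poisson

variable {Ω : Type*} {mΩ : MeasurableSpace Ω} {P : Measure Ω} {c : ℝ≥0} {V : ℝ≥0 → Ω → ℕ}

lemma IsPoissonProcess.map_increments [IsProbabilityMeasure P] (hV : IsPoissonProcess c P V) {n : ℕ}
    {t : Fin (n + 1) → ℝ≥0} (ht : Monotone t) :
    P.map (fun ω (i : Fin n) => V (t i.succ) ω - V (t i.castSucc) ω) =
      Measure.pi fun i => poissonMeasure (c * (t i.succ - t i.castSucc)) := by
  have h := hV.indep n t ht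
  refine ((iIndepFun_iff_map_fun_eq_pi_map fun i =>
    ((hV.measurable _).sub (hV.measurable _)).aemeasurable).1 h).trans ?_
  congr 1 with i : 1
  exact (hV.law _ _ (ht i.castSucc_lt_succ.le)).map_eq

lemma IsPoissonProcess.eq_sum_increments (hV : IsPoissonProcess c P V) {n : ℕ}
    {t : Fin (n + 1) → ℝ≥0} (ht : Monotone t) (h0 : t 0 = 0) (ω : Ω) (i : Fin (n + 1)) :
    V (t i) ω = ∑ j : Fin n, if j.castSucc < i then V (t j.succ) ω - V (t j.castSucc) ω else 0 := by
  induction i using Fin.induction with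
  | zero => simp [h0, hV.zero]
  | succ i ih =>
    have : ∀ j : Fin n, (if j.castSucc < i.succ then V (t j.succ) ω - V (t j.castSucc) ω else 0) =
        (if j.castSucc < i.castSucc then V (t j.succ) ω - V (t j.castSucc) ω else 0) +
          (if j = i then V (t i.succ) ω - V (t i.castSucc) ω else 0) := by
      intro j
      rcases lt_trichotomy j i with h | rfl | h
      · simp [h, h.ne, h.le, Fin.castSucc_lt_succ_iff]
      · simp
      · simp [h.ne', h.not_gt, h.not_ge, Fin.castSucc_lt_succ_iff]
    rw [Finset.sum_congr rfl fun j _ => this j, Finset.sum_add_distrib, ← ih,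
      Finset.sum_ite_eq' Finset.univ i, if_pos (Finset.mem_univ i),
      Nat.add_sub_cancel' (hV.mono ω (ht i.castSucc_lt_succ.le))]

/-- The parameter determines the law of a Poisson process. -/
lemma IsPoissonProcess.map_eq {Ω' : Type*} {mΩ' : MeasurableSpace Ω'} {P' : Measure Ω'}
    {V' : ℝ≥0 → Ω' → ℕ} [IsProbabilityMeasure P] [IsProbabilityMeasure P']
    (hV : IsPoissonProcess c P V) (hV' : IsPoissonProcess c P' V') :
    P.map (fun ω t => V t ω) = P'.map (fun ω t => V' t ω) := by
  classical
  refine map_process_eq hV.measurable hV'.measurable fun S A hA => ?_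
  obtain ⟨n, hn⟩ : ∃ n, (insert 0 S).card = n + 1 :=
    ⟨_, (Nat.succ_pred_eq_of_pos (Finset.card_pos.2 ⟨0, Finset.mem_insert_self _ _⟩)).symm⟩
  set t : Fin (n + 1) → ℝ≥0 := ⇑((insert 0 S).orderEmbOfFin hn) with ht
  have htm : Monotone t := ((insert 0 S).orderEmbOfFin hn).monotone
  have hmem (s) (hs : s ∈ insert 0 S) : ∃ i, t i = s := by
    have := Finset.range_orderEmbOfFin (insert 0 S) hn
    have hs' : s ∈ Set.range ((insert 0 S).orderEmbOfFin hn) := by rw [this]; exact hs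
    exact hs'
  have h0 : t 0 = 0 := by
    obtain ⟨i, hi⟩ := hmem 0 (Finset.mem_insert_self _ _)
    exact le_antisymm (hi ▸ htm (Fin.zero_le i)) zero_le
  -- The events are about the increments, whose joint law is known.
  set D : Set (Fin n → ℕ) := {d | ∀ i : Fin (n + 1), t i ∈ S →
    (∑ j : Fin n, if j.castSucc < i then d j else 0) ∈ A (t i)} with hD
  have hDm : MeasurableSet D := Set.to_countable D |>.measurableSet
  have e1 : ⋂ s ∈ S, V s ⁻¹' A s =
      (fun ω (i : Fin n) => V (t i.succ) ω - V (t i.castSucc) ω) ⁻¹' D := by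
    ext ω
    simp only [Set.mem_iInter, Set.mem_preimage, hD, Set.mem_ofPred_eq,
      ← hV.eq_sum_increments htm h0 ω]
    refine ⟨fun h i hi => h _ hi, fun h s hs => ?_⟩
    obtain ⟨i, rfl⟩ := hmem s (Finset.mem_insert_of_mem hs)
    exact h i hs
  have e2 : ⋂ s ∈ S, V' s ⁻¹' A s =
      (fun ω (i : Fin n) => V' (t i.succ) ω - V' (t i.castSucc) ω) ⁻¹' D := by
    ext ω
    simp only [Set.mem_iInter, Set.mem_preimage, hD, Set.mem_ofPred_eq,
      ← hV'.eq_sum_increments htm h0 ω]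
    refine ⟨fun h i hi => h _ hi, fun h s hs => ?_⟩
    obtain ⟨i, rfl⟩ := hmem s (Finset.mem_insert_of_mem hs)
    exact h i hs
  have hm : Measurable fun ω (i : Fin n) => V (t i.succ) ω - V (t i.castSucc) ω :=
    measurable_pi_lambda _ fun i => (hV.measurable _).sub (hV.measurable _)
  have hm' : Measurable fun ω (i : Fin n) => V' (t i.succ) ω - V' (t i.castSucc) ω :=
    measurable_pi_lambda _ fun i => (hV'.measurable _).sub (hV'.measurable _)
  rw [e1, e2, ← Measure.map_apply hm hDm, ← Measure.map_apply hm' hDm, hV.map_increments htm,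
    hV'.map_increments htm]

end Poisson

/-- Two jump processes of the same kernel, with the same initial law, have the same law. -/
lemma IsJumpProcess.map_eq {Ω Ω' E : Type*} [MeasurableSpace E] {mΩ : MeasurableSpace Ω}
    {mΩ' : MeasurableSpace Ω'} {P : Measure Ω} {P' : Measure Ω'} [IsProbabilityMeasure P]
    [IsProbabilityMeasure P'] {N : Kernel E E} [IsMarkovKernel (normalizedKernel N)] {ν : Measure E}
    {X : ℝ≥0 → Ω → E} {X' : ℝ≥0 → Ω' → E} (hX : IsJumpProcess N ν P X)
    (hX' : IsJumpProcess N ν P' X') :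
    P.map (fun ω t => X t ω) = P'.map (fun ω t => X' t ω) := by
  obtain ⟨Y, V, hY, hV, hi, hXe⟩ := hX
  obtain ⟨Y', V', hY', hV', hi', hXe'⟩ := hX'
  set Φ : (ℕ → E) × (ℝ≥0 → ℕ) → ℝ≥0 → E := fun z t => z.1 (z.2 t) with hΦ
  have hΦm : Measurable Φ := measurable_pi_lambda _ fun t => by
    have h : Measurable fun z : (ℕ → E) × ℕ => z.1 z.2 :=
      measurable_from_prod_countable_left fun n => measurable_pi_apply n
    exact h.comp (f := fun z : (ℕ → E) × (ℝ≥0 → ℕ) => (z.1, z.2 t)) (by fun_prop)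
  have hYm := measurable_pi_lambda (fun ω k => Y k ω) hY.measurable
  have hVm := measurable_pi_lambda (fun ω t => V t ω) hV.measurable
  have hYm' := measurable_pi_lambda (fun ω k => Y' k ω) hY'.measurable
  have hVm' := measurable_pi_lambda (fun ω t => V' t ω) hV'.measurable
  have e : (fun ω t => X t ω) = Φ ∘ fun ω => (fun k => Y k ω, fun t => V t ω) := by
    ext ω t; exact hXe t ω
  have e' : (fun ω t => X' t ω) = Φ ∘ fun ω => (fun k => Y' k ω, fun t => V' t ω) := by
    ext ω t; exact hXe' t ω
  rw [e, e', ← Measure.map_map hΦm (hYm.prodMk hVm), ← Measure.map_map hΦm (hYm'.prodMk hVm'),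
    hi.map_prod_eq_prod_map_map hYm.aemeasurable hVm.aemeasurable,
    hi'.map_prod_eq_prod_map_map hYm'.aemeasurable hVm'.aemeasurable, hY.map_eq hY', hV.map_eq hV']

instance (r : Set.Ioo (0 : ℝ) 1) : IsMarkovKernel (normalizedKernel (fragKernel r)) := ⟨fun y => by
  rw [← map_fragStep]
  exact Measure.isProbabilityMeasure_map ((measurable_fragStep r).comp
    (g := fun z : I × ℝ≥0 => fragStep r z.1 z.2) (f := fun m : I × ℝ≥0 => (y, m.2))
    (by fun_prop)).aemeasurable⟩

end Law

end Avalanche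

theorem theorem3p1 (r : Set.Ioo (0 : ℝ) 1) (x : I) :
    (∃ (Ω : Type) (_ : MeasurableSpace Ω) (P : Measure Ω) (_ : IsProbabilityMeasure P)
      (X : ℝ≥0 → Ω → I),
        Avalanche.IsJumpProcess (Avalanche.fragKernel r) (Measure.dirac x) P X) ∧
    ∃ (Ω : Type) (mΩ : MeasurableSpace Ω) (P : Measure Ω) (_ : IsProbabilityMeasure P)
      (ℱ : Filtration ℝ≥0 mΩ) (p : Ω → Measure (ℝ≥0 × I × ℝ≥0)) (Z : ℝ≥0 → Ω → I),
        Avalanche.IsWeakSolution r (Measure.dirac x) P ℱ p Z ∧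
        ∀ (Ω' : Type*) (_ : MeasurableSpace Ω') (P' : Measure Ω') (_ : IsProbabilityMeasure P')
          (X : ℝ≥0 → Ω' → I),
          Avalanche.IsJumpProcess (Avalanche.fragKernel r) (Measure.dirac x) P' X →
          P.map (fun ω t => Z t ω) = P'.map (fun ω t => X t ω) := by
  choose Ω mΩ P hP ξ hξ using fun n => Avalanche.exists_isMarkedRenewal (Avalanche.rate_pos r)
    (Avalanche.markLaw r n) (MeasurableSet.univ.prod (Avalanche.measurableSet_strip r n))
    (Avalanche.markLaw_mem_strip r n)
  have hZ : Avalanche.IsJumpProcess (Avalanche.fragKernel r) (Measure.dirac x)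
      (Measure.infinitePi P) fun t ω => Avalanche.fragProcess r x (ξ 0) t (ω 0) :=
    Avalanche.isJumpProcess_fragProcess r ((hξ 0).comp (measurePreserving_eval_infinitePi P 0)) x
  refine ⟨⟨∀ n, Ω n, inferInstance, Measure.infinitePi P, inferInstance, _, hZ⟩,
    ∀ n, Ω n, inferInstance, Measure.infinitePi P, inferInstance, _, _, _,
    Avalanche.isWeakSolution_fragProcess r hξ x, fun Ω' _ P' _ X hX => hZ.map_eq hX⟩
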